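/- Let $k$ be a perfect field of characteristic $p>0$, $K=W(k)[1/p]$ with its Frobenius $\sigma$, $L$ an extension field of $K$, and $\Gamma\neq 0$ a subgroup of $\mathbb{R}$. **Filtrations.** For a subgroup $\Delta\subset\mathbb{R}$ and a finite dimensional vector space $E$ over a field, a $\Delta$-filtration on $E$ is a family $\mathcal{A}^{x}=\bigoplus_{\eta\in\Delta,\ \eta\ge x}\mathcal{G}_\eta$ attached to some decomposition $E=\bigoplus_{\eta\in\Delta}\mathcal{G}_\eta$; indexing by all $x\in\mathbb{R}$, we regard $\Delta$-filtrations as $\mathbb{R}$-filtrations. Put $\mathcal{A}_+^{\gamma}=\bigcup_{\eta>\gamma}\mathcal{A}^{\eta}$, $\deg\mathcal{A}=\sum_\gamma \gamma\cdot\dim(\mathcal{A}^\gamma/\mathcal{A}^\gamma_+)$, $$\langle\mathcal{A},\mathcal{B}\rangle=\sum_{\gamma_1,\gamma_2}\gamma_1\gamma_2\cdot\dim\frac{\mathcal{A}^{\gamma_1}\cap\mathcal{B}^{\gamma_2}}{\mathcal{A}_+^{\gamma_1}\cap\mathcal{B}^{\gamma_2}+\mathcal{A}^{\gamma_1}\cap\mathcal{B}_+^{\gamma_2}},\qquad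 d(\mathcal{A},\mathcal{B})=\sqrt{\langle\mathcal{A},\mathcal{A}\rangle+\langle\mathcal{B},\mathcal{B}\rangle-2\langle\mathcal{A},\mathcal{B}\rangle}.$$ Subspaces and subquotients of $E$ carry the induced filtrations. **Filtered isocrystals.** Let $V$ be a finite dimensional $K$-vector space with a $\sigma$-linear bijection $\varphi$, let $\mathcal{F}_H$ be a $\Gamma$-filtration on $V_L=L\otimes_K V$, let $V=\bigoplus_{\lambda\in\mathbb{Q}}V_\lambda$ be the slope decomposition ($V_\lambda$ is the union of the finitely generated $W(k)$-submodules $M$ with $\varphi^h(M)=p^dM$, where $\lambda=d/h$ and $h>0$), and let $\mathcal{F}_N^{x}=\bigoplus_{\eta\ge x}V_\eta$ and $(\mathcal{F}_N^{\iota})^{x}=\bigoplus_{\eta\ge x}V_{-\eta}$. For a filtration $\Xi$ on $V$, $\langle\mathcal{F}_H,\Xi\rangle$ means $\langle\mathcal{F}_H,\Xi_L\rangle$ with $\Xi_L=L\otimes_K\Xi$. Assume that $(V,\varphi,\mathcal{F}_H)$ is weakly admissible: $\deg\mathcal{F}_H=\deg\mathcal{F}_N$, and $\deg(\mathcal{F}_H|W_L)\le\deg(\mathcal{F}_N|W)$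 for every $\varphi$-stable $K$-subspace $W$ of $V$. Weak admissibility of a $\varphi$-stable subspace or subquotient of $V$ is defined in the same way, with the induced structures. Let $\mathbf{F}^\Delta(V)$ be the set of $\Delta$-filtrations on $V$, $\mathbf{F}^\Delta(V,\varphi)$ its subset of filtrations by $\varphi$-stable subspaces, and $\mathbf{F}^\Delta(V,\varphi,\mathcal{F})$ its subset of filtrations by $\varphi$-stable weakly admissible subspaces. The Fargues filtration $\mathcal{F}_F$ is the Harder–Narasimhan filtration of $(V,\varphi,\mathcal{F}_H)$ among weakly admissible objects for the slope $\mu=\deg(\mathcal{F}_N^\iota)/\dim$: it is the unique $\mathbb{R}$-filtration of $V$ by weakly admissible $\varphi$-stable subspaces such that each nonzero $\mathrm{Gr}^\gamma=\mathcal{F}_F^\gamma/\mathcal{F}_{F,+}^\gamma$ is weakly admissible and semi-stable of slope $\gamma$, i.e. $\mu(\mathrm{Gr}^\gamma)=\gamma$ and $\mu(X)\le\gamma$ for every nonzero weakly admissible subspace $X$ of $\mathrm{Gr}^\gamma$. **Lemma 5.2.** 1. For every subgroup $0\neq\Delta\subset\mathbb{R}$, $$\mathbf{F}^{\Delta}(V,\varphi,\mathcal{F})=\{\Xi\in\mathbf{F}^{\Delta}(V,\varphi):\langle\mathcal{F}_H,\Xi\rangle=\langle\mathcal{F}_N,\Xi\rangle\}.$$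 2. $\mathbf{F}^{\mathbb{R}}(V,\varphi,\mathcal{F})$ is a closed convex subset of $(\mathbf{F}^{\mathbb{R}}(V),d)$; convex means that any two of its points are joined by a geodesic of $\mathbf{F}^{\mathbb{R}}(V)$ and that every such geodesic is contained in it. 3. $\mathcal{F}_N^\iota\in\mathbf{F}^{\mathbb{Q}}(V,\varphi)$, the Fargues filtration $\mathcal{F}_F$ exists, is unique and belongs to $\mathbf{F}^{\mathbb{Q}}(V,\varphi,\mathcal{F})$, and it is the image of $\mathcal{F}_N^\iota$ under the convex projection to $\mathbf{F}^{\mathbb{R}}(V,\varphi,\mathcal{F})$, i.e. the unique point of $\mathbf{F}^{\mathbb{R}}(V,\varphi,\mathcal{F})$ nearest to $\mathcal{F}_N^\iota$ for $d$. -/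

import Mathlib

open scoped TensorProduct Isocrystal

namespace FilteredIsocrystal

noncomputable section

/-! ### Filtrations by subspaces, indexed by real numbers -/

section Filtrations

variable {F : Type*} [Field F] {E : Type*} [AddCommGroup E] [Module F E]

/-- The set of `Γ`-filtrations on the vector space `E`: the families `Fil(G)` attached to a
`Γ`-graduation `E = ⊕_{η ∈ Γ} G η` by the formula `Fil(G)^x = ⊕_{η ∈ Γ, η ≥ x} G η`.
All filtrations are indexed by the real numbers, so that `Γ`-filtrations are among the
`ℝ`-filtrations (those which only jump at elements of `Γ`); such a family is determined by its
restriction to the indices in `Γ`, and every choice of `G` is allowed. -/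
def filtrations (Γ : AddSubgroup ℝ) (F : Type*) [Field F] (E : Type*) [AddCommGroup E]
    [Module F E] : Set (ℝ → Submodule F E) :=
  {A | open Classical in ∃ G : Γ → Submodule F E, DirectSum.IsInternal G ∧
    ∀ x : ℝ, A x = ⨆ (η : Γ) (_ : x ≤ (η : ℝ)), G η}

/-- `A₊^γ = ⋃_{η > γ} A^η` (an increasing union, hence a supremum). -/
def plus (A : ℝ → Submodule F E) (γ : ℝ) : Submodule F E :=
  ⨆ (η : ℝ) (_ : γ < η), A η

/-- The degree `∑_γ dim (A^γ / A₊^γ) · γ`. -/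
def degree (A : ℝ → Submodule F E) : ℝ :=
  ∑ᶠ γ : ℝ, (Module.finrank F (A γ ⧸ (plus A γ).submoduleOf (A γ)) : ℝ) * γ

/-- The scalar product `⟨A, B⟩ = ∑_{γ₁, γ₂} dim (A^γ₁ ∩ B^γ₂ /
(A₊^γ₁ ∩ B^γ₂ + A^γ₁ ∩ B₊^γ₂)) · γ₁ γ₂`. -/
def scalarProduct (A B : ℝ → Submodule F E) : ℝ :=
  ∑ᶠ γ : ℝ × ℝ,
    (Module.finrank F (↥(A γ.1 ⊓ B γ.2) ⧸
      (plus A γ.1 ⊓ B γ.2 ⊔ A γ.1 ⊓ plus B γ.2).submoduleOf (A γ.1 ⊓ B γ.2)) : ℝ) *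
      (γ.1 * γ.2)

/-- The distance `d(A, B) = √(‖A‖² + ‖B‖² - 2 ⟨A, B⟩)`, with `‖A‖² = ⟨A, A⟩`. -/
def filDist (A B : ℝ → Submodule F E) : ℝ :=
  √(scalarProduct A A + scalarProduct B B - 2 * scalarProduct A B)

/-- The family induced by `A` on a subspace `W`. -/
def restrict (A : ℝ → Submodule F E) (W : Submodule F E) : ℝ → Submodule F W :=
  fun γ ↦ (A γ).submoduleOf W

/-- The family induced by `A` on a subquotient `W / U`, for `U ≤ W`: the images of the
`A^γ ∩ W`. -/
def subquotient (A : ℝ → Submodule F E) (U W : Submodule F E) :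
    ℝ → Submodule F (W ⧸ U.submoduleOf W) :=
  fun γ ↦ (restrict A W γ).map (U.submoduleOf W).mkQ

/-- The degree of the family induced by `A` on a subspace `W`. -/
def degreeOn (A : ℝ → Submodule F E) (W : Submodule F E) : ℝ :=
  degree (restrict A W)

/-- The degree of the family induced by `A` on a subquotient `W / U`, for `U ≤ W`. -/
def degreeSubquotient (A : ℝ → Submodule F E) (U W : Submodule F E) : ℝ :=
  degree (subquotient A U W)

/-- Extension of scalars of a family of subspaces. -/
def baseChange (L : Type*) [Field L] [Algebra F L] (A : ℝ → Submodule F E) :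
    ℝ → Submodule L (L ⊗[F] E) :=
  fun γ ↦ (A γ).baseChange L

/-- `S` is a closed subset of `X` for the distance `filDist`. -/
def IsClosedIn (X S : Set (ℝ → Submodule F E)) : Prop :=
  S ⊆ X ∧ ∀ A ∈ X, (∀ ε : ℝ, 0 < ε → ∃ B ∈ S, filDist A B < ε) → A ∈ S

/-- `c`, restricted to `[0, ℓ]`, is a geodesic of `X` from `A` to `B`. -/
def IsGeodesic (X : Set (ℝ → Submodule F E)) (A B : ℝ → Submodule F E) (ℓ : ℝ)
    (c : ℝ → (ℝ → Submodule F E)) : Prop :=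
  0 ≤ ℓ ∧ c 0 = A ∧ c ℓ = B ∧ (∀ t ∈ Set.Icc 0 ℓ, c t ∈ X) ∧
    ∀ s ∈ Set.Icc 0 ℓ, ∀ t ∈ Set.Icc 0 ℓ, filDist (c s) (c t) = |s - t|

/-- `S` is a convex subset of `X`: any two points of `S` are joined by a geodesic of `X`, and
every such geodesic is contained in `S`. -/
def IsConvexIn (X S : Set (ℝ → Submodule F E)) : Prop :=
  S ⊆ X ∧ ∀ A ∈ S, ∀ B ∈ S, (∃ ℓ c, IsGeodesic X A B ℓ c) ∧
    ∀ ℓ c, IsGeodesic X A B ℓ c → ∀ t ∈ Set.Icc 0 ℓ, c t ∈ S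

/-- `B` is the convex projection of `A` to `S`: the unique point of `S` nearest to `A`. -/
def IsConvexProjection (S : Set (ℝ → Submodule F E)) (A B : ℝ → Submodule F E) : Prop :=
  B ∈ S ∧ ∀ C ∈ S, C ≠ B → filDist A B < filDist A C

end Filtrations

/-- The group of rational numbers, inside the real numbers. -/
def rationals : AddSubgroup ℝ := (Rat.castHom ℝ).toAddMonoidHom.range

/-! ### Isocrystals and their Newton filtrations -/

section Isocrystals

variable (p : ℕ) [Fact p.Prime] (k : Type*) [Field k] [CharP k p] [PerfectRing k p]
variable (V : Type*) [AddCommGroup V] [WittVector.Isocrystal p k V]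

variable {V} in
/-- The `σ`-linear Frobenius `φ` of the isocrystal `V`, as a map. -/
def frob : V → V :=
  (WittVector.Isocrystal.frobenius p k : V ≃ᶠˡ[p, k] V).toFun

/-- The slope `s` part of the isocrystal `V`: the union of all finitely generated
`W(k)`-submodules `M` of `V` such that `φ^h(M) = p^d M`, where `s = d / h` with `h > 0`.
This union is a `K`-subspace, so that taking its span does not change it. -/
def slopePart (s : ℚ) : Submodule K(p, k) V :=
  letI : Module (WittVector p k) V :=
    Module.compHom V (algebraMap (WittVector p k) K(p, k))
  Submodule.span K(p, k)
    {x | ∃ (d : ℤ) (h : ℕ) (M : Submodule (WittVector p k) V),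
      0 < h ∧ s = (d : ℚ) / (h : ℚ) ∧ M.FG ∧ x ∈ M ∧
      (frob p k)^[h] '' (M : Set V) =
        (fun y : V ↦ (p : K(p, k)) ^ d • y) '' (M : Set V)}

/-- The Newton filtration `F_N^x = ⊕_{η ≥ x} V_η`. -/
def newton : ℝ → Submodule K(p, k) V :=
  fun x ↦ ⨆ (η : ℚ) (_ : x ≤ (η : ℝ)), slopePart p k V η

/-- The opposed Newton filtration `x ↦ ⊕_{η ≥ x} V_{-η}`. -/
def newtonOpp : ℝ → Submodule K(p, k) V :=
  fun x ↦ ⨆ (η : ℚ) (_ : x ≤ (η : ℝ)), slopePart p k V (-η)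

variable {V}

/-- A `φ`-stable `K`-subspace. -/
def IsStable (W : Submodule K(p, k) V) : Prop :=
  ∀ x ∈ W, frob p k x ∈ W

variable {L : Type*} [Field L] [Algebra K(p, k) L]

/-- The filtered isocrystal `(V, φ, FH)`, with `FH` a filtration on `V_L`, is weakly
admissible. -/
def IsWeaklyAdmissible (FH : ℝ → Submodule L (L ⊗[K(p, k)] V)) : Prop :=
  degree FH = degree (newton p k V) ∧
    ∀ W : Submodule K(p, k) V, IsStable p k W →
      degreeOn FH (W.baseChange L) ≤ degreeOn (newton p k V) W

/-- `W` is a (`φ`-stable) weakly admissible subspace of `(V, φ, FH)`: it is weakly admissible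
for the structures induced by those of `V`. -/
def IsWeaklyAdmissibleSub (FH : ℝ → Submodule L (L ⊗[K(p, k)] V))
    (W : Submodule K(p, k) V) : Prop :=
  IsStable p k W ∧
    degreeOn FH (W.baseChange L) = degreeOn (newton p k V) W ∧
    ∀ W' : Submodule K(p, k) V, W' ≤ W → IsStable p k W' →
      degreeOn FH (W'.baseChange L) ≤ degreeOn (newton p k V) W'

/-- The subquotient `W / U` of `(V, φ, FH)` is weakly admissible, for the structures induced by
those of `V`. Its `φ`-stable subspaces are the `W' / U`, with `W'` a `φ`-stable subspace such
that `U ≤ W' ≤ W`. -/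
def IsWeaklyAdmissibleSubquotient (FH : ℝ → Submodule L (L ⊗[K(p, k)] V))
    (U W : Submodule K(p, k) V) : Prop :=
  IsStable p k U ∧ IsStable p k W ∧ U ≤ W ∧
    degreeSubquotient FH (U.baseChange L) (W.baseChange L) =
      degreeSubquotient (newton p k V) U W ∧
    ∀ W' : Submodule K(p, k) V, U ≤ W' → W' ≤ W → IsStable p k W' →
      degreeSubquotient FH (U.baseChange L) (W'.baseChange L) ≤
        degreeSubquotient (newton p k V) U W'

/-- The slope `μ = deg / dim` of a subquotient `W / U`, where the degree is that of the opposed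
Newton filtration. -/
def farguesSlope (U W : Submodule K(p, k) V) : ℝ :=
  degreeSubquotient (newtonOpp p k V) U W /
    (Module.finrank K(p, k) (W ⧸ U.submoduleOf W) : ℝ)

/-- The subquotient `W / U` is a nonzero weakly admissible object which is semi-stable among
weakly admissible objects: its nonzero weakly admissible subspaces `W' / U` have slope at most
that of `W / U`. -/
def IsSemistable (FH : ℝ → Submodule L (L ⊗[K(p, k)] V)) (U W : Submodule K(p, k) V) : Prop :=
  U < W ∧ IsWeaklyAdmissibleSubquotient p k FH U W ∧
    ∀ W' : Submodule K(p, k) V, U < W' → W' ≤ W →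
      IsWeaklyAdmissibleSubquotient p k FH U W' → farguesSlope p k U W' ≤ farguesSlope p k U W

variable (V) in
/-- The `Δ`-filtrations on `V` by `φ`-stable `K`-subspaces. -/
def stableFiltrations (Δ : AddSubgroup ℝ) : Set (ℝ → Submodule K(p, k) V) :=
  {Ξ ∈ filtrations Δ K(p, k) V | ∀ γ, IsStable p k (Ξ γ)}

/-- The `Δ`-filtrations on `V` by `φ`-stable weakly admissible `K`-subspaces. -/
def admissibleFiltrations (FH : ℝ → Submodule L (L ⊗[K(p, k)] V)) (Δ : AddSubgroup ℝ) :
    Set (ℝ → Submodule K(p, k) V) :=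
  {Ξ ∈ stableFiltrations p k V Δ | ∀ γ, IsWeaklyAdmissibleSub p k FH (Ξ γ)}

/-- `Ξ` is the Fargues filtration of the weakly admissible `(V, φ, FH)`, i.e. its
Harder-Narasimhan filtration among weakly admissible objects for the slope function `farguesSlope`: a
filtration by weakly admissible subspaces whose nonzero graded pieces `Ξ^γ / Ξ₊^γ` are
semi-stable of slope `γ`. -/
def IsFargues (FH : ℝ → Submodule L (L ⊗[K(p, k)] V))
    (Ξ : ℝ → Submodule K(p, k) V) : Prop :=
  Ξ ∈ admissibleFiltrations p k FH ⊤ ∧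
    ∀ γ : ℝ, plus Ξ γ ≠ Ξ γ →
      IsSemistable p k FH (plus Ξ γ) (Ξ γ) ∧ farguesSlope p k (plus Ξ γ) (Ξ γ) = γ

end Isocrystals

end

end FilteredIsocrystal

open FilteredIsocrystal

/-!
The proof combines the metric geometry of the space of filtrations with the slope decomposition of
isocrystals.

Any two filtrations `A` and `B` of a finite dimensional space are split by a common basis
(`exists_common_basis`). In such a basis the scalar product and the distance are those of the
weight vectors, and it follows that `⟨A, B⟩ = ∑_γ γ (deg (A|B^γ) - deg (A|B₊^γ))`, the Choquet
integral (`choquet`) along `B` of the function `W ↦ deg (A|W)`. By Abel summation this integral is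
a strictly increasing function of the degrees on the steps, the total degree being fixed
(`choquet_mono`). For a filtration `Ξ` by stable subspaces, both `⟨F_H, Ξ⟩` and `⟨F_N, Ξ⟩` are
such integrals along `Ξ`, and weak admissibility says that the degrees of `F_H` on the steps are
bounded by those of `F_N`. So the scalar products are equal exactly when the degrees agree on all
the steps, that is, when the steps are weakly admissible.

The degree induced on a subspace is a supermodular function of this subspace
(`degreeOn_supermodular`). This implies that `⟨X, ·⟩` is concave on the filtrations split by a
given basis (`scalarProduct_concave`), hence that geodesics are unique: they are the segments in a
common splitting (`eq_barycenter`). The steps of a point of such a segment are sums of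
intersections of steps of its ends, so that filtrations with steps in a sublattice form a convex
set (`isConvexIn_of_steps`); this set is closed because filtrations close to `A` have the steps of
`A` among theirs (`isClosedIn_of_steps`). The weakly admissible subspaces do form a lattice
(`IsWeaklyAdmissible.sup_inf`), since the degree of `F_H` is supermodular while that of `F_N` is
modular on stable subspaces.

Harder-Narasimhan filtrations for a modular degree function `δ` on a lattice of subspaces are
obtained by taking for the step of index `γ` the greatest maximizer of `δ W - γ dim W`
(`exists_isHarderNarasimhan`). If `δ` is the degree induced by a filtration `N`, semi-stability
gives `⟨N, Ξ⟩ = ⟨Ξ, Ξ⟩` and `⟨N, Ξ'⟩ ≤ ⟨Ξ, Ξ'⟩` for the Harder-Narasimhan filtration `Ξ` and for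
every `Ξ'` with steps in the lattice, so that `Ξ` is the only nearest point to `N`
(`IsHarderNarasimhan.filDist_lt`). Applied to the opposed Newton filtration, this identifies the
Fargues filtration with the convex projection and shows its uniqueness.

The slope decomposition of an isocrystal (`isInternal_slopePart`) and its compatibility with
stable subspaces are deduced from the same statements over a complete discrete valuation ring `O`
with uniformizer `p`, for a semilinear automorphism `f`. The first slope `d / h` of the Newton
polygon of a relation between the iterates of a vector gives a lattice which `p ^ (-d) f ^ h` maps
into itself without being topologically nilpotent; the intersection of the images of this lattice
by the powers of the operator is nonzero by linear compactness of finitely generated `O`-modules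
(`exists_fixed_submodule_ne_bot`). By the same compactness, lattices on which the operator is
bijective lift from the quotient by a part of given slope (`exists_fixed_lift`), so that the parts
of the various slopes span by induction on the dimension (`iSup_slopeComponent`). They are
independent because, on a sum of parts of slopes larger than `d / h`, the operator
`p ^ (-d) f ^ h` is topologically nilpotent (`disjoint_slopeComponent`).
-/

namespace FilteredIsocrystal

open Module

/-! ### Bases adapted to two chains of subspaces -/

section LinearAlgebra

variable {F : Type*} [Field F] {E : Type*} [AddCommGroup E] [Module F E] {ι : Type*}

theorem basis_mem_span_image_iff (b : Basis ι F E) (S : Set ι) (i : ι) :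
    b i ∈ Submodule.span F (b '' S) ↔ i ∈ S := by
  rw [b.mem_span_image]
  simp

theorem span_image_inf_span_image (b : Basis ι F E) (S T : Set ι) :
    Submodule.span F (b '' S) ⊓ Submodule.span F (b '' T) = Submodule.span F (b '' (S ∩ T)) := by
  ext x
  simp [b.mem_span_image]

theorem span_image_sup_span_image (b : Basis ι F E) (S T : Set ι) :
    Submodule.span F (b '' S) ⊔ Submodule.span F (b '' T) = Submodule.span F (b '' (S ∪ T)) := by
  rw [Set.image_union, Submodule.span_union]

theorem span_image_le_span_image_iff (b : Basis ι F E) (S T : Set ι) :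
    Submodule.span F (b '' S) ≤ Submodule.span F (b '' T) ↔ S ⊆ T := by
  refine ⟨fun h i hi ↦ ?_, fun h ↦ Submodule.span_mono (Set.image_mono h)⟩
  exact (basis_mem_span_image_iff b T i).1 (h ((basis_mem_span_image_iff b S i).2 hi))

theorem span_image_injective (b : Basis ι F E) :
    Function.Injective fun S : Set ι ↦ Submodule.span F (b '' S) := fun S T h ↦
  le_antisymm ((span_image_le_span_image_iff b S T).1 h.le)
    ((span_image_le_span_image_iff b T S).1 h.ge)

theorem finrank_span_image (b : Basis ι F E) (S : Set ι) :
    finrank F (Submodule.span F (b '' S)) = S.ncard := by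
  have h := b.linearIndependent.comp ((↑) : S → ι) Subtype.val_injective
  have h2 : Set.range (b ∘ ((↑) : S → ι)) = b '' S := by
    rw [Set.range_comp, Subtype.range_coe]
  rw [← h2, Module.finrank_eq_nat_card_basis (Basis.span h)]
  rfl

/-- `b` is adapted to the subspace `W` when `W` is spanned by a part of the basis `b`. -/
def IsAdapted (b : Basis ι F E) (W : Submodule F E) : Prop :=
  ∃ S : Set ι, W = Submodule.span F (b '' S)

theorem IsAdapted.eq_span {b : Basis ι F E} {W : Submodule F E} (h : IsAdapted b W) :
    W = Submodule.span F (b '' {i | b i ∈ W}) := by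
  obtain ⟨S, rfl⟩ := h
  simp only [basis_mem_span_image_iff]
  rfl

/-- Two chains of subspaces admit a common adapted basis. The line and the hyperplane used in the
induction are chosen so that every member of the two chains contains the line or is contained
in the hyperplane. -/
theorem exists_basis_isAdapted (n : ℕ) : ∀ {E : Type*} [AddCommGroup E] [Module F E]
    [FiniteDimensional F E], finrank F E = n → ∀ C D : Set (Submodule F E),
    IsChain (· ≤ ·) C → IsChain (· ≤ ·) D →
    ∃ b : Basis (Fin n) F E, ∀ W ∈ C ∪ D, IsAdapted b W := by
  induction n with
  | zero =>
    intro E _ _ _ hn C D _ _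
    have : Subsingleton E := finrank_zero_iff.1 hn
    exact ⟨Module.finBasisOfFinrankEq F E hn, fun W _ ↦ ⟨∅, Subsingleton.elim _ _⟩⟩
  | succ n ih =>
    intro E _ _ _ hn C D hC hD
    have hne : Nontrivial E := Module.nontrivial_of_finrank_pos (R := F) (by omega)
    -- the smallest nonzero member of `C`, then the smallest nonzero trace on it of a member of `D`
    obtain ⟨A, ⟨hA, hA0⟩, hAmin⟩ := wellFounded_lt.has_min
      {A : Submodule F E | A ∈ insert ⊤ C ∧ A ≠ ⊥} ⟨⊤, by simp, top_ne_bot⟩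
    obtain ⟨W, ⟨⟨B, hB, rfl⟩, hW0⟩, hWmin⟩ := wellFounded_lt.has_min
      {W : Submodule F E | (∃ B ∈ insert ⊤ D, W = A ⊓ B) ∧ W ≠ ⊥}
        ⟨A, ⟨⊤, by simp, by simp⟩, hA0⟩
    obtain ⟨v, hv, hv0⟩ := Submodule.exists_mem_ne_zero_of_ne_bot hW0
    have hC' : IsChain (· ≤ ·) (insert ⊤ C) := hC.insert fun _ _ _ ↦ Or.inr le_top
    have hD' : IsChain (· ≤ ·) (insert ⊤ D) := hD.insert fun _ _ _ ↦ Or.inr le_top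
    have hCv : ∀ X ∈ C, v ∈ X ∨ X = ⊥ := by
      intro X hX
      by_cases h0 : X = ⊥
      · exact Or.inr h0
      refine Or.inl ?_
      rcases hC'.total hA (Set.mem_insert_of_mem _ hX) with h | h
      · exact h hv.1
      · have := hAmin X ⟨Set.mem_insert_of_mem _ hX, h0⟩
        rw [eq_of_le_of_not_lt h this]
        exact hv.1
    have hDv : ∀ X ∈ D, v ∉ X → X ⊓ A = ⊥ := by
      intro X hX hvX
      by_contra h0
      rcases hD'.total hB (Set.mem_insert_of_mem _ hX) with h | h
      · exact hvX (h hv.2)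
      · have := hWmin (A ⊓ X) ⟨⟨X, Set.mem_insert_of_mem _ hX, rfl⟩, by rwa [inf_comm]⟩
        have h2 := eq_of_le_of_not_lt (inf_le_inf_left A h) this
        exact hvX (h2.ge hv).2
    -- the hyperplane
    obtain ⟨P, hvP, hP⟩ : ∃ P : Submodule F E, v ∉ P ∧ ∀ X ∈ D, v ∉ X → X ≤ P := by
      by_cases hne : {X ∈ D | v ∉ X}.Nonempty
      · obtain ⟨P, hP, hmax⟩ := wellFounded_gt.has_min {X ∈ D | v ∉ X} hne
        refine ⟨P, hP.2, fun X hX hvX ↦ ?_⟩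
        rcases hD.total hX hP.1 with h | h
        · exact h
        · exact (eq_of_le_of_not_lt h (hmax X ⟨hX, hvX⟩)).ge
      · exact ⟨⊥, by simpa using hv0, fun X hX hvX ↦ (hne ⟨X, hX, hvX⟩).elim⟩
    obtain ⟨f, hfv, hfP⟩ : ∃ f : E →ₗ[F] F, f v = 1 ∧ P ≤ LinearMap.ker f := by
      obtain ⟨f, hf, hP⟩ := Submodule.exists_le_ker_of_notMem hvP
      refine ⟨(f v)⁻¹ • f, by simp [hf], fun x hx ↦ ?_⟩
      have := hP hx
      simp only [LinearMap.mem_ker] at this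
      simp [this]
    set H := LinearMap.ker f with hH
    have hdim : finrank F H = n := by
      have h1 := LinearMap.finrank_range_add_finrank_ker f
      have h2 : LinearMap.range f = ⊤ := LinearMap.range_eq_top.2 fun c ↦ ⟨c • v, by simp [hfv]⟩
      rw [h2, finrank_top, finrank_self, hn] at h1
      rw [hH]
      omega
    have hdich : ∀ X ∈ C ∪ D, v ∈ X ∨ X ≤ H := by
      rintro X (hX | hX)
      · exact (hCv X hX).imp_right fun h ↦ h.trans_le bot_le
      · by_cases hvX : v ∈ X
        · exact Or.inl hvX
        · exact Or.inr ((hP X hX hvX).trans hfP)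
    have hcomap : ∀ {Y : Set (Submodule F E)}, IsChain (· ≤ ·) Y →
        IsChain (· ≤ ·) ((fun X ↦ X.comap H.subtype) '' Y) := by
      rintro Y hY _ ⟨X, hX, rfl⟩ _ ⟨Z, hZ, rfl⟩ _
      exact (hY.total hX hZ).imp Submodule.comap_mono Submodule.comap_mono
    obtain ⟨b, hb⟩ := ih hdim ((fun X ↦ X.comap H.subtype) '' C) ((fun X ↦ X.comap H.subtype) '' D)
      (hcomap hC) (hcomap hD)
    have hli : ∀ c : F, ∀ x ∈ H, c • v + x = 0 → c = 0 := by
      intro c x hx h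
      have := congrArg f h
      simpa [hfv, LinearMap.mem_ker.1 hx] using this
    have hsp : ∀ z : E, ∃ c : F, z + c • v ∈ H := fun z ↦
      ⟨-f z, by simp [hH, LinearMap.mem_ker, hfv]⟩
    refine ⟨Basis.mkFinCons v b hli hsp, fun X hX ↦ ?_⟩
    have hbX : IsAdapted b (X.comap H.subtype) := by
      rcases hX with hX | hX
      · exact hb _ (Or.inl ⟨X, hX, rfl⟩)
      · exact hb _ (Or.inr ⟨X, hX, rfl⟩)
    set b' := Basis.mkFinCons v b hli hsp with hb'
    have hb0 : b' 0 = v := by simp [hb', Basis.coe_mkFinCons]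
    have hbs : ∀ i : Fin n, b' i.succ = b i := fun i ↦ by simp [hb', Basis.coe_mkFinCons]
    refine ⟨{i | b' i ∈ X}, le_antisymm (fun x hx ↦ ?_) ?_⟩
    · have key : ∀ y : H, (y : E) ∈ X → (y : E) ∈ Submodule.span F (b' '' {i | b' i ∈ X}) := by
        intro y hy
        have h1 : y ∈ X.comap H.subtype := hy
        rw [hbX.eq_span] at h1
        have h2 := Submodule.mem_map_of_mem (f := H.subtype) h1
        rw [Submodule.map_span] at h2
        refine Submodule.span_mono ?_ h2
        rintro _ ⟨_, ⟨i, hi, rfl⟩, rfl⟩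
        exact ⟨i.succ, by simpa [hbs] using hi, hbs i⟩
      rcases hdich X hX with hvX | hXH
      · have h3 : x - f x • v ∈ X := X.sub_mem hx (X.smul_mem _ hvX)
        have h4 := key ⟨x - f x • v, by simp [hH, LinearMap.mem_ker, hfv]⟩ h3
        have h5 : v ∈ Submodule.span F (b' '' {i | b' i ∈ X}) :=
          Submodule.subset_span ⟨0, by simpa [hb0] using hvX, hb0⟩
        have := Submodule.add_mem _ h4 (Submodule.smul_mem _ (f x) h5)
        simpa using this
      · exact key ⟨x, hXH hx⟩ hx
    · rw [Submodule.span_le]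
      rintro _ ⟨i, hi, rfl⟩
      exact hi

end LinearAlgebra

/-! ### Filtrations given by weights on a basis -/

section Weights

variable {F : Type*} [Field F] {E : Type*} [AddCommGroup E] [Module F E] {ι : Type*}

/-- The filtration of `E` attached to a basis `b` and to real weights `w` of its members: its step
of index `x` is spanned by the basis vectors of weight at least `x`. -/
def filOf (b : Basis ι F E) (w : ι → ℝ) : ℝ → Submodule F E :=
  fun x ↦ Submodule.span F (b '' {i | x ≤ w i})

theorem filOf_antitone (b : Basis ι F E) (w : ι → ℝ) : Antitone (filOf b w) := fun _ _ h ↦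
  Submodule.span_mono (Set.image_mono fun _ hi ↦ h.trans hi)

theorem filOf_reindex {κ : Type*} (b : Basis ι F E) (w : ι → ℝ) (e : κ ≃ ι) :
    filOf (b.reindex e.symm) (w ∘ e) = filOf b w := by
  funext x
  unfold filOf
  congr 1
  ext v
  constructor
  · rintro ⟨i, hi, rfl⟩
    exact ⟨e i, hi, by simp⟩
  · rintro ⟨i, hi, rfl⟩
    exact ⟨e.symm i, by simpa using hi, by simp⟩

/-- The right neighbourhoods of `γ` avoid a finite set of weights. -/
theorem exists_forall_lt_le [Finite ι] (w : ι → ℝ) (γ : ℝ) :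
    ∃ γ' > γ, ∀ i, γ < w i → γ' ≤ w i := by
  have h : ∀ᶠ η in nhdsWithin γ (Set.Ioi γ), ∀ i, γ < w i → η ≤ w i := by
    refine Filter.eventually_all.2 fun i ↦ ?_
    by_cases hi : γ < w i
    · filter_upwards [Ioc_mem_nhdsGT hi] with η hη _ using hη.2
    · exact Filter.Eventually.of_forall fun _ h ↦ (hi h).elim
  obtain ⟨γ', h1, h2⟩ := (h.and self_mem_nhdsWithin).exists
  exact ⟨γ', h2, h1⟩

/-- The supremum defining `plus` is attained at every index slightly larger than `γ`. -/
theorem exists_plus_filOf_eq [Finite ι] (b : Basis ι F E) (w : ι → ℝ) (γ : ℝ) :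
    plus (filOf b w) γ = Submodule.span F (b '' {i | γ < w i}) ∧
      ∃ γ' > γ, ∀ η, γ < η → η ≤ γ' → filOf b w η = plus (filOf b w) γ := by
  obtain ⟨γ', hγ, h⟩ := exists_forall_lt_le w γ
  have h1 : ∀ η, γ < η → η ≤ γ' → filOf b w η = Submodule.span F (b '' {i | γ < w i}) := by
    intro η h1 h2
    unfold filOf
    congr 2
    ext i
    exact ⟨fun hi ↦ h1.trans_le hi, fun hi ↦ h2.trans (h i hi)⟩
  have h2 : plus (filOf b w) γ = Submodule.span F (b '' {i | γ < w i}) := by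
    refine le_antisymm (iSup₂_le fun η hη ↦ Submodule.span_mono (Set.image_mono ?_)) ?_
    · exact fun i hi ↦ lt_of_lt_of_le hη hi
    · rw [← h1 γ' hγ le_rfl]
      exact le_iSup₂_of_le γ' hγ le_rfl
  exact ⟨h2, γ', hγ, fun η h3 h4 ↦ (h1 η h3 h4).trans h2.symm⟩

theorem filOf_mem_filtrations [Finite ι] (b : Basis ι F E) (w : ι → ℝ) {Γ : AddSubgroup ℝ}
    (hw : ∀ i, w i ∈ Γ) : filOf b w ∈ filtrations Γ F E := by
  classical
  refine ⟨fun η ↦ Submodule.span F (b '' {i | w i = η}), ?_, fun x ↦ ?_⟩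
  · rw [DirectSum.isInternal_submodule_iff_iSupIndep_and_iSup_eq_top]
    constructor
    · intro η
      rw [← Submodule.span_iUnion₂, ← Set.image_iUnion₂]
      refine b.linearIndependent.disjoint_span_image ?_
      rw [Set.disjoint_left]
      intro i hi hi'
      simp only [Set.mem_iUnion, Set.mem_ofPred_eq, exists_prop] at hi hi'
      obtain ⟨η', h1, h2⟩ := hi'
      exact h1 (Subtype.ext (h2.symm.trans hi))
    · rw [eq_top_iff, ← b.span_eq, Submodule.span_le]
      rintro _ ⟨i, rfl⟩
      exact Submodule.mem_iSup_of_mem ⟨w i, hw i⟩ (Submodule.subset_span ⟨i, rfl, rfl⟩)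
  · rw [← Submodule.span_iUnion₂, ← Set.image_iUnion₂]
    unfold filOf
    congr 2
    ext i
    simp only [Set.mem_iUnion, Set.mem_ofPred_eq, exists_prop]
    exact ⟨fun h ↦ ⟨⟨w i, hw i⟩, h, rfl⟩, fun ⟨η, h1, h2⟩ ↦ h2 ▸ h1⟩

/-- A decomposition `E = ⊕ G i` and a weight for each piece give a filtration of the form `filOf`.
The basis does not depend on the weights. -/
theorem exists_filOf_of_isInternal [FiniteDimensional F E] {Λ : Type*} [DecidableEq Λ]
    (G : Λ → Submodule F E) (hG : DirectSum.IsInternal G) :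
    ∃ (b : Basis (Fin (finrank F E)) F E) (l : Fin (finrank F E) → Λ), ∀ w : Λ → ℝ,
      filOf b (w ∘ l) = fun x ↦ ⨆ (i : Λ) (_ : x ≤ w i), G i := by
  let b := hG.collectedBasis fun i ↦ Module.finBasis F (G i)
  have hfin : Fintype (Σ i, Fin (finrank F (G i))) := FiniteDimensional.fintypeBasisIndex b
  have hcard : Fintype.card (Σ i, Fin (finrank F (G i))) = finrank F E :=
    (Module.finrank_eq_card_basis b).symm
  let e := (Fintype.equivFinOfCardEq hcard).symm
  refine ⟨b.reindex e.symm, fun i ↦ (e i).1, fun w ↦ ?_⟩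
  have := filOf_reindex b (fun a ↦ w a.1) e
  refine this.trans ?_
  funext x
  refine le_antisymm (Submodule.span_le.2 ?_) (iSup₂_le fun i hi ↦ ?_)
  · rintro _ ⟨a, ha, rfl⟩
    exact le_iSup₂_of_le (f := fun (i : Λ) (_ : x ≤ w i) ↦ G i) a.1 ha le_rfl
      (hG.collectedBasis_mem _ a)
  · intro v hv
    have h1 : (⟨v, hv⟩ : G i) ∈ Submodule.span F (Set.range (Module.finBasis F (G i))) := by
      rw [Basis.span_eq]; trivial
    have h2 := Submodule.mem_map_of_mem (f := (G i).subtype) h1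
    rw [Submodule.map_span] at h2
    refine Submodule.span_mono ?_ h2
    rintro _ ⟨_, ⟨j, rfl⟩, rfl⟩
    exact ⟨⟨i, j⟩, hi, by simp [b]⟩

theorem exists_filOf_of_mem [FiniteDimensional F E] {Γ : AddSubgroup ℝ} {A : ℝ → Submodule F E}
    (hA : A ∈ filtrations Γ F E) :
    ∃ (b : Basis (Fin (finrank F E)) F E) (w : Fin (finrank F E) → ℝ),
      A = filOf b w ∧ ∀ i, w i ∈ Γ := by
  classical
  obtain ⟨G, hG, h⟩ := hA
  obtain ⟨b, l, hb⟩ := exists_filOf_of_isInternal G (by convert hG)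
  refine ⟨b, fun i ↦ (l i : ℝ), ?_, fun i ↦ (l i).2⟩
  rw [show (fun i ↦ (l i : ℝ)) = (fun η : Γ ↦ (η : ℝ)) ∘ l from rfl, hb]
  exact funext h

theorem antitone_of_mem [FiniteDimensional F E] {Γ : AddSubgroup ℝ} {A : ℝ → Submodule F E}
    (hA : A ∈ filtrations Γ F E) : Antitone A := by
  obtain ⟨b, w, rfl, -⟩ := exists_filOf_of_mem hA
  exact filOf_antitone b w

theorem mem_filtrations_top [FiniteDimensional F E] {Γ : AddSubgroup ℝ} {A : ℝ → Submodule F E}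
    (hA : A ∈ filtrations Γ F E) : A ∈ filtrations ⊤ F E := by
  obtain ⟨b, w, rfl, -⟩ := exists_filOf_of_mem hA
  exact filOf_mem_filtrations b w fun _ ↦ trivial

theorem isChain_range_of_antitone {A : ℝ → Submodule F E} (hA : Antitone A) :
    IsChain (· ≤ ·) (Set.range A) := by
  rintro _ ⟨x, rfl⟩ _ ⟨y, rfl⟩ _
  exact (le_total x y).symm.imp (fun h ↦ hA h) (fun h ↦ hA h)

/-- Along a basis adapted to its steps, a `Γ`-filtration is given by weights in `Γ`: the weight of
a vector is the smallest weight of its coordinates in a basis splitting the filtration. -/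
theorem exists_weights [FiniteDimensional F E] {κ : Type*} {Γ : AddSubgroup ℝ}
    {A : ℝ → Submodule F E}
    (hA : A ∈ filtrations Γ F E) (b : Basis κ F E) (hb : ∀ x, IsAdapted b (A x)) :
    ∃ w : κ → ℝ, A = filOf b w ∧ ∀ i, w i ∈ Γ := by
  obtain ⟨c, w, rfl, hw⟩ := exists_filOf_of_mem hA
  have hne : ∀ i, (c.repr (b i)).support.Nonempty := fun i ↦ by
    rw [Finsupp.support_nonempty_iff]
    simpa using b.ne_zero i
  refine ⟨fun i ↦ (c.repr (b i)).support.inf' (hne i) w, ?_, fun i ↦ ?_⟩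
  · funext x
    rw [(hb x).eq_span, filOf]
    congr 2
    ext i
    simp only [Set.mem_ofPred_eq, Finset.le_inf'_iff]
    exact c.mem_span_image
  · obtain ⟨j, -, hj⟩ := Finset.exists_mem_eq_inf' (hne i) w
    exact Set.mem_of_eq_of_mem hj (hw j)

theorem exists_filOf_isAdapted [FiniteDimensional F E] {Γ : AddSubgroup ℝ} {A : ℝ → Submodule F E}
    (hA : A ∈ filtrations Γ F E) {D : Set (Submodule F E)} (hD : IsChain (· ≤ ·) D) :
    ∃ (b : Basis (Fin (finrank F E)) F E) (w : Fin (finrank F E) → ℝ),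
      A = filOf b w ∧ (∀ i, w i ∈ Γ) ∧ ∀ W ∈ D, IsAdapted b W := by
  obtain ⟨b, hb⟩ := exists_basis_isAdapted _ rfl (Set.range A) D
    (isChain_range_of_antitone (antitone_of_mem hA)) hD
  obtain ⟨w, hw, hw'⟩ := exists_weights hA b fun x ↦ hb _ (Or.inl ⟨x, rfl⟩)
  exact ⟨b, w, hw, hw', fun W hW ↦ hb W (Or.inr hW)⟩

/-- Any two filtrations are split by a common basis. -/
theorem exists_common_basis [FiniteDimensional F E] {Γ Δ : AddSubgroup ℝ} {A B : ℝ → Submodule F E}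
    (hA : A ∈ filtrations Γ F E) (hB : B ∈ filtrations Δ F E) :
    ∃ (b : Basis (Fin (finrank F E)) F E) (w w' : Fin (finrank F E) → ℝ),
      A = filOf b w ∧ B = filOf b w' ∧ (∀ i, w i ∈ Γ) ∧ ∀ i, w' i ∈ Δ := by
  obtain ⟨b, w, h1, h2, h3⟩ := exists_filOf_isAdapted hA
    (isChain_range_of_antitone (antitone_of_mem hB))
  obtain ⟨w', h4, h5⟩ := exists_weights hB b fun x ↦ h3 _ ⟨x, rfl⟩
  exact ⟨b, w, w', h1, h4, h2, h5⟩

/-- A decreasing, exhaustive, separated and left continuous family of subspaces is a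
filtration. -/
theorem mem_filtrations_of_leftContinuous [FiniteDimensional F E] {A : ℝ → Submodule F E}
    (hA : Antitone A) {m M : ℝ} (hm : A m = ⊤) (hM : A M = ⊥) (hl : ∀ x, ∃ y < x, A y = A x) :
    A ∈ filtrations ⊤ F E := by
  obtain ⟨b, hb⟩ := exists_basis_isAdapted _ rfl (Set.range A) ∅
    (isChain_range_of_antitone hA) (by simp)
  have hbdd : ∀ i, BddAbove {x | b i ∈ A x} := fun i ↦ ⟨M, fun x hx ↦ by
    by_contra! h
    have := hA h.le hx
    rw [hM, Submodule.mem_bot] at this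
    exact b.ne_zero i this⟩
  have hmem : ∀ i x, b i ∈ A x ↔ x ≤ sSup {x | b i ∈ A x} := by
    intro i x
    refine ⟨fun h ↦ le_csSup (hbdd i) h, fun h ↦ hA h ?_⟩
    obtain ⟨y, hy, hy'⟩ := hl (sSup {x | b i ∈ A x})
    obtain ⟨z, hz, hz'⟩ := exists_lt_of_lt_csSup (s := {x | b i ∈ A x}) ⟨m, by simp [hm]⟩ hy
    rw [← hy']
    exact hA hz'.le hz
  have : A = filOf b fun i ↦ sSup {x | b i ∈ A x} := by
    funext x
    rw [(hb _ (Or.inl ⟨x, rfl⟩)).eq_span, filOf]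
    congr 2
    ext i
    exact hmem i x
  rw [this]
  exact filOf_mem_filtrations b _ fun _ ↦ trivial

theorem plus_le {A : ℝ → Submodule F E} (hA : Antitone A) (γ : ℝ) : plus A γ ≤ A γ :=
  iSup₂_le fun _ h ↦ hA (le_of_lt h)

theorem exists_plus_eq [FiniteDimensional F E] {Γ : AddSubgroup ℝ} {A : ℝ → Submodule F E}
    (hA : A ∈ filtrations Γ F E) (γ : ℝ) :
    ∃ γ' > γ, ∀ η, γ < η → η ≤ γ' → A η = plus A γ := by
  obtain ⟨b, w, rfl, -⟩ := exists_filOf_of_mem hA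
  exact (exists_plus_filOf_eq b w γ).2

/-- Increasing operations on subspaces commute with the formation of `A₊`. -/
theorem plus_comp [FiniteDimensional F E] {F' : Type*} [Field F'] {E' : Type*}
    [AddCommGroup E'] [Module F' E'] {Γ : AddSubgroup ℝ} {A : ℝ → Submodule F E}
    (hA : A ∈ filtrations Γ F E) {T : Submodule F E → Submodule F' E'} (hT : Monotone T) (γ : ℝ) :
    plus (fun x ↦ T (A x)) γ = T (plus A γ) := by
  obtain ⟨γ', h1, h2⟩ := exists_plus_eq hA γ
  refine le_antisymm (iSup₂_le fun η hη ↦ hT (le_iSup₂_of_le η hη le_rfl)) ?_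
  rw [← h2 γ' h1 le_rfl]
  exact le_iSup₂_of_le (f := fun (η : ℝ) (_ : γ < η) ↦ T (A η)) γ' h1 le_rfl

theorem exists_jumps [FiniteDimensional F E] {Γ : AddSubgroup ℝ} {A : ℝ → Submodule F E}
    (hA : A ∈ filtrations Γ F E) : ∃ J : Finset ℝ, ∀ γ ∉ J, plus A γ = A γ := by
  obtain ⟨b, w, rfl, -⟩ := exists_filOf_of_mem hA
  refine ⟨Finset.univ.image w, fun γ hγ ↦ ?_⟩
  rw [(exists_plus_filOf_eq b w γ).1, filOf]
  congr 2
  ext i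
  have hi : γ ≠ w i := fun h ↦ hγ (h ▸ Finset.mem_image_of_mem w (Finset.mem_univ i))
  exact ⟨fun h ↦ show γ ≤ w i from le_of_lt h, fun h ↦ show γ < w i from lt_of_le_of_ne h hi⟩

/-- The weights in any splitting of a filtration are jumps of the filtration. -/
theorem plus_filOf_ne (b : Basis (Fin (finrank F E)) F E) (w : Fin (finrank F E) → ℝ)
    (i : Fin (finrank F E)) : plus (filOf b w) (w i) ≠ filOf b w (w i) := by
  rw [(exists_plus_filOf_eq b w _).1, filOf]
  intro h
  have := Set.ext_iff.1 (span_image_injective b h) i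
  simp at this

end Weights

/-! ### Choquet integrals along filtrations -/

section Choquet

variable {F : Type*} [Field F] {E : Type*} [AddCommGroup E] [Module F E] {ι : Type*}

/-- The sum `∑_γ (g (A^γ) - g (A₊^γ)) γ`: the Choquet integral, along the filtration `A`, of a
function `g` of subspaces. -/
noncomputable def choquet (A : ℝ → Submodule F E) (g : Submodule F E → ℝ) : ℝ :=
  ∑ᶠ γ : ℝ, (g (A γ) - g (plus A γ)) * γ

theorem finsum_indicator_preimage_mul [Fintype ι] {α : Type*} (w : ι → α) (l : ι → ℝ)
    (f : α → ℝ) :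
    ∑ᶠ γ : α, (∑ i, ({i | w i = γ} : Set ι).indicator l i) * f γ = ∑ i, l i * f (w i) := by
  classical
  rw [finsum_eq_sum_of_support_subset (s := Finset.univ.image w)]
  · simp_rw [Finset.sum_mul]
    rw [Finset.sum_comm]
    refine Finset.sum_congr rfl fun i _ ↦ ?_
    rw [Finset.sum_eq_single (w i)]
    · simp
    · intro γ _ h
      simp [h.symm]
    · intro h
      simp at h
  · intro γ hγ
    by_contra h
    refine hγ ?_
    have : ∀ i, w i ≠ γ := fun i hi ↦ h (by simp [← hi])
    simp [this]

theorem finsum_ncard_mul [Fintype ι] {α : Type*} (w : ι → α) (f : α → ℝ) :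
    ∑ᶠ γ : α, (({i | w i = γ} : Set ι).ncard : ℝ) * f γ = ∑ i, f (w i) := by
  classical
  rw [show ∑ i, f (w i) = ∑ i, (1 : ι → ℝ) i * f (w i) by simp,
    ← finsum_indicator_preimage_mul w 1 f]
  refine finsum_congr fun γ ↦ ?_
  congr 1
  rw [Set.ncard_eq_toFinset_card', Finset.cast_card, Finset.sum_indicator_eq_sum_filter]
  exact Finset.sum_congr (by ext; simp) fun _ _ ↦ rfl

theorem choquet_sub [FiniteDimensional F E] {Γ : AddSubgroup ℝ} {A : ℝ → Submodule F E}
    (hA : A ∈ filtrations Γ F E) (g g' : Submodule F E → ℝ) :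
    choquet A (fun W ↦ g W - g' W) = choquet A g - choquet A g' := by
  obtain ⟨J, hJ⟩ := exists_jumps hA
  unfold choquet
  have h : ∀ g : Submodule F E → ℝ,
      Function.HasFiniteSupport fun γ ↦ (g (A γ) - g (plus A γ)) * γ := fun g ↦ by
    refine J.finite_toSet.subset fun γ hγ ↦ ?_
    by_contra hn
    exact hγ (by simp [hJ γ hn])
  rw [← finsum_sub_distrib (h g) (h g')]
  exact finsum_congr fun γ ↦ by ring

theorem choquet_congr {A : ℝ → Submodule F E} [FiniteDimensional F E] {Γ : AddSubgroup ℝ}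
    (hA : A ∈ filtrations Γ F E) {g g' : Submodule F E → ℝ} (h : ∀ γ, g (A γ) = g' (A γ)) :
    choquet A g = choquet A g' := by
  refine finsum_congr fun γ ↦ ?_
  obtain ⟨γ', h1, h2⟩ := exists_plus_eq hA γ
  rw [← h2 γ' h1 le_rfl, h, h]

/-- The Choquet integral of a function which is additive along the basis `b`. -/
theorem choquet_filOf [Fintype ι] (b : Basis ι F E) (w l : ι → ℝ) {g : Submodule F E → ℝ}
    (hg : ∀ S : Set ι, g (Submodule.span F (b '' S)) = ∑ i, S.indicator l i) :
    choquet (filOf b w) g = ∑ i, l i * w i := by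
  rw [← finsum_indicator_preimage_mul w l fun x ↦ x]
  refine finsum_congr fun γ ↦ ?_
  rw [(exists_plus_filOf_eq b w γ).1, filOf, hg, hg, ← Finset.sum_sub_distrib]
  congr 1
  refine Finset.sum_congr rfl fun i _ ↦ ?_
  rcases lt_trichotomy γ (w i) with h | h | h
  · simp [Set.indicator, h, h.le, h.ne']
  · simp [Set.indicator, h]
  · simp [Set.indicator, h.not_ge, h.not_gt, h.ne]

/-- Abel summation over the finite set `J` of jumps: the sum is `h J` times the smallest jump, plus
the sum of the values of `h` on the other terminal segments of `J` times the gaps between successive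
jumps. -/
theorem sum_jumps_mul (h : Finset ℝ → ℝ) (h0 : h ∅ = 0) (J : Finset ℝ) :
    (∀ γ ∈ J, 0 ≤ h (J.filter (γ ≤ ·))) → ∀ m : ℝ, (∀ γ ∈ J, m ≤ γ) →
      (m * h J ≤ ∑ γ ∈ J, (h (J.filter (γ ≤ ·)) - h (J.filter (γ < ·))) * γ) ∧
      (h J = 0 → ∑ γ ∈ J, (h (J.filter (γ ≤ ·)) - h (J.filter (γ < ·))) * γ ≤ 0 →
        ∀ γ ∈ J, h (J.filter (γ ≤ ·)) = 0) := by
  induction J using Finset.induction_on_min with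
  | empty => simp [h0]
  | insert a s ha ih =>
    intro hpos m hm
    have has : a ∉ s := fun h ↦ lt_irrefl _ (ha a h)
    have e1 : (insert a s).filter (a ≤ ·) = insert a s := by
      rw [Finset.filter_eq_self]
      intro x hx
      rcases Finset.mem_insert.1 hx with rfl | hx
      · exact le_rfl
      · exact (ha x hx).le
    have e2 : (insert a s).filter (a < ·) = s := by
      rw [Finset.filter_insert, if_neg (lt_irrefl a), Finset.filter_eq_self]
      exact ha
    have e3 : ∀ γ ∈ s, (insert a s).filter (γ ≤ ·) = s.filter (γ ≤ ·) := fun γ hγ ↦ by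
      rw [Finset.filter_insert, if_neg (ha γ hγ).not_ge]
    have e4 : ∀ γ ∈ s, (insert a s).filter (γ < ·) = s.filter (γ < ·) := fun γ hγ ↦ by
      rw [Finset.filter_insert, if_neg (ha γ hγ).not_gt]
    have hsum : ∑ γ ∈ insert a s,
        (h ((insert a s).filter (γ ≤ ·)) - h ((insert a s).filter (γ < ·))) * γ =
        (h (insert a s) - h s) * a +
          ∑ γ ∈ s, (h (s.filter (γ ≤ ·)) - h (s.filter (γ < ·))) * γ := by
      rw [Finset.sum_insert has, e1, e2]
      congr 1
      exact Finset.sum_congr rfl fun γ hγ ↦ by rw [e3 γ hγ, e4 γ hγ]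
    have hposs : ∀ γ ∈ s, 0 ≤ h (s.filter (γ ≤ ·)) := fun γ hγ ↦ by
      rw [← e3 γ hγ]
      exact hpos γ (Finset.mem_insert_of_mem hγ)
    have hma := hm a (Finset.mem_insert_self _ _)
    have hJ : 0 ≤ h (insert a s) := by
      have := hpos a (Finset.mem_insert_self _ _)
      rwa [e1] at this
    rw [hsum]
    rcases s.eq_empty_or_nonempty with rfl | hne
    · simp only [h0, Finset.sum_empty]
      refine ⟨by nlinarith, fun h1 _ γ hγ ↦ ?_⟩
      simp only [insert_empty_eq, Finset.mem_singleton] at hγ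
      subst hγ
      rw [e1, h1]
    · set m' := s.min' hne
      have hm' : a < m' := ha _ (s.min'_mem hne)
      have hs : 0 ≤ h s := by
        have := hposs m' (s.min'_mem hne)
        rwa [Finset.filter_true_of_mem fun x hx ↦ s.min'_le x hx] at this
      obtain ⟨i1, i2⟩ := ih hposs m' fun γ hγ ↦ s.min'_le γ hγ
      refine ⟨by nlinarith, fun h1 h2 γ hγ ↦ ?_⟩
      have hs0 : h s = 0 := by
        rw [h1] at h2
        nlinarith
      rcases Finset.mem_insert.1 hγ with rfl | hγ
      · rw [e1, h1]
      · rw [e3 γ hγ]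
        exact i2 hs0 (by rw [h1, hs0] at h2; simpa using h2) γ hγ

theorem sum_jumps (h : Finset ℝ → ℝ) (J : Finset ℝ) :
    ∑ γ ∈ J, (h (J.filter (γ ≤ ·)) - h (J.filter (γ < ·))) = h J - h ∅ := by
  induction J using Finset.induction_on_min with
  | empty => simp
  | insert a s ha ih =>
    have has : a ∉ s := fun h ↦ lt_irrefl _ (ha a h)
    have e1 : (insert a s).filter (a ≤ ·) = insert a s := by
      rw [Finset.filter_eq_self]
      intro x hx
      rcases Finset.mem_insert.1 hx with rfl | hx
      · exact le_rfl
      · exact (ha x hx).le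
    have e2 : (insert a s).filter (a < ·) = s := by
      rw [Finset.filter_insert, if_neg (lt_irrefl a), Finset.filter_eq_self]
      exact ha
    rw [Finset.sum_insert has, e1, e2, show h (insert a s) - h ∅ =
      h (insert a s) - h s + (h s - h ∅) by ring, ← ih]
    congr 1
    refine Finset.sum_congr rfl fun γ hγ ↦ ?_
    rw [Finset.filter_insert, if_neg (ha γ hγ).not_ge, Finset.filter_insert,
      if_neg (ha γ hγ).not_gt]

/-- The steps of a filtration, as a function on the sets of its jumps. -/
theorem exists_step_function [FiniteDimensional F E] {Γ : AddSubgroup ℝ} {A : ℝ → Submodule F E}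
    (hA : A ∈ filtrations Γ F E) : ∃ (J : Finset ℝ) (T : Finset ℝ → Submodule F E),
      T ∅ = ⊥ ∧ T J = ⊤ ∧ (∀ γ, A γ = T (J.filter (γ ≤ ·))) ∧
      (∀ γ, plus A γ = T (J.filter (γ < ·))) ∧ (∀ γ ∉ J, plus A γ = A γ) ∧
      ∀ γ, A γ = ⊥ ∨ ∃ γ' ∈ J, A γ = A γ' := by
  obtain ⟨b, w, rfl, -⟩ := exists_filOf_of_mem hA
  have hA1 : ∀ γ, filOf b w γ = Submodule.span F
      (b '' {i | w i ∈ (Finset.univ.image w).filter (γ ≤ ·)}) := fun γ ↦ by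
    unfold filOf
    congr 2
    ext i
    simp
  have hA2 : ∀ γ, plus (filOf b w) γ = Submodule.span F
      (b '' {i | w i ∈ (Finset.univ.image w).filter (γ < ·)}) := fun γ ↦ by
    rw [(exists_plus_filOf_eq b w γ).1]
    congr 2
    ext i
    simp
  refine ⟨Finset.univ.image w, fun S ↦ Submodule.span F (b '' {i | w i ∈ S}), by simp, by simp,
    hA1, hA2, fun γ hγ ↦ ?_, fun γ ↦ ?_⟩
  · rw [hA1, hA2]
    congr 3
    ext i
    simp only [Finset.mem_filter, and_congr_right_iff]
    exact fun hi ↦ ⟨le_of_lt, fun h ↦ lt_of_le_of_ne h fun h' ↦ hγ (by rw [h']; exact hi)⟩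
  · by_cases hne : ((Finset.univ.image w).filter (γ ≤ ·)).Nonempty
    · obtain ⟨h1, h2⟩ := Finset.mem_filter.1 (Finset.min'_mem _ hne)
      refine Or.inr ⟨_, h1, ?_⟩
      rw [hA1, hA1]
      congr 3
      ext x
      simp only [Finset.mem_filter, and_congr_right_iff]
      exact fun hx ↦ ⟨fun h ↦ Finset.min'_le _ _ (Finset.mem_filter.2 ⟨hx, h⟩), h2.trans⟩
    · left
      rw [hA1, Finset.not_nonempty_iff_eq_empty.1 hne]
      simp

variable [FiniteDimensional F E]

/-- The Choquet integral of a function which is nonnegative on the steps of the filtration and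
vanishes at both ends is nonnegative, and it vanishes only if the function vanishes on all
steps. -/
theorem choquet_nonneg {Γ : AddSubgroup ℝ} {A : ℝ → Submodule F E}
    (hA : A ∈ filtrations Γ F E) {g : Submodule F E → ℝ} (h0 : g ⊥ = 0) (h1 : g ⊤ = 0)
    (hg : ∀ γ, 0 ≤ g (A γ)) :
    0 ≤ choquet A g ∧ (choquet A g = 0 → ∀ γ, g (A γ) = 0) := by
  obtain ⟨J, T, hT0, hT1, hT2, hT3, hJ, hJ'⟩ := exists_step_function hA
  have hc : choquet A g =
      ∑ γ ∈ J, ((g ∘ T) (J.filter (γ ≤ ·)) - (g ∘ T) (J.filter (γ < ·))) * γ := by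
    unfold choquet
    rw [finsum_eq_sum_of_support_subset (s := J)]
    · simp only [hT2, hT3, Function.comp]
    · intro γ hγ
      by_contra hn
      exact hγ (by simp [hJ γ hn])
  have key := sum_jumps_mul (g ∘ T) (by simp [hT0, h0]) J
    (fun γ _ ↦ by simpa [hT2] using hg γ)
  rw [← hc] at key
  refine ⟨?_, fun hz γ ↦ ?_⟩
  · rcases J.eq_empty_or_nonempty with rfl | hne
    · simp [hc]
    · have := (key (J.min' hne) fun γ hγ ↦ J.min'_le γ hγ).1
      simpa [hT1, h1] using this
  · rcases hJ' γ with h | ⟨γ', hγ', h⟩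
    · rw [h, h0]
    · have := (key (J.min' ⟨γ', hγ'⟩) fun γ hγ ↦ J.min'_le γ hγ).2
        (by simp [hT1, h1]) hz.le γ' hγ'
      rw [h, hT2]
      exact this

/-- Monotonicity of the Choquet integral among functions with the same value on `⊤`. -/
theorem choquet_mono {Γ : AddSubgroup ℝ} {A : ℝ → Submodule F E}
    (hA : A ∈ filtrations Γ F E) {g g' : Submodule F E → ℝ} (h0 : g ⊥ = g' ⊥) (h1 : g ⊤ = g' ⊤)
    (hg : ∀ γ, g (A γ) ≤ g' (A γ)) :
    choquet A g ≤ choquet A g' ∧ (choquet A g = choquet A g' → ∀ γ, g (A γ) = g' (A γ)) := by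
  have := choquet_nonneg hA (g := fun W ↦ g' W - g W) (by simp [h0]) (by simp [h1])
    fun γ ↦ sub_nonneg.2 (hg γ)
  rw [choquet_sub hA] at this
  exact ⟨sub_nonneg.1 this.1, fun h γ ↦ (sub_eq_zero.1 (this.2 (sub_eq_zero.2 h.symm) γ)).symm⟩

/-- Comparison of two functions on subspaces through their increments along a filtration. -/
theorem le_of_forall_increment_le {Γ : AddSubgroup ℝ} {A : ℝ → Submodule F E}
    (hA : A ∈ filtrations Γ F E) (g : Submodule F E → ℝ) (h0 : g ⊥ = 0) (h : ℝ → ℝ)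
    (hg : ∀ γ, g (A γ) - g (plus A γ) ≤ h γ) (hh : ∀ γ, plus A γ = A γ → h γ = 0) :
    g ⊤ ≤ ∑ᶠ γ, h γ := by
  obtain ⟨J, T, hT0, hT1, hT2, hT3, hJ, -⟩ := exists_step_function hA
  have := sum_jumps (g ∘ T) J
  simp only [Function.comp, hT0, hT1, h0, sub_zero, ← hT2, ← hT3] at this
  rw [← this, finsum_eq_sum_of_support_subset (s := J)]
  · exact Finset.sum_le_sum fun γ _ ↦ hg γ
  · intro γ hγ
    by_contra hn
    exact hγ (hh γ (hJ γ hn))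

end Choquet

/-! ### Degrees and scalar products -/

section Degrees

variable {F : Type*} [Field F] {E : Type*} [AddCommGroup E] [Module F E]

/-- The dimension of a subspace, as a real number. -/
noncomputable def sdim (W : Submodule F E) : ℝ :=
  finrank F W

theorem sdim_bot : sdim (⊥ : Submodule F E) = 0 := by
  simp [sdim]

theorem sdim_sup_add_sdim_inf [FiniteDimensional F E] (W W' : Submodule F E) :
    sdim (W ⊔ W') + sdim (W ⊓ W') = sdim W + sdim W' :=
  by unfold sdim; exact_mod_cast Submodule.finrank_sup_add_finrank_inf_eq W W'

theorem sdim_mono [FiniteDimensional F E] : Monotone (sdim : Submodule F E → ℝ) := fun _ _ h ↦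
  Nat.cast_le.2 (Submodule.finrank_mono h)

theorem sdim_strictMono [FiniteDimensional F E] : StrictMono (sdim : Submodule F E → ℝ) :=
  fun _ _ h ↦ Nat.cast_lt.2 (Submodule.finrank_lt_finrank_of_lt h)

theorem sdim_span_image {ι : Type*} [Fintype ι] (b : Basis ι F E) (S : Set ι) :
    sdim (Submodule.span F (b '' S)) = ∑ i, S.indicator (fun _ ↦ (1 : ℝ)) i := by
  classical
  rw [sdim, finrank_span_image, Set.ncard_eq_toFinset_card', Finset.cast_card,
    Finset.sum_indicator_eq_sum_filter]
  exact Finset.sum_congr (by ext; simp) fun _ _ ↦ rfl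

theorem sdim_submoduleOf (X W : Submodule F E) : sdim (X.submoduleOf W) = sdim (X ⊓ W) := by
  rw [sdim, Submodule.submoduleOf, ← Submodule.finrank_map_subtype_eq,
    Submodule.map_comap_subtype, inf_comm]
  rfl

theorem finrank_quotient_eq_sdim_sub [FiniteDimensional F E] {P Q : Submodule F E} (h : Q ≤ P) :
    (finrank F (P ⧸ Q.submoduleOf P) : ℝ) = sdim P - sdim Q := by
  have h1 := Submodule.finrank_quotient_add_finrank (Q.submoduleOf P)
  have h2 : sdim (Q.submoduleOf P) = sdim Q := by rw [sdim_submoduleOf, inf_eq_left.2 h]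
  rw [← h2, sdim, ← h1]
  push_cast
  rw [sdim]
  ring

section Intrinsic

variable [FiniteDimensional F E] {Γ : AddSubgroup ℝ} {A : ℝ → Submodule F E}

theorem degree_eq_choquet (hA : A ∈ filtrations Γ F E) :
    degree A = choquet A sdim :=
  finsum_congr fun γ ↦ by
    rw [finrank_quotient_eq_sdim_sub (plus_le (antitone_of_mem hA) γ)]

theorem degreeOn_eq_choquet (hA : A ∈ filtrations Γ F E) (W : Submodule F E) :
    degreeOn A W = choquet A fun U ↦ sdim (U ⊓ W) := by
  refine finsum_congr fun γ ↦ ?_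
  have h1 : plus (restrict A W) γ = (plus A γ).submoduleOf W :=
    plus_comp hA (T := fun U ↦ U.submoduleOf W) (fun _ _ h ↦ Submodule.comap_mono h) γ
  have h2 : (plus A γ).submoduleOf W ≤ (A γ).submoduleOf W :=
    Submodule.comap_mono (plus_le (antitone_of_mem hA) γ)
  rw [h1, restrict, finrank_quotient_eq_sdim_sub h2]
  simp only [sdim_submoduleOf]

theorem sdim_map_mkQ_submoduleOf {U W : Submodule F E} (h : U ≤ W) (X : Submodule F E) :
    sdim ((X.submoduleOf W).map (U.submoduleOf W).mkQ) = sdim (X ⊓ W) - sdim (X ⊓ U) := by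
  have h1 := LinearMap.finrank_range_add_finrank_ker
    ((U.submoduleOf W).mkQ.domRestrict (X.submoduleOf W))
  rw [LinearMap.range_domRestrict, LinearMap.ker_domRestrict, Submodule.ker_mkQ] at h1
  have h2 : sdim ((U.submoduleOf W).submoduleOf (X.submoduleOf W)) = sdim (X ⊓ U) := by
    rw [sdim_submoduleOf, Submodule.submoduleOf, Submodule.submoduleOf, ← Submodule.comap_inf]
    exact (sdim_submoduleOf _ W).trans (by rw [inf_comm U, inf_assoc, inf_eq_left.2 h])
  have h3 : sdim (X.submoduleOf W) = sdim (X ⊓ W) := sdim_submoduleOf X W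
  rw [← h2, ← h3, sdim, sdim, sdim, ← h1]
  push_cast
  exact (add_sub_cancel_right _ _).symm

theorem degreeSubquotient_eq (hA : A ∈ filtrations Γ F E) {U W : Submodule F E} (h : U ≤ W) :
    degreeSubquotient A U W = degreeOn A W - degreeOn A U := by
  rw [degreeOn_eq_choquet hA, degreeOn_eq_choquet hA, ← choquet_sub hA]
  refine finsum_congr fun γ ↦ ?_
  have h1 : plus (subquotient A U W) γ =
      ((plus A γ).submoduleOf W).map (U.submoduleOf W).mkQ :=
    plus_comp hA (T := fun X ↦ (X.submoduleOf W).map (U.submoduleOf W).mkQ)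
      (fun _ _ h ↦ Submodule.map_mono (Submodule.comap_mono h)) γ
  have h2 : subquotient A U W γ = ((A γ).submoduleOf W).map (U.submoduleOf W).mkQ := rfl
  have h3 : ((plus A γ).submoduleOf W).map (U.submoduleOf W).mkQ ≤
      ((A γ).submoduleOf W).map (U.submoduleOf W).mkQ :=
    Submodule.map_mono (Submodule.comap_mono (plus_le (antitone_of_mem hA) γ))
  rw [h1, h2, finrank_quotient_eq_sdim_sub h3, sdim_map_mkQ_submoduleOf h,
    sdim_map_mkQ_submoduleOf h]

theorem degreeOn_top (hA : A ∈ filtrations Γ F E) : degreeOn A ⊤ = degree A := by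
  rw [degreeOn_eq_choquet hA, degree_eq_choquet hA]
  simp only [inf_top_eq]

theorem degreeOn_bot (hA : A ∈ filtrations Γ F E) : degreeOn A ⊥ = 0 := by
  rw [degreeOn_eq_choquet hA]
  simp [choquet, sdim_bot]

/-- The degree of the induced filtration is a supermodular function of the subspace. -/
theorem degreeOn_supermodular (hA : A ∈ filtrations Γ F E) (W W' : Submodule F E) :
    degreeOn A W + degreeOn A W' ≤ degreeOn A (W ⊔ W') + degreeOn A (W ⊓ W') := by
  have key : ∀ X : Submodule F E, sdim (X ⊓ W) + sdim (X ⊓ W') ≤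
      sdim (X ⊓ (W ⊔ W')) + sdim (X ⊓ (W ⊓ W')) := by
    intro X
    have h1 := sdim_sup_add_sdim_inf (X ⊓ W) (X ⊓ W')
    have h2 : sdim ((X ⊓ W) ⊔ (X ⊓ W')) ≤ sdim (X ⊓ (W ⊔ W')) := sdim_mono le_inf_sup
    rw [show (X ⊓ W) ⊓ (X ⊓ W') = X ⊓ (W ⊓ W') by rw [← inf_inf_distrib_left]] at h1
    linarith
  have h := (choquet_nonneg hA (g := fun X ↦
    (sdim (X ⊓ (W ⊔ W')) - sdim (X ⊓ W)) -
      (sdim (X ⊓ W') - sdim (X ⊓ (W ⊓ W'))))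
    (by simp [sdim_bot]) ?_ fun γ ↦ by linarith [key (A γ)]).1
  · rw [choquet_sub hA, choquet_sub hA, choquet_sub hA, ← degreeOn_eq_choquet hA,
      ← degreeOn_eq_choquet hA, ← degreeOn_eq_choquet hA, ← degreeOn_eq_choquet hA] at h
    linarith
  · simp only [top_inf_eq]
    linarith [sdim_sup_add_sdim_inf W W']

/-- The degrees induced on subspaces are sums over the jumps, with bounded integral coefficients. -/
theorem finite_range_degreeOn (hA : A ∈ filtrations Γ F E) : (Set.range (degreeOn A)).Finite := by
  obtain ⟨J, hJ⟩ := exists_jumps hA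
  let N := finrank F E + 1
  let Φ : (J → Fin N × Fin N) → ℝ := fun u ↦ ∑ γ : J, (((u γ).1 : ℕ) - ((u γ).2 : ℕ) : ℝ) * γ
  refine (Set.finite_range Φ).subset ?_
  rintro _ ⟨W, rfl⟩
  have hlt : ∀ X : Submodule F E, finrank F X < N := fun X ↦
    Nat.lt_succ_of_le (Submodule.finrank_le X)
  refine ⟨fun γ ↦ (⟨finrank F ↥(A γ ⊓ W), hlt _⟩, ⟨finrank F ↥(plus A γ ⊓ W), hlt _⟩), ?_⟩
  rw [degreeOn_eq_choquet hA, choquet, finsum_eq_sum_of_support_subset (s := J)]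
  · exact Finset.sum_coe_sort J
      fun γ ↦ (sdim (A γ ⊓ W) - finrank F ↥(plus A γ ⊓ W)) * γ
  · intro γ hγ
    by_contra hn
    exact hγ (by simp [hJ γ hn])

end Intrinsic

section Coordinates

variable {ι : Type*} [Fintype ι] (b : Basis ι F E)

theorem degree_filOf [FiniteDimensional F E] (w : ι → ℝ) : degree (filOf b w) = ∑ i, w i := by
  rw [degree_eq_choquet (filOf_mem_filtrations b w (Γ := ⊤) fun _ ↦ trivial),
    choquet_filOf b w (fun _ ↦ 1)]
  · simp
  · intro S
    rw [sdim_span_image]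

theorem degreeOn_filOf [FiniteDimensional F E] (w : ι → ℝ) (S : Set ι) :
    degreeOn (filOf b w) (Submodule.span F (b '' S)) = ∑ i, S.indicator w i := by
  rw [degreeOn_eq_choquet (filOf_mem_filtrations b w (Γ := ⊤) fun _ ↦ trivial),
    choquet_filOf b w (S.indicator fun _ ↦ 1)]
  · exact Finset.sum_congr rfl fun i _ ↦ by by_cases hi : i ∈ S <;> simp [hi]
  · intro T
    rw [span_image_inf_span_image, sdim_span_image, ← Set.indicator_indicator]

theorem scalarProduct_filOf [FiniteDimensional F E] (w w' : ι → ℝ) :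
    scalarProduct (filOf b w) (filOf b w') = ∑ i, w i * w' i := by
  rw [← finsum_ncard_mul (fun i ↦ (w i, w' i)) fun γ : ℝ × ℝ ↦ γ.1 * γ.2]
  refine finsum_congr fun γ ↦ ?_
  congr 1
  have hcard : (({i | (w i, w' i) = γ} : Set ι).ncard : ℝ) =
      ∑ i, ({i | (w i, w' i) = γ} : Set ι).indicator (fun _ ↦ (1 : ℝ)) i := by
    rw [← sdim_span_image b, sdim, finrank_span_image]
  have hle := sup_le (inf_le_inf_right (filOf b w' γ.2) (plus_le (filOf_antitone b w) γ.1))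
    (inf_le_inf_left (filOf b w γ.1) (plus_le (filOf_antitone b w') γ.2))
  rw [finrank_quotient_eq_sdim_sub hle, (exists_plus_filOf_eq b w _).1,
    (exists_plus_filOf_eq b w' _).1, filOf, filOf, span_image_inf_span_image,
    span_image_inf_span_image, span_image_inf_span_image, span_image_sup_span_image,
    sdim_span_image, sdim_span_image, hcard, ← Finset.sum_sub_distrib]
  refine Finset.sum_congr rfl fun i _ ↦ ?_
  rcases lt_trichotomy γ.1 (w i) with h | h | h <;>
  rcases lt_trichotomy γ.2 (w' i) with h' | h' | h' <;>
  simp [Set.indicator, Prod.ext_iff, h, h', le_of_lt, ne_of_lt, ne_of_gt, not_lt_of_gt,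
    not_le_of_gt]

end Coordinates

variable [FiniteDimensional F E] {Γ Δ : AddSubgroup ℝ} {A B : ℝ → Submodule F E}

theorem scalarProduct_comm (hA : A ∈ filtrations Γ F E) (hB : B ∈ filtrations Δ F E) :
    scalarProduct A B = scalarProduct B A := by
  obtain ⟨b, w, w', rfl, rfl, -⟩ := exists_common_basis hA hB
  simp_rw [scalarProduct_filOf, mul_comm]

/-- The scalar product is computed by the degrees induced on the steps of one of the two
filtrations. -/
theorem scalarProduct_eq_choquet (hA : A ∈ filtrations Γ F E) (hB : B ∈ filtrations Δ F E) :
    scalarProduct A B = choquet B (degreeOn A) := by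
  obtain ⟨b, w, w', rfl, rfl, -⟩ := exists_common_basis hA hB
  rw [scalarProduct_filOf, choquet_filOf b w' w (degreeOn_filOf b w)]

end Degrees

/-! ### The metric space of filtrations -/

section Supermodular

variable {ι : Type*} [LinearOrder ι] [LocallyFiniteOrderBot ι]

/-- A supermodular set function is at most the additive function defined by its increments along
the initial segments of `ι`. -/
theorem le_sum_increments {f : Finset ι → ℝ} (h0 : f ∅ = 0)
    (hf : ∀ S T, f S + f T ≤ f (S ∪ T) + f (S ∩ T)) (S : Finset ι) :
    f S ≤ ∑ i ∈ S, (f (Finset.Iic i) - f (Finset.Iio i)) := by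
  induction S using Finset.induction_on_max with
  | empty => simp [h0]
  | insert a s ha ih =>
    have has : a ∉ s := fun h ↦ lt_irrefl _ (ha a h)
    rw [Finset.sum_insert has]
    have h1 := hf (Finset.Iio a) (insert a s)
    have h2 : Finset.Iio a ∪ insert a s = Finset.Iic a := by
      ext x
      simp only [Finset.mem_union, Finset.mem_Iio, Finset.mem_insert, Finset.mem_Iic]
      refine ⟨?_, fun h ↦ h.lt_or_eq.imp_right Or.inl⟩
      rintro (h | rfl | h)
      exacts [h.le, le_rfl, (ha x h).le]
    have h3 : Finset.Iio a ∩ insert a s = s := by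
      ext x
      simp only [Finset.mem_inter, Finset.mem_Iio, Finset.mem_insert]
      exact ⟨fun h ↦ h.2.resolve_left h.1.ne, fun h ↦ ⟨ha x h, Or.inr h⟩⟩
    rw [h2, h3] at h1
    linarith

/-- On initial segments the bound of `le_sum_increments` is an equality, by telescoping. -/
theorem eq_sum_increments {f : Finset ι → ℝ} (h0 : f ∅ = 0) (S : Finset ι)
    (hS : ∀ i ∈ S, ∀ j ≤ i, j ∈ S) :
    f S = ∑ i ∈ S, (f (Finset.Iic i) - f (Finset.Iio i)) := by
  induction S using Finset.induction_on_max with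
  | empty => simp [h0]
  | insert a s ha ih =>
    have has : a ∉ s := fun h ↦ lt_irrefl _ (ha a h)
    have h1 : s = Finset.Iio a := by
      ext x
      rw [Finset.mem_Iio]
      exact ⟨ha x, fun h ↦ (Finset.mem_insert.1
        (hS a (Finset.mem_insert_self _ _) x h.le)).resolve_left h.ne⟩
    have h2 : insert a s = Finset.Iic a := by rw [h1, Finset.Iio_insert]
    rw [Finset.sum_insert has, ← ih, h2, h1]
    · ring
    · intro i hi j hj
      rw [h1, Finset.mem_Iio] at hi ⊢
      exact hj.trans_lt hi

end Supermodular

section Metric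

variable {F : Type*} [Field F] {E : Type*} [AddCommGroup E] [Module F E] [FiniteDimensional F E]

theorem filDist_filOf {ι : Type*} [Fintype ι] (b : Basis ι F E) (w w' : ι → ℝ) :
    filDist (filOf b w) (filOf b w') = √(∑ i, (w i - w' i) ^ 2) := by
  rw [filDist, scalarProduct_filOf, scalarProduct_filOf, scalarProduct_filOf]
  congr 1
  rw [Finset.mul_sum, ← Finset.sum_add_distrib, ← Finset.sum_sub_distrib]
  exact Finset.sum_congr rfl fun i _ ↦ by ring

theorem filDist_sq {Γ Δ : AddSubgroup ℝ} {A B : ℝ → Submodule F E} (hA : A ∈ filtrations Γ F E)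
    (hB : B ∈ filtrations Δ F E) :
    filDist A B ^ 2 = scalarProduct A A + scalarProduct B B - 2 * scalarProduct A B := by
  rw [filDist, Real.sq_sqrt]
  obtain ⟨b, w, w', rfl, rfl, -⟩ := exists_common_basis hA hB
  rw [scalarProduct_filOf, scalarProduct_filOf, scalarProduct_filOf, Finset.mul_sum,
    ← Finset.sum_add_distrib, ← Finset.sum_sub_distrib]
  exact Finset.sum_nonneg fun i _ ↦ by nlinarith [sq_nonneg (w i - w' i)]

theorem eq_of_filDist_sq_nonpos {Γ Δ : AddSubgroup ℝ} {A B : ℝ → Submodule F E}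
    (hA : A ∈ filtrations Γ F E) (hB : B ∈ filtrations Δ F E) (h : filDist A B ^ 2 ≤ 0) :
    A = B := by
  obtain ⟨b, w, w', rfl, rfl, -⟩ := exists_common_basis hA hB
  rw [filDist_filOf, Real.sq_sqrt (Finset.sum_nonneg fun i _ ↦ sq_nonneg _)] at h
  congr 1
  funext i
  have h1 : (w i - w' i) ^ 2 ≤ ∑ i, (w i - w' i) ^ 2 :=
    Finset.single_le_sum (f := fun i ↦ (w i - w' i) ^ 2) (fun i _ ↦ sq_nonneg _)
      (Finset.mem_univ i)
  exact sub_eq_zero.1 (pow_eq_zero_iff two_ne_zero |>.1 (le_antisymm (h1.trans h) (sq_nonneg _)))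

/-- The scalar product with a fixed filtration `X` is concave on the filtrations split by a given
basis: sort the basis by decreasing weights of the midpoint, and compare the supermodular function
`degreeOn X` with the additive function given by its increments along the resulting flag. -/
theorem scalarProduct_concave {n : ℕ} {Γ : AddSubgroup ℝ} {X : ℝ → Submodule F E}
    (hX : X ∈ filtrations Γ F E) (b : Basis (Fin n) F E) (w w' : Fin n → ℝ) {s t : ℝ}
    (hs : 0 ≤ s) (ht : 0 ≤ t) :
    s * scalarProduct X (filOf b w) + t * scalarProduct X (filOf b w') ≤
      scalarProduct X (filOf b fun i ↦ s * w i + t * w' i) := by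
  classical
  wlog hanti : Antitone fun i ↦ s * w i + t * w' i generalizing b w w'
  · let σ := Tuple.sort fun i ↦ -(s * w i + t * w' i)
    have h1 := Tuple.monotone_sort fun i ↦ -(s * w i + t * w' i)
    have := this (b.reindex σ.symm) (w ∘ σ) (w' ∘ σ) fun i j hij ↦ neg_le_neg_iff.1 (h1 hij)
    rw [filOf_reindex, filOf_reindex] at this
    refine this.trans_eq ?_
    rw [← filOf_reindex b (fun i ↦ s * w i + t * w' i) σ]
    rfl
  set f : Finset (Fin n) → ℝ := fun S ↦ degreeOn X (Submodule.span F (b '' S)) with hf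
  have hf0 : f ∅ = 0 := by simp [hf, degreeOn_bot hX]
  have hsup : ∀ S T, f S + f T ≤ f (S ∪ T) + f (S ∩ T) := fun S T ↦ by
    have := degreeOn_supermodular hX (Submodule.span F (b '' S)) (Submodule.span F (b '' T))
    rw [span_image_inf_span_image, span_image_sup_span_image] at this
    simpa [hf] using this
  set l : Fin n → ℝ := fun i ↦ f (Finset.Iic i) - f (Finset.Iio i) with hl
  let g : Submodule F E → ℝ := fun W ↦ ∑ i, ({i | b i ∈ W} : Set (Fin n)).indicator l i
  have hg : ∀ S : Set (Fin n), g (Submodule.span F (b '' S)) = ∑ i, S.indicator l i := fun S ↦ by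
    have : {i | b i ∈ Submodule.span F (b '' S)} = S := Set.ext (basis_mem_span_image_iff b S)
    simp only [g, this]
  have hsum : ∀ S : Set (Fin n), ∑ i, S.indicator l i = ∑ i ∈ S.toFinset, l i := fun S ↦ by
    rw [Finset.sum_indicator_eq_sum_filter]
    exact Finset.sum_congr (by ext; simp) fun _ _ ↦ rfl
  have hfS : ∀ S : Set (Fin n), f S.toFinset = degreeOn X (Submodule.span F (b '' S)) :=
    fun S ↦ by simp [hf]
  have hle : ∀ S : Set (Fin n), degreeOn X (Submodule.span F (b '' S)) ≤
      g (Submodule.span F (b '' S)) := fun S ↦ by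
    rw [hg, hsum]
    rw [← hfS S]
    exact le_sum_increments hf0 hsup S.toFinset
  have heq : ∀ S : Set (Fin n), (∀ i ∈ S, ∀ j ≤ i, j ∈ S) →
      degreeOn X (Submodule.span F (b '' S)) = g (Submodule.span F (b '' S)) := fun S hS ↦ by
    rw [hg, hsum]
    rw [← hfS S]
    exact eq_sum_increments hf0 S.toFinset (by simpa using hS)
  have hmem : ∀ w, filOf b w ∈ filtrations ⊤ F E := fun w ↦
    filOf_mem_filtrations b w fun _ ↦ trivial
  have h1 : ∀ w, scalarProduct X (filOf b w) ≤ ∑ i, l i * w i := fun w ↦ by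
    rw [scalarProduct_eq_choquet hX (hmem w), ← choquet_filOf b w l hg]
    refine (choquet_mono (hmem w) ?_ ?_ fun γ ↦ hle _).1
    · simpa using heq ∅ (by simp)
    · simpa using heq Set.univ (by simp)
  have h2 : scalarProduct X (filOf b fun i ↦ s * w i + t * w' i) =
      ∑ i, l i * (s * w i + t * w' i) := by
    rw [scalarProduct_eq_choquet hX (hmem _), ← choquet_filOf b _ l hg]
    refine choquet_congr (hmem _) fun γ ↦ heq _ fun i hi j hij ↦ ?_
    exact le_trans (show γ ≤ s * w i + t * w' i from hi) (hanti hij)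
  rw [h2]
  calc s * scalarProduct X (filOf b w) + t * scalarProduct X (filOf b w')
      ≤ s * ∑ i, l i * w i + t * ∑ i, l i * w' i :=
        add_le_add (mul_le_mul_of_nonneg_left (h1 w) hs) (mul_le_mul_of_nonneg_left (h1 w') ht)
    _ = _ := by
        rw [Finset.mul_sum, Finset.mul_sum, ← Finset.sum_add_distrib]
        exact Finset.sum_congr rfl fun i _ ↦ by ring

/-- A point at the distances prescribed by a geodesic from both ends is the barycenter of the ends
computed in any common splitting: the space of filtrations is nonpositively curved. -/
theorem eq_barycenter {n : ℕ} {Γ : AddSubgroup ℝ} {X : ℝ → Submodule F E}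
    (hX : X ∈ filtrations Γ F E) (b : Basis (Fin n) F E) (w w' : Fin n → ℝ) {t l : ℝ}
    (ht0 : 0 ≤ t) (ht1 : t ≤ 1) (hl : filDist (filOf b w) (filOf b w') = l)
    (h1 : filDist (filOf b w) X = t * l) (h2 : filDist X (filOf b w') = (1 - t) * l) :
    X = filOf b fun i ↦ (1 - t) * w i + t * w' i := by
  have hmem : ∀ w, filOf b w ∈ filtrations ⊤ F E := fun w ↦
    filOf_mem_filtrations b w fun _ ↦ trivial
  refine eq_of_filDist_sq_nonpos hX (hmem _) ?_
  have hc := scalarProduct_concave hX b w w' (sub_nonneg.2 ht1) ht0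
  have e1 := filDist_sq (hmem w) hX
  have e2 := filDist_sq hX (hmem w')
  have e3 := filDist_sq (hmem w) (hmem w')
  rw [filDist_sq hX (hmem _)]
  rw [h1, scalarProduct_comm (hmem w) hX] at e1
  rw [h2] at e2
  rw [hl] at e3
  have e4 : scalarProduct (filOf b fun i ↦ (1 - t) * w i + t * w' i)
      (filOf b fun i ↦ (1 - t) * w i + t * w' i) =
      (1 - t) ^ 2 * scalarProduct (filOf b w) (filOf b w) +
        t ^ 2 * scalarProduct (filOf b w') (filOf b w') +
        2 * t * (1 - t) * scalarProduct (filOf b w) (filOf b w') := by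
    simp_rw [scalarProduct_filOf, Finset.mul_sum, ← Finset.sum_add_distrib]
    exact Finset.sum_congr rfl fun i _ ↦ by ring
  rw [e4]
  nlinarith

/-- Filtrations with steps in a given set of subspaces form a closed set: the steps of a
filtration are steps of every filtration that is close enough to it. -/
theorem isClosedIn_of_steps (C : Set (Submodule F E)) :
    IsClosedIn (filtrations ⊤ F E) {Ξ ∈ filtrations ⊤ F E | ∀ γ, Ξ γ ∈ C} := by
  refine ⟨fun _ h ↦ h.1, fun A hA h ↦ ⟨hA, fun γ ↦ ?_⟩⟩
  obtain ⟨c, v, hcv, -⟩ := exists_filOf_of_mem hA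
  -- below `γ` there is no jump of `A` in an interval `[γ', γ)`
  obtain ⟨γ', hγ', hA2⟩ : ∃ γ' < γ, ∀ η, γ' ≤ η → η ≤ γ → A η = A γ := by
    obtain ⟨δ, hδ, hδ'⟩ := exists_forall_lt_le (fun i ↦ -v i) (-γ)
    refine ⟨-δ + (γ + δ) / 2, by linarith, fun η h1 h2 ↦ ?_⟩
    rw [hcv]
    refine le_antisymm (Submodule.span_mono (Set.image_mono fun i hi ↦ ?_)) (filOf_antitone _ _ h2)
    by_contra hlt
    have h3 := hδ' i (neg_lt_neg (not_le.1 hlt))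
    have h4 : η ≤ v i := hi
    linarith
  obtain ⟨B, ⟨hB, hBC⟩, hd⟩ := h ((γ - γ') / 2) (by linarith)
  obtain ⟨b, w, w', rfl, rfl, -⟩ := exists_common_basis hA hB
  rw [filDist_filOf, Real.sqrt_lt' (by linarith)] at hd
  have hw : ∀ i, |w i - w' i| < (γ - γ') / 2 := fun i ↦ by
    refine abs_lt_of_sq_lt_sq (lt_of_le_of_lt ?_ hd) (by linarith)
    exact Finset.single_le_sum (f := fun i ↦ (w i - w' i) ^ 2) (fun i _ ↦ sq_nonneg _)
      (Finset.mem_univ i)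
  have : filOf b w γ = filOf b w' ((γ + γ') / 2) := by
    refine le_antisymm (Submodule.span_mono (Set.image_mono fun i hi ↦ ?_)) ?_
    · have h1 : γ ≤ w i := hi
      have h2 := abs_lt.1 (hw i)
      show (γ + γ') / 2 ≤ w' i
      linarith
    · rw [← hA2 γ' le_rfl hγ'.le]
      refine Submodule.span_mono (Set.image_mono fun i hi ↦ ?_)
      have h1 : (γ + γ') / 2 ≤ w' i := hi
      have h2 := abs_lt.1 (hw i)
      show γ' ≤ w i
      linarith
  rw [this]
  exact hBC _

omit [FiniteDimensional F E] in
/-- The steps of a barycenter are sums of intersections of steps of the two ends: a basis vector of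
weights `w i` and `w' i` lies in the intersection of the steps of these indices, whose vectors have
weights at least as large. -/
theorem barycenter_mem {n : ℕ} {C : Set (Submodule F E)} (hbot : ⊥ ∈ C)
    (hsup : ∀ W ∈ C, ∀ W' ∈ C, W ⊔ W' ∈ C) (hinf : ∀ W ∈ C, ∀ W' ∈ C, W ⊓ W' ∈ C)
    (b : Basis (Fin n) F E) {w w' : Fin n → ℝ} (h : ∀ γ, filOf b w γ ∈ C)
    (h' : ∀ γ, filOf b w' γ ∈ C) {s t : ℝ} (hs : 0 ≤ s) (ht : 0 ≤ t) (γ : ℝ) :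
    filOf b (fun i ↦ s * w i + t * w' i) γ ∈ C := by
  classical
  have : filOf b (fun i ↦ s * w i + t * w' i) γ =
      (Finset.univ.filter fun i ↦ γ ≤ s * w i + t * w' i).sup
        fun i ↦ filOf b w (w i) ⊓ filOf b w' (w' i) := by
    refine le_antisymm (Submodule.span_le.2 ?_) (Finset.sup_le fun i hi ↦ ?_)
    · rintro _ ⟨i, hi, rfl⟩
      have h1 : filOf b w (w i) ⊓ filOf b w' (w' i) ≤ _ :=
        Finset.le_sup (f := fun i ↦ filOf b w (w i) ⊓ filOf b w' (w' i))
          (Finset.mem_filter.2 ⟨Finset.mem_univ i, hi⟩)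
      exact h1 ⟨Submodule.subset_span ⟨i, show w i ≤ w i from le_rfl, rfl⟩,
        Submodule.subset_span ⟨i, show w' i ≤ w' i from le_rfl, rfl⟩⟩
    · rw [filOf, filOf, span_image_inf_span_image]
      refine Submodule.span_mono (Set.image_mono ?_)
      rintro j ⟨h1, h2⟩
      have h1' : w i ≤ w j := h1
      have h2' : w' i ≤ w' j := h2
      exact (Finset.mem_filter.1 hi).2.trans
        (add_le_add (mul_le_mul_of_nonneg_left h1' hs) (mul_le_mul_of_nonneg_left h2' ht))
  rw [this]
  exact Finset.sup_induction hbot hsup fun i _ ↦ hinf _ (h _) _ (h' _)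

/-- Filtrations with steps in a sublattice form a convex set. -/
theorem isConvexIn_of_steps {C : Set (Submodule F E)} (hbot : ⊥ ∈ C)
    (hsup : ∀ W ∈ C, ∀ W' ∈ C, W ⊔ W' ∈ C) (hinf : ∀ W ∈ C, ∀ W' ∈ C, W ⊓ W' ∈ C) :
    IsConvexIn (filtrations ⊤ F E) {Ξ ∈ filtrations ⊤ F E | ∀ γ, Ξ γ ∈ C} := by
  refine ⟨fun _ h ↦ h.1, fun A ⟨hA, hAC⟩ B ⟨hB, hBC⟩ ↦ ?_⟩
  obtain ⟨b, w, w', rfl, rfl, -⟩ := exists_common_basis hA hB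
  have hmem : ∀ w, filOf b w ∈ filtrations ⊤ F E := fun w ↦
    filOf_mem_filtrations b w fun _ ↦ trivial
  constructor
  · set l := filDist (filOf b w) (filOf b w') with hl
    have hl0 : 0 ≤ l := Real.sqrt_nonneg _
    -- for `l = 0` the convention `t / 0 = 0` makes the path constant
    refine ⟨l, fun t ↦ filOf b fun i ↦ (1 - t / l) * w i + t / l * w' i, hl0, by simp, ?_,
      fun _ _ ↦ hmem _, fun s hs t ht ↦ ?_⟩
    · rcases hl0.eq_or_lt with h0 | h0
      · have h1 : filOf b w = filOf b w' :=
          eq_of_filDist_sq_nonpos (hmem _) (hmem _) (by rw [← hl, ← h0]; simp)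
        simp only [← h0, div_zero]
        simpa using h1
      · simp [div_self h0.ne']
    · rw [filDist_filOf]
      have h1 : ∑ i, ((1 - s / l) * w i + s / l * w' i - ((1 - t / l) * w i + t / l * w' i)) ^ 2 =
          (s / l - t / l) ^ 2 * ∑ i, (w i - w' i) ^ 2 := by
        rw [Finset.mul_sum]
        exact Finset.sum_congr rfl fun i _ ↦ by ring
      have h2 : ∑ i, (w i - w' i) ^ 2 = l ^ 2 := by
        rw [hl, filDist_filOf, Real.sq_sqrt (Finset.sum_nonneg fun i _ ↦ sq_nonneg _)]
      rw [h1, h2, ← mul_pow, Real.sqrt_sq_eq_abs]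
      rcases hl0.eq_or_lt with h0 | h0
      · rw [le_antisymm (hs.2.trans_eq h0.symm) hs.1, le_antisymm (ht.2.trans_eq h0.symm) ht.1]
        simp
      · congr 1
        field_simp
  · rintro l c ⟨hl0, rfl0, rfl1, hc, hd⟩ t ht
    refine ⟨hc t ht, ?_⟩
    have h0 : (0 : ℝ) ∈ Set.Icc 0 l := ⟨le_rfl, hl0⟩
    have h1 : l ∈ Set.Icc 0 l := ⟨hl0, le_rfl⟩
    rcases hl0.eq_or_lt with hz | hpos
    · have : t = 0 := le_antisymm (hz ▸ ht.2) ht.1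
      rw [this, rfl0]
      exact hAC
    · have e1 := hd 0 h0 l h1
      have e2 := hd 0 h0 t ht
      have e3 := hd t ht l h1
      rw [rfl0, rfl1, zero_sub, abs_neg, abs_of_nonneg hl0] at e1
      rw [rfl0, zero_sub, abs_neg, abs_of_nonneg ht.1] at e2
      rw [rfl1, abs_sub_comm, abs_of_nonneg (sub_nonneg.2 ht.2)] at e3
      have ht1 : t / l ≤ 1 := (div_le_one hpos).2 ht.2
      have ht0 : 0 ≤ t / l := div_nonneg ht.1 hl0
      rw [eq_barycenter (hc t ht) b w w' ht0 ht1 e1 (e2.trans (by field_simp))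
        (e3.trans (by field_simp))]
      exact barycenter_mem hbot hsup hinf b hAC hBC (sub_nonneg.2 ht1) ht0

end Metric

/-! ### Harder-Narasimhan filtrations of lattices of subspaces -/

section HarderNarasimhan

variable {F : Type*} [Field F] {E : Type*} [AddCommGroup E] [Module F E]

/-- A filtration `Ξ` with steps in the lattice `C` is a Harder-Narasimhan filtration for the degree
function `δ` if its graded piece of index `γ` has slope `γ` and is semi-stable. The slopes are
written without denominators, so that zero graded pieces need no special treatment. -/
def IsHarderNarasimhan (C : Set (Submodule F E)) (δ : Submodule F E → ℝ)
    (Ξ : ℝ → Submodule F E) : Prop :=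
  (∀ γ, Ξ γ ∈ C) ∧ ∀ γ,
    (∀ W ∈ C, plus Ξ γ ≤ W → W ≤ Ξ γ →
      δ W - δ (plus Ξ γ) ≤ γ * (sdim W - sdim (plus Ξ γ))) ∧
    δ (Ξ γ) - δ (plus Ξ γ) = γ * (sdim (Ξ γ) - sdim (plus Ξ γ))

variable [FiniteDimensional F E] {C : Set (Submodule F E)} {δ : Submodule F E → ℝ}

theorem plus_mem_of_steps {Γ : AddSubgroup ℝ} {Ξ : ℝ → Submodule F E}
    (hΞ : Ξ ∈ filtrations Γ F E) (hC : ∀ γ, Ξ γ ∈ C) (γ : ℝ) : plus Ξ γ ∈ C := by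
  obtain ⟨γ', h1, h2⟩ := exists_plus_eq hΞ γ
  exact h2 γ' h1 le_rfl ▸ hC γ'

/-- Among the members of `C` that maximize `δ W - γ dim W` there is a greatest one. -/
theorem exists_greatest_maximizer (hbot : ⊥ ∈ C) (hsup : ∀ W ∈ C, ∀ W' ∈ C, W ⊔ W' ∈ C)
    (hinf : ∀ W ∈ C, ∀ W' ∈ C, W ⊓ W' ∈ C)
    (hδ : ∀ W ∈ C, ∀ W' ∈ C, δ (W ⊔ W') + δ (W ⊓ W') = δ W + δ W')
    (hfin : (Set.range fun W : C ↦ δ W).Finite) (γ : ℝ) :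
    ∃ W ∈ C, (∀ W' ∈ C, δ W' - γ * sdim W' ≤ δ W - γ * sdim W) ∧
      ∀ X ∈ C, (∀ W' ∈ C, δ W' - γ * sdim W' ≤ δ X - γ * sdim X) → X ≤ W := by
  have hfin2 : (Set.range fun W : C ↦ δ W - γ * sdim (W : Submodule F E)).Finite := by
    refine ((hfin.prod (Set.finite_range fun n : Fin (finrank F E + 1) ↦ ((n : ℕ) : ℝ))).image
      fun q ↦ q.1 - γ * q.2).subset ?_
    rintro _ ⟨W, rfl⟩
    exact ⟨(δ W, sdim (W : Submodule F E)), ⟨⟨W, rfl⟩,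
      ⟨⟨finrank F (W : Submodule F E), Nat.lt_succ_of_le (Submodule.finrank_le _)⟩, rfl⟩⟩, rfl⟩
  obtain ⟨_, ⟨⟨W₀, hW₀⟩, rfl⟩, hmax⟩ := Set.exists_max_image _ id hfin2 ⟨_, ⟨⟨⊥, hbot⟩, rfl⟩⟩
  have hW₀' : ∀ W' ∈ C, δ W' - γ * sdim W' ≤ δ W₀ - γ * sdim W₀ := fun W' h ↦
    hmax _ ⟨⟨W', h⟩, rfl⟩
  obtain ⟨W, ⟨hW, hWm⟩, hWmax⟩ := wellFounded_gt.has_min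
    {X : Submodule F E | X ∈ C ∧ ∀ W' ∈ C, δ W' - γ * sdim W' ≤ δ X - γ * sdim X} ⟨W₀, hW₀, hW₀'⟩
  refine ⟨W, hW, hWm, fun X hX hXm ↦ ?_⟩
  have h1 : W ⊔ X ∈ C ∧ ∀ W' ∈ C, δ W' - γ * sdim W' ≤ δ (W ⊔ X) - γ * sdim (W ⊔ X) := by
    refine ⟨hsup W hW X hX, fun W' hW' ↦ ?_⟩
    have h2 := hδ W hW X hX
    have h3 := sdim_sup_add_sdim_inf W X
    have h4 := hXm _ (hinf W hW X hX)
    have h5 := hWm W' hW'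
    have h6 : γ * sdim (W ⊔ X) + γ * sdim (W ⊓ X) = γ * sdim W + γ * sdim X := by
      rw [← mul_add, h3, mul_add]
    linarith
  have h2 := eq_of_le_of_not_lt (le_sup_left : W ≤ W ⊔ X) (hWmax _ h1)
  exact h2 ▸ le_sup_right

theorem le_of_forall_Ioc {a b x y : ℝ} (hxy : x < y)
    (h : ∀ t, x < t → t ≤ y → 0 ≤ a + b * t) : 0 ≤ a + b * x := by
  have hc : Filter.Tendsto (fun t ↦ a + b * t) (nhdsWithin x (Set.Ioi x)) (nhds (a + b * x)) :=
    ((by fun_prop : Continuous fun t ↦ a + b * t).tendsto x).mono_left nhdsWithin_le_nhds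
  refine ge_of_tendsto hc ?_
  filter_upwards [Ioc_mem_nhdsGT hxy] with t ht using h t ht.1 ht.2

/-- Harder-Narasimhan filtrations exist: the step of index `γ` is the greatest maximizer of
`δ W - γ dim W`. -/
theorem exists_isHarderNarasimhan (hbot : ⊥ ∈ C) (htop : ⊤ ∈ C)
    (hsup : ∀ W ∈ C, ∀ W' ∈ C, W ⊔ W' ∈ C) (hinf : ∀ W ∈ C, ∀ W' ∈ C, W ⊓ W' ∈ C)
    (hδ0 : δ ⊥ = 0)
    (hδ : ∀ W ∈ C, ∀ W' ∈ C, δ (W ⊔ W') + δ (W ⊓ W') = δ W + δ W')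
    (hfin : (Set.range fun W : C ↦ δ W).Finite) :
    ∃ Ξ ∈ filtrations ⊤ F E, IsHarderNarasimhan C δ Ξ := by
  choose Ξ hC hmax hgr using exists_greatest_maximizer hbot hsup hinf hδ hfin
  have hanti : Antitone Ξ := by
    intro γ γ' hγ
    refine le_trans le_sup_right (hgr γ (Ξ γ ⊔ Ξ γ') (hsup _ (hC _) _ (hC _)) fun W' hW' ↦ ?_)
    have h2 := hδ _ (hC γ) _ (hC γ')
    have h3 := sdim_sup_add_sdim_inf (Ξ γ) (Ξ γ')
    have h4 := hmax γ' _ (hinf _ (hC γ) _ (hC γ'))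
    have h5 := hmax γ W' hW'
    have h6 : sdim (Ξ γ ⊓ Ξ γ') ≤ sdim (Ξ γ') := sdim_mono inf_le_right
    have h7 : sdim (Ξ γ ⊔ Ξ γ') = sdim (Ξ γ) + (sdim (Ξ γ') - sdim (Ξ γ ⊓ Ξ γ')) := by linarith
    have h8 := mul_nonneg (sub_nonneg.2 hγ) (sub_nonneg.2 h6)
    rw [h7]
    linarith
  obtain ⟨D, hD⟩ := (hfin.image abs).bddAbove
  have hD' : ∀ W ∈ C, |δ W| ≤ D := fun W hW ↦ hD ⟨_, ⟨⟨W, hW⟩, rfl⟩, rfl⟩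
  have hD0 : 0 ≤ D := (abs_nonneg _).trans (hD' ⊥ hbot)
  have hstep : ∀ W W' : Submodule F E, W < W' → sdim W + 1 ≤ sdim W' := fun W W' h ↦ by
    have := Submodule.finrank_lt_finrank_of_lt h
    unfold sdim
    exact_mod_cast this
  have hM : Ξ (D + 1) = ⊥ := by
    by_contra hne
    have h1 := hstep _ _ (bot_lt_iff_ne_bot.2 hne)
    have h2 := hmax (D + 1) ⊥ hbot
    have h3 := abs_le.1 (hD' _ (hC (D + 1)))
    rw [hδ0, sdim_bot] at h2
    rw [sdim_bot] at h1
    nlinarith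
  have hm : Ξ (-(2 * D + 1)) = ⊤ := by
    by_contra hne
    have h1 := hstep _ _ (lt_top_iff_ne_top.2 hne)
    have h2 := hmax (-(2 * D + 1)) ⊤ htop
    have h3 := abs_le.1 (hD' _ (hC (-(2 * D + 1))))
    have h4 := abs_le.1 (hD' _ htop)
    nlinarith
  have hleft : ∀ x, ∃ y < x, Ξ y = Ξ x := by
    intro x
    -- the steps stabilize when the index increases to `x`, and the limit is a maximizer
    obtain ⟨W, ⟨y, hy, rfl⟩, hmin⟩ := wellFounded_lt.has_min
      {W | ∃ y < x, W = Ξ y} ⟨_, x - 1, by linarith, rfl⟩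
    have hconst : ∀ z, y ≤ z → z < x → Ξ z = Ξ y := fun z h1 h2 ↦
      eq_of_le_of_not_lt (hanti h1) (hmin _ ⟨z, h2, rfl⟩)
    refine ⟨y, hy, le_antisymm (hgr x _ (hC y) fun W' hW' ↦ ?_) (hanti hy.le)⟩
    have := le_of_forall_Ioc (a := δ (Ξ y) - δ W') (b := sdim (Ξ y) - sdim W')
      (x := -x) (y := -y) (by linarith) fun t h1 h2 ↦ by
        have := hmax (-t) W' hW'
        rw [hconst (-t) (by linarith) (by linarith)] at this
        linarith
    linarith
  have hΞ := mem_filtrations_of_leftContinuous hanti hm hM hleft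
  refine ⟨Ξ, hΞ, hC, fun γ ↦ ?_⟩
  -- the step `Ξ₊^γ` is a maximizer too, as a limit from the other side
  have hplus : ∀ W' ∈ C, δ W' - γ * sdim W' ≤ δ (plus Ξ γ) - γ * sdim (plus Ξ γ) := by
    intro W' hW'
    obtain ⟨γ', h1, h2⟩ := exists_plus_eq hΞ γ
    have := le_of_forall_Ioc (a := δ (plus Ξ γ) - δ W') (b := sdim W' - sdim (plus Ξ γ)) h1
      fun t h3 h4 ↦ by
        have := hmax t W' hW'
        rw [h2 t h3 h4] at this
        linarith
    linarith
  refine ⟨fun W hW _ _ ↦ by linarith [hplus W hW], ?_⟩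
  linarith [hplus _ (hC γ), hmax γ _ (plus_mem_of_steps hΞ hC γ)]

variable {Ξ : ℝ → Submodule F E}

/-- The degree function is bounded by the degree of the filtration induced by a Harder-Narasimhan
filtration: this holds on every graded piece, by semi-stability. -/
theorem IsHarderNarasimhan.le_degreeOn (h : IsHarderNarasimhan C δ Ξ) {Γ : AddSubgroup ℝ}
    (hΞ : Ξ ∈ filtrations Γ F E)
    (hsup : ∀ W ∈ C, ∀ W' ∈ C, W ⊔ W' ∈ C) (hinf : ∀ W ∈ C, ∀ W' ∈ C, W ⊓ W' ∈ C)
    (hδ0 : δ ⊥ = 0)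
    (hδ : ∀ W ∈ C, ∀ W' ∈ C, δ (W ⊔ W') + δ (W ⊓ W') = δ W + δ W')
    {W : Submodule F E} (hW : W ∈ C) : δ W ≤ degreeOn Ξ W := by
  have hplus := plus_le (antitone_of_mem hΞ)
  have := le_of_forall_increment_le hΞ (fun X ↦ δ (X ⊓ W)) (by simp [hδ0])
    (fun γ ↦ (sdim (Ξ γ ⊓ W) - sdim (plus Ξ γ ⊓ W)) * γ) (fun γ ↦ ?_)
    (fun γ hγ ↦ by simp [hγ])
  · rw [degreeOn_eq_choquet hΞ]
    simpa [choquet] using this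
  · have hP := plus_mem_of_steps hΞ h.1 γ
    have hXW := hinf _ (h.1 γ) _ hW
    have e1 := (h.2 γ).1 (Ξ γ ⊓ W ⊔ plus Ξ γ) (hsup _ hXW _ hP) le_sup_right
      (sup_le inf_le_left (hplus γ))
    have e2 := hδ _ hXW _ hP
    have e3 := sdim_sup_add_sdim_inf (Ξ γ ⊓ W) (plus Ξ γ)
    have e4 : Ξ γ ⊓ W ⊓ plus Ξ γ = plus Ξ γ ⊓ W := by
      rw [inf_comm, ← inf_assoc, inf_eq_left.2 (hplus γ)]
    rw [e4] at e2 e3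
    have e5 : δ (Ξ γ ⊓ W) - δ (plus Ξ γ ⊓ W) =
      δ (Ξ γ ⊓ W ⊔ plus Ξ γ) - δ (plus Ξ γ) := by linarith
    have e6 : sdim (Ξ γ ⊓ W) - sdim (plus Ξ γ ⊓ W) =
      sdim (Ξ γ ⊓ W ⊔ plus Ξ γ) - sdim (plus Ξ γ) := by linarith
    rw [e5, e6, mul_comm]
    exact e1

/-- The first two moments of the jumps. -/
theorem finsum_sdim_sub_mul {Γ : AddSubgroup ℝ} (hΞ : Ξ ∈ filtrations Γ F E) :
    ∑ᶠ γ : ℝ, γ * (sdim (Ξ γ) - sdim (plus Ξ γ)) = degreeOn Ξ ⊤ ∧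
      ∑ᶠ γ : ℝ, γ * (sdim (Ξ γ) - sdim (plus Ξ γ)) * γ = scalarProduct Ξ Ξ := by
  constructor
  · rw [degreeOn_top hΞ, degree_eq_choquet hΞ]
    exact finsum_congr fun γ ↦ mul_comm _ _
  · obtain ⟨b, w, rfl, -⟩ := exists_filOf_of_mem hΞ
    rw [scalarProduct_filOf, ← finsum_ncard_mul w fun x ↦ x * x]
    refine finsum_congr fun γ ↦ ?_
    have : (({i | w i = γ} : Set (Fin (finrank F E))).ncard : ℝ) =
        sdim (filOf b w γ) - sdim (plus (filOf b w) γ) := by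
      rw [← finrank_span_image b, (exists_plus_filOf_eq b w γ).1]
      change sdim _ = _
      rw [filOf, sdim_span_image, sdim_span_image, sdim_span_image, ← Finset.sum_sub_distrib]
      refine Finset.sum_congr rfl fun i _ ↦ ?_
      rcases lt_trichotomy γ (w i) with h | h | h <;>
        simp [Set.indicator, h, le_of_lt, ne_of_lt, ne_of_gt, not_lt_of_gt, not_le_of_gt]
    rw [this]
    ring

/-- A Harder-Narasimhan filtration for the degree function of `N` is the nearest point to `N`
among the filtrations with steps in `C`. -/
theorem IsHarderNarasimhan.filDist_lt (h : IsHarderNarasimhan C δ Ξ)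
    (hΞ : Ξ ∈ filtrations ⊤ F E) (hbot : ⊥ ∈ C) (htop : ⊤ ∈ C)
    (hsup : ∀ W ∈ C, ∀ W' ∈ C, W ⊔ W' ∈ C) (hinf : ∀ W ∈ C, ∀ W' ∈ C, W ⊓ W' ∈ C)
    (hδ : ∀ W ∈ C, ∀ W' ∈ C, δ (W ⊔ W') + δ (W ⊓ W') = δ W + δ W')
    {N : ℝ → Submodule F E} (hN : N ∈ filtrations ⊤ F E) (hNδ : ∀ W ∈ C, degreeOn N W = δ W)
    {Ξ' : ℝ → Submodule F E} (hΞ' : Ξ' ∈ filtrations ⊤ F E) (hC' : ∀ γ, Ξ' γ ∈ C)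
    (hne : Ξ' ≠ Ξ) : filDist N Ξ < filDist N Ξ' := by
  have hδ0 : δ ⊥ = 0 := by rw [← hNδ ⊥ hbot, degreeOn_bot hN]
  have hfilt : ∀ {A : ℝ → Submodule F E}, A ∈ filtrations ⊤ F E → (∀ γ, A γ ∈ C) →
      scalarProduct N A = choquet A δ := fun hA hAC ↦ by
    rw [scalarProduct_eq_choquet hN hA]
    exact choquet_congr hA fun γ ↦ hNδ _ (hAC γ)
  -- `N - Ξ` is orthogonal to `Ξ` and has nonpositive scalar product with the other filtrations
  have h1 : scalarProduct N Ξ = scalarProduct Ξ Ξ := by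
    rw [hfilt hΞ h.1, ← (finsum_sdim_sub_mul hΞ).2]
    exact finsum_congr fun γ ↦ by rw [(h.2 γ).2]
  have htotal : δ ⊤ = degreeOn Ξ ⊤ := by
    refine le_antisymm (h.le_degreeOn hΞ hsup hinf hδ0 hδ htop) ?_
    have := le_of_forall_increment_le hΞ (fun X ↦ -δ X) (by simp [hδ0])
      (fun γ ↦ -(γ * (sdim (Ξ γ) - sdim (plus Ξ γ)))) (fun γ ↦ by linarith [(h.2 γ).2])
      (fun γ hγ ↦ by simp [hγ])
    rw [finsum_neg_distrib, (finsum_sdim_sub_mul hΞ).1] at this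
    linarith
  have h2 : scalarProduct N Ξ' ≤ scalarProduct Ξ Ξ' := by
    rw [hfilt hΞ' hC', scalarProduct_eq_choquet hΞ hΞ']
    exact (choquet_mono hΞ' (by rw [hδ0, degreeOn_bot hΞ]) htotal fun γ ↦
      h.le_degreeOn hΞ hsup hinf hδ0 hδ (hC' γ)).1
  refine lt_of_pow_lt_pow_left₀ 2 (Real.sqrt_nonneg _) ?_
  rw [filDist_sq hN hΞ, filDist_sq hN hΞ']
  have h3 : 0 < filDist Ξ Ξ' ^ 2 := by
    by_contra hn
    exact hne (eq_of_filDist_sq_nonpos hΞ hΞ' (not_lt.1 hn)).symm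
  rw [filDist_sq hΞ hΞ'] at h3
  linarith

/-- The jumps of a Harder-Narasimhan filtration are quotients of degrees by dimensions. -/
theorem IsHarderNarasimhan.mem_rationals (h : IsHarderNarasimhan C δ Ξ)
    (hΞ : Ξ ∈ filtrations ⊤ F E) (hδ : ∀ W ∈ C, δ W ∈ rationals) :
    Ξ ∈ filtrations rationals F E := by
  have hC := h.1
  have h2 := h.2
  have hplus := plus_mem_of_steps hΞ hC
  obtain ⟨b, w, rfl, -⟩ := exists_filOf_of_mem hΞ
  refine filOf_mem_filtrations b w fun i ↦ ?_
  have hlt : plus (filOf b w) (w i) < filOf b w (w i) :=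
    lt_of_le_of_ne (plus_le (filOf_antitone b w) _) (plus_filOf_ne b w i)
  have hpos := sub_pos.2 (sdim_strictMono hlt)
  obtain ⟨q, hq⟩ := hδ _ (hC (w i))
  obtain ⟨r, hr⟩ := hδ _ (hplus (w i))
  have e := (h2 (w i)).2
  have hq' : (q : ℝ) = δ (filOf b w (w i)) := hq
  have hr' : (r : ℝ) = δ (plus (filOf b w) (w i)) := hr
  refine ⟨(q - r) / (finrank F (filOf b w (w i)) - finrank F (plus (filOf b w) (w i))), ?_⟩
  change (((q - r) / (finrank F (filOf b w (w i)) - finrank F (plus (filOf b w) (w i))) : ℚ) : ℝ) =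
    w i
  push_cast
  rw [hq', hr', e]
  exact mul_div_cancel_right₀ _ hpos.ne'

end HarderNarasimhan

/-! ### Linear compactness over a complete discrete valuation ring -/

section LinearCompactness

variable {O : Type*} [CommRing O] [IsDomain O] [IsDiscreteValuationRing O] {p : ℕ}
  {V : Type*} [AddCommGroup V] [Module O V]

/-- A quotient of a discrete valuation ring by a power of its uniformizer has finitely many
ideals. -/
theorem isArtinian_quotient_span_pow (hp : Irreducible (p : O)) (c : ℕ) :
    IsArtinian O (O ⧸ Ideal.span {(p : O) ^ c}) := by
  have hsurj : Function.Surjective fun j : Fin (c + 1) ↦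
      Submodule.map (Submodule.mkQ (Ideal.span {(p : O) ^ c}))
        (Ideal.span {(p : O) ^ (j : ℕ)}) := by
    intro S
    have hle : Ideal.span {(p : O) ^ c} ≤ S.comap (Ideal.span {(p : O) ^ c}).mkQ :=
      Submodule.le_comap_mkQ _ _
    have hne : S.comap (Ideal.span {(p : O) ^ c}).mkQ ≠ ⊥ := by
      intro h
      rw [h, le_bot_iff, Ideal.span_singleton_eq_bot] at hle
      exact pow_ne_zero c hp.ne_zero hle
    obtain ⟨j, hj⟩ := IsDiscreteValuationRing.ideal_eq_span_pow_irreducible hne hp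
    have hjc : j ≤ c := by
      have h1 : Ideal.span {(p : O) ^ c} ≤ Ideal.span {(p : O) ^ j} := hj ▸ hle
      rw [Ideal.span_singleton_le_span_singleton] at h1
      exact (pow_dvd_pow_iff hp.ne_zero hp.not_isUnit).1 h1
    refine ⟨⟨j, Nat.lt_succ_of_le hjc⟩, ?_⟩
    have h2 := Submodule.map_comap_eq_of_surjective
      (Submodule.mkQ_surjective (Ideal.span {(p : O) ^ c})) S
    rw [hj] at h2
    exact h2
  have : Finite (Submodule O (O ⧸ Ideal.span {(p : O) ^ c})) := Finite.of_surjective _ hsurj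
  exact ⟨Finite.to_wellFoundedLT.wf⟩

/-- A decreasing sequence of submodules of a finitely generated module becomes stationary modulo
each power of the uniformizer. -/
theorem exists_stable_mod_pow (hp : Irreducible (p : O)) {M : Submodule O V} (hM : M.FG)
    {R : ℕ → Submodule O V} (hR : Antitone R) (hRM : ∀ n, R n ≤ M) (c : ℕ) :
    ∃ n₀, ∀ n ≥ n₀, ∀ x ∈ R n₀, ∃ y ∈ R n, ∃ m ∈ M, x - y = (p : O) ^ c • m := by
  obtain ⟨r, g, hg⟩ := Submodule.fg_iff_exists_fin_generating_family.1 hM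
  have hart := isArtinian_quotient_span_pow hp c
  set P : Submodule O V := M.map ((p : O) ^ c • LinearMap.id) with hP
  have hPmem : ∀ x, x ∈ P ↔ ∃ m ∈ M, x = (p : O) ^ c • m := fun x ↦ by
    simp only [hP, Submodule.mem_map, LinearMap.smul_apply, LinearMap.id_apply, eq_comm]
  -- the image of `M` modulo `p ^ c` is a quotient of a power of `O ⧸ p ^ c`
  let q : Fin r → (O ⧸ Ideal.span {(p : O) ^ c}) →ₗ[O] V ⧸ P := fun i ↦
    (Ideal.span {(p : O) ^ c}).liftQ (P.mkQ ∘ₗ LinearMap.toSpanSingleton O V (g i)) (by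
      rw [Ideal.span, Submodule.span_le, Set.singleton_subset_iff]
      simp only [SetLike.mem_coe, LinearMap.mem_ker, LinearMap.comp_apply,
        LinearMap.toSpanSingleton_apply, Submodule.mkQ_apply, Submodule.Quotient.mk_eq_zero]
      exact (hPmem _).2 ⟨g i, hg ▸ Submodule.subset_span ⟨i, rfl⟩, rfl⟩)
  let Q : (Fin r → O ⧸ Ideal.span {(p : O) ^ c}) →ₗ[O] V ⧸ P :=
    LinearMap.lsum O (fun _ ↦ O ⧸ Ideal.span {(p : O) ^ c}) O q
  have hQ : M.map P.mkQ ≤ LinearMap.range Q := by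
    rw [← hg, Submodule.map_span, Submodule.span_le]
    rintro _ ⟨_, ⟨i, rfl⟩, rfl⟩
    refine ⟨Pi.single i (Submodule.Quotient.mk 1), ?_⟩
    simp only [Q, LinearMap.lsum_piSingle, q]
    exact (Submodule.liftQ_apply _ _ _).trans (by simp)
  obtain ⟨n₀, hn₀⟩ := IsArtinian.monotone_stabilizes
    (⟨fun n ↦ (((R (OrderDual.ofDual n)).map P.mkQ).submoduleOf (LinearMap.range Q)), fun a b h ↦
      Submodule.comap_mono (Submodule.map_mono (hR h))⟩ : ℕ →o (Submodule O (LinearMap.range Q))ᵒᵈ)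
  refine ⟨n₀, fun n hn x hx ↦ ?_⟩
  have h1 : P.mkQ x ∈ LinearMap.range Q := hQ (Submodule.mem_map_of_mem (hRM _ hx))
  have h2 : (⟨P.mkQ x, h1⟩ : LinearMap.range Q) ∈
      ((R n₀).map P.mkQ).submoduleOf (LinearMap.range Q) := Submodule.mem_map_of_mem hx
  have h3 := hn₀ n hn
  have h4 : ((R n₀).map P.mkQ).submoduleOf (LinearMap.range Q) =
    ((R n).map P.mkQ).submoduleOf (LinearMap.range Q) := h3
  rw [h4] at h2
  obtain ⟨y, hy, hxy⟩ := h2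
  refine ⟨y, hy, (hPmem _).1 ?_⟩
  rw [← Submodule.Quotient.mk_eq_zero P, Submodule.Quotient.mk_sub, sub_eq_zero]
  exact hxy.symm

variable [IsAdicComplete (Ideal.span {(p : O)}) O]

omit [IsDomain O] [IsDiscreteValuationRing O] in
/-- A finitely generated module is complete: a Cauchy sequence for the `p`-adic topology of `M`
has a limit in `M`. -/
theorem exists_adic_limit {M : Submodule O V} (hM : M.FG) {y : ℕ → V} (hy0 : y 0 ∈ M)
    (hy : ∀ c, ∃ m ∈ M, y (c + 1) - y c = (p : O) ^ c • m) :
    ∃ z ∈ M, ∀ c, ∃ m ∈ M, z - y c = (p : O) ^ c • m := by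
  obtain ⟨r, g, hg⟩ := Submodule.fg_iff_exists_fin_generating_family.1 hM
  have hrep : ∀ m ∈ M, ∃ a : Fin r → O, ∑ i, a i • g i = m := fun m hm ↦ by
    rw [← hg] at hm
    exact (Submodule.mem_span_range_iff_exists_fun O).1 hm
  have hmem : ∀ a : Fin r → O, ∑ i, a i • g i ∈ M := fun a ↦ by
    rw [← hg]
    exact (Submodule.mem_span_range_iff_exists_fun O).2 ⟨a, rfl⟩
  choose m hm hym using hy
  choose a ha using fun c ↦ hrep (m c) (hm c)
  have hpow : ∀ n, (Ideal.span {(p : O)}) ^ n = Ideal.span {(p : O) ^ n} := fun n ↦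
    Ideal.span_singleton_pow _ _
  have hlim : ∀ i, ∃ b : O, ∀ n, ∃ e : O,
      b - ∑ c ∈ Finset.range n, (p : O) ^ c * a c i = (p : O) ^ n * e := by
    intro i
    obtain ⟨b, hb⟩ := IsPrecomplete.prec (IsAdicComplete.toIsPrecomplete
      (I := Ideal.span {(p : O)}) (M := O))
      (f := fun n ↦ ∑ c ∈ Finset.range n, (p : O) ^ c * a c i) (fun {k n} hkn ↦ by
        rw [SModEq.sub_mem, smul_eq_mul, Ideal.mul_top, hpow, Ideal.mem_span_singleton,
          ← neg_sub, dvd_neg, ← Finset.sum_Ico_eq_sub _ hkn]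
        exact Finset.dvd_sum fun c hc ↦
          Dvd.dvd.mul_right (pow_dvd_pow _ (Finset.mem_Ico.1 hc).1) _)
    refine ⟨b, fun n ↦ ?_⟩
    have := hb n
    rw [SModEq.sub_mem, smul_eq_mul, Ideal.mul_top, hpow, Ideal.mem_span_singleton,
      ← neg_sub, dvd_neg] at this
    exact this
  choose b e hbe using hlim
  have hysum : ∀ n, y n = y 0 + ∑ i, (∑ c ∈ Finset.range n, (p : O) ^ c * a c i) • g i := by
    intro n
    induction n with
    | zero => simp
    | succ n ih =>
      simp only [Finset.sum_range_succ, add_smul, Finset.sum_add_distrib]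
      rw [← add_assoc, ← ih, ← sub_eq_iff_eq_add', hym n, ← ha n, Finset.smul_sum]
      exact Finset.sum_congr rfl fun i _ ↦ (mul_smul _ _ _).symm
  refine ⟨y 0 + ∑ i, b i • g i, M.add_mem hy0 (hmem b), fun n ↦ ⟨∑ i, e i n • g i, hmem _, ?_⟩⟩
  rw [hysum n, add_sub_add_left_eq_sub, ← Finset.sum_sub_distrib, Finset.smul_sum]
  exact Finset.sum_congr rfl fun i _ ↦ by rw [← sub_smul, hbe, mul_smul]

omit [IsAdicComplete (Ideal.span {(p : O)}) O] in
/-- Submodules of a finitely generated module are closed. -/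
theorem mem_of_forall_mem_mod_pow (hp : Irreducible (p : O)) {M N : Submodule O V} (hM : M.FG)
    {x : V} (hx : x ∈ M) (h : ∀ c : ℕ, ∃ y ∈ N, ∃ m ∈ M, x - y = (p : O) ^ c • m) : x ∈ N := by
  have : Module.Finite O M := Module.Finite.iff_fg.2 hM
  have hI : Ideal.span {(p : O)} ≠ ⊤ := by
    rw [Ne, Ideal.span_singleton_eq_top]
    exact hp.not_isUnit
  have key := Ideal.iInf_pow_smul_eq_bot_of_isLocalRing (M := M ⧸ N.submoduleOf M)
    (Ideal.span {(p : O)}) hI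
  have hmem : (N.submoduleOf M).mkQ ⟨x, hx⟩ ∈
      (⨅ i : ℕ, Ideal.span {(p : O)} ^ i • ⊤ : Submodule O (M ⧸ N.submoduleOf M)) := by
    rw [Submodule.mem_iInf]
    intro c
    obtain ⟨y, hy, m, hm, hxy⟩ := h c
    have hyM : y ∈ M := by
      rw [show y = x - (p : O) ^ c • m by rw [← hxy]; abel]
      exact M.sub_mem hx (M.smul_mem _ hm)
    have h1 : (⟨x, hx⟩ : M) = ⟨y, hyM⟩ + (p : O) ^ c • ⟨m, hm⟩ := by
      ext
      simp [← hxy]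
    rw [h1, map_add, map_smul]
    have h2 : (N.submoduleOf M).mkQ ⟨y, hyM⟩ = 0 := by
      rw [Submodule.mkQ_apply, Submodule.Quotient.mk_eq_zero]
      exact hy
    rw [h2, zero_add]
    exact Submodule.smul_mem_smul (Ideal.pow_mem_pow (Ideal.mem_span_singleton_self _) _) trivial
  rw [key, Submodule.mem_bot, Submodule.mkQ_apply, Submodule.Quotient.mk_eq_zero] at hmem
  exact hmem

/-- Linear compactness of finitely generated modules: a decreasing sequence of submodules meeting
a coset of `P` has an intersection meeting this coset. -/
theorem exists_mem_iInf_of_forall (hp : Irreducible (p : O)) {M : Submodule O V} (hM : M.FG)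
    {N : ℕ → Submodule O V} (hN : Antitone N) (hNM : ∀ n, N n ≤ M) (P : Submodule O V) {x : V}
    (hx : ∀ n, ∃ y ∈ N n, x - y ∈ P) : ∃ z ∈ ⨅ n, N n, x - z ∈ P := by
  -- `u c` is an index from which on the sequence `N n ⊓ P` is constant modulo `p ^ c`
  choose u hu using exists_stable_mod_pow hp hM (R := fun n ↦ N n ⊓ P)
    (fun a b h ↦ inf_le_inf_right P (hN h)) fun n ↦ inf_le_left.trans (hNM n)
  let v : ℕ → ℕ := fun c ↦ ∑ i ∈ Finset.range (c + 1), (u i + 1)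
  have hv1 : ∀ c, v (c + 1) = v c + (u (c + 1) + 1) := fun c ↦ Finset.sum_range_succ _ _
  have hv : Monotone v := monotone_nat_of_le_succ fun c ↦ by rw [hv1]; omega
  have huv : ∀ c, u c ≤ v c := fun c ↦ by
    cases c with
    | zero => simp [v]
    | succ c => rw [hv1]; omega
  have hcv : ∀ c, c ≤ v c := fun c ↦ by
    induction c with
    | zero => omega
    | succ c ih => rw [hv1]; omega
  have step : ∀ c, ∀ y : {y // y ∈ N (v c) ∧ x - y ∈ P},
      ∃ z : {z // z ∈ N (v (c + 1)) ∧ x - z ∈ P}, ∃ m ∈ M, (z : V) - y = (p : O) ^ c • m := by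
    rintro c ⟨y, hy, hyP⟩
    obtain ⟨w, hw, hwP⟩ := hx (v (c + 1))
    have h1 : y - w ∈ N (u c) ⊓ P := by
      refine ⟨hN (huv c) ((N _).sub_mem hy (hN (hv c.le_succ) hw)), ?_⟩
      rw [show y - w = (x - w) - (x - y) by abel]
      exact P.sub_mem hwP hyP
    obtain ⟨t, ⟨ht, htP⟩, m, hm, h2⟩ := hu c (v (c + 1)) ((huv c).trans (hv c.le_succ)) _ h1
    refine ⟨⟨w + t, (N _).add_mem hw ht, ?_⟩, -m, M.neg_mem hm, ?_⟩
    · rw [show x - (w + t) = (x - w) - t by abel]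
      exact P.sub_mem hwP htP
    · rw [smul_neg, ← h2]
      simp only
      abel
  choose next hnext using step
  obtain ⟨y₀, hy₀, hy₀P⟩ := hx (v 0)
  let Y : ∀ c, {y // y ∈ N (v c) ∧ x - y ∈ P} := fun c ↦
    Nat.rec ⟨y₀, hy₀, hy₀P⟩ (fun c y ↦ next c y) c
  obtain ⟨z, hz, hlim⟩ := exists_adic_limit (p := p) hM (y := fun c ↦ (Y c).1)
    (hNM _ (Y 0).2.1) fun c ↦ hnext c (Y c)
  refine ⟨z, ?_, ?_⟩
  · rw [Submodule.mem_iInf]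
    intro n
    refine mem_of_forall_mem_mod_pow hp hM hz fun c ↦ ?_
    obtain ⟨m, hm, h⟩ := hlim (max c n)
    refine ⟨_, hN ((le_max_right c n).trans (hcv _)) (Y (max c n)).2.1,
      (p : O) ^ (max c n - c) • m, M.smul_mem _ hm, ?_⟩
    rw [h, ← mul_smul, ← pow_add, Nat.add_sub_cancel' (le_max_left c n)]
  · have h0 : z - (Y 0).1 ∈ P ⊓ M := by
      have hz0 : z - (Y 0).1 ∈ M := M.sub_mem hz (hNM _ (Y 0).2.1)
      refine ⟨mem_of_forall_mem_mod_pow hp hM hz0 fun c ↦ ?_, hz0⟩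
      obtain ⟨m, hm, h⟩ := hlim c
      refine ⟨(Y c).1 - (Y 0).1, ?_, m, hm, by rw [← h]; abel⟩
      rw [show (Y c).1 - (Y 0).1 = (x - (Y 0).1) - (x - (Y c).1) by abel]
      exact P.sub_mem (Y 0).2.2 (Y c).2.2
    rw [show x - z = (x - (Y 0).1) - (z - (Y 0).1) by abel]
    exact P.sub_mem (Y 0).2.2 h0.1

end LinearCompactness

/-! ### Lattices fixed by semilinear automorphisms -/

section Semilinear

variable {O : Type*} [CommRing O] {V : Type*} [AddCommGroup V] [Module O V]

variable (O) in
/-- An automorphism of the additive group of an `O`-module is semilinear if it is compatible with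
the scalar multiplication up to some automorphism of the ring `O`. -/
def IsSemilinear (θ : V ≃ₗ[ℤ] V) : Prop :=
  ∃ τ : O ≃+* O, ∀ (a : O) (x : V), θ (a • x) = τ a • θ x

theorem IsSemilinear.one : IsSemilinear O (1 : V ≃ₗ[ℤ] V) :=
  ⟨RingEquiv.refl O, fun _ _ ↦ rfl⟩

theorem IsSemilinear.mul {θ η : V ≃ₗ[ℤ] V} (hθ : IsSemilinear O θ) (hη : IsSemilinear O η) :
    IsSemilinear O (θ * η) := by
  obtain ⟨τ, hτ⟩ := hθ
  obtain ⟨υ, hυ⟩ := hη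
  exact ⟨υ.trans τ, fun a x ↦ by simp [hυ, hτ]⟩

theorem apply_inv_self (θ : V ≃ₗ[ℤ] V) (x : V) : θ (θ⁻¹ x) = x := θ.apply_symm_apply x

theorem inv_apply_self (θ : V ≃ₗ[ℤ] V) (x : V) : θ⁻¹ (θ x) = x := θ.symm_apply_apply x

theorem IsSemilinear.inv {θ : V ≃ₗ[ℤ] V} (hθ : IsSemilinear O θ) : IsSemilinear O θ⁻¹ := by
  obtain ⟨τ, hτ⟩ := hθ
  refine ⟨τ.symm, fun a x ↦ θ.injective ?_⟩
  rw [hτ, apply_inv_self, apply_inv_self, RingEquiv.apply_symm_apply]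

theorem IsSemilinear.pow {θ : V ≃ₗ[ℤ] V} (hθ : IsSemilinear O θ) (n : ℕ) :
    IsSemilinear O (θ ^ n) := by
  induction n with
  | zero => exact IsSemilinear.one
  | succ n ih => exact pow_succ θ n ▸ ih.mul hθ

/-- The image of a submodule by a semilinear automorphism. -/
theorem IsSemilinear.exists_image {θ : V ≃ₗ[ℤ] V} (hθ : IsSemilinear O θ) (M : Submodule O V) :
    ∃ M' : Submodule O V, (∀ x, x ∈ M' ↔ θ⁻¹ x ∈ M) ∧ (M.FG → M'.FG) := by
  obtain ⟨τ, hτ⟩ := hθ.inv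
  let M' : Submodule O V :=
    { carrier := {x | θ⁻¹ x ∈ M}
      add_mem' := fun {x y} hx hy ↦ show θ⁻¹ (x + y) ∈ M by
        rw [map_add]
        exact M.add_mem hx hy
      zero_mem' := show θ⁻¹ 0 ∈ M by simp
      smul_mem' := fun a x hx ↦ show θ⁻¹ (a • x) ∈ M by
        rw [hτ]
        exact M.smul_mem _ hx }
  have hM' : ∀ x, x ∈ M' ↔ θ⁻¹ x ∈ M := fun x ↦ Iff.rfl
  refine ⟨M', hM', ?_⟩
  rintro ⟨S, rfl⟩
  classical
  refine ⟨S.image θ, le_antisymm (Submodule.span_le.2 ?_) fun x hx ↦ ?_⟩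
  · intro y hy
    obtain ⟨x, hx, rfl⟩ := Finset.mem_image.1 (Finset.mem_coe.1 hy)
    refine (hM' _).2 ?_
    rw [inv_apply_self]
    exact Submodule.subset_span hx
  · have h1 := (hM' x).1 hx
    have h2 : ∀ y ∈ Submodule.span O (S : Set V),
        θ y ∈ Submodule.span O ((S.image θ : Finset V) : Set V) := by
      obtain ⟨υ, hυ⟩ := hθ
      intro y hy
      induction hy using Submodule.span_induction with
      | mem y hy =>
        exact Submodule.subset_span (Finset.mem_coe.2 (Finset.mem_image_of_mem θ hy))
      | zero => simp
      | add y z _ _ h1 h2 => rw [map_add]; exact Submodule.add_mem _ h1 h2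
      | smul a y _ h => rw [hυ]; exact Submodule.smul_mem _ _ h
    have h3 := h2 _ h1
    rwa [apply_inv_self] at h3

/-- The images of a submodule by the powers of a semilinear automorphism mapping it into itself. -/
theorem IsSemilinear.exists_iterates {θ : V ≃ₗ[ℤ] V} (hθ : IsSemilinear O θ)
    {M : Submodule O V} (hM : ∀ x ∈ M, θ x ∈ M) :
    ∃ N : ℕ → Submodule O V, (∀ n x, x ∈ N n ↔ (θ ^ n)⁻¹ x ∈ M) ∧ Antitone N ∧
      ∀ n, N n ≤ M := by
  choose N hN _ using fun n ↦ (hθ.pow n).exists_image M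
  have hanti : Antitone N := antitone_nat_of_succ_le fun n x hx ↦ by
    rw [hN] at hx ⊢
    have := hM _ hx
    rwa [pow_succ, mul_inv_rev, LinearEquiv.mul_apply, apply_inv_self] at this
  refine ⟨N, hN, hanti, fun n x hx ↦ ?_⟩
  simpa using (hN 0 x).1 (hanti (Nat.zero_le n) hx)

/-- A semilinear automorphism mapping a lattice `M` into itself induces a bijection of
`M' = ⋂ θ ^ n M`, and the reduction of `M'` modulo any submodule `P` is as large as possible, by
linear compactness: it contains every class which is in the image of all `θ ^ n M`. -/
theorem IsSemilinear.exists_fixed_submodule [IsDomain O] [IsDiscreteValuationRing O] {p : ℕ}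
    [IsAdicComplete (Ideal.span {(p : O)}) O] (hp : Irreducible (p : O))
    {θ : V ≃ₗ[ℤ] V} (hθ : IsSemilinear O θ) {M : Submodule O V} (hfg : M.FG)
    (hM : ∀ x ∈ M, θ x ∈ M) :
    ∃ M' : Submodule O V, M'.FG ∧ (∀ x, θ x ∈ M' ↔ x ∈ M') ∧
      ∀ (P : Submodule O V) (x : V), (∀ n, ∃ y ∈ M, x - (θ ^ n) y ∈ P) →
        ∃ z ∈ M', x - z ∈ P := by
  obtain ⟨N, hN, hanti, hNM⟩ := hθ.exists_iterates hM
  refine ⟨⨅ n, N n, ?_, fun x ↦ ?_, fun P x hx ↦ ?_⟩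
  · have : IsNoetherian O M := isNoetherian_of_fg_of_noetherian M hfg
    exact Submodule.FG.of_le hfg ((iInf_le N 0).trans (hNM 0))
  · simp only [Submodule.mem_iInf, hN]
    refine ⟨fun h n ↦ ?_, fun h n ↦ ?_⟩
    · have := h (n + 1)
      rwa [pow_succ', mul_inv_rev, LinearEquiv.mul_apply, inv_apply_self] at this
    · cases n with
      | zero => simpa using hM _ (by simpa using h 0)
      | succ n => rw [pow_succ', mul_inv_rev, LinearEquiv.mul_apply, inv_apply_self]; exact h n
  · refine exists_mem_iInf_of_forall hp hfg hanti hNM P fun n ↦ ?_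
    obtain ⟨y, hy, h⟩ := hx n
    exact ⟨(θ ^ n) y, (hN n _).2 (by rwa [inv_apply_self]), h⟩

end Semilinear

section Lattices

variable {O : Type*} [CommRing O] [IsDomain O] [IsDiscreteValuationRing O] {p : ℕ}
  {K : Type*} [Field K] [Algebra O K]
  {V : Type*} [AddCommGroup V] [Module K V] [Module O V] [IsScalarTower O K V]

/-- Additive maps commute with the powers of `p`, including the negative ones. -/
theorem map_zpow_smul (θ : V ≃ₗ[ℤ] V) (hp0 : (p : K) ≠ 0) (z : ℤ) (x : V) :
    θ ((p : K) ^ z • x) = (p : K) ^ z • θ x := by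
  have h1 : ∀ (n : ℕ) (x : V), θ ((p : K) ^ n • x) = (p : K) ^ n • θ x := fun n x ↦ by
    have h2 : ∀ y : V, (p : K) ^ n • y = ((p ^ n : ℕ) : ℤ) • y := fun y ↦ by
      rw [natCast_zsmul, ← Nat.cast_smul_eq_nsmul K]
      push_cast
      rfl
    rw [h2, h2, map_zsmul]
  obtain ⟨n, rfl | rfl⟩ := z.eq_nat_or_neg
  · simpa using h1 n x
  · have hpn : (p : K) ^ n ≠ 0 := pow_ne_zero n hp0
    rw [zpow_neg, zpow_natCast]
    have h2 := h1 n (((p : K) ^ n)⁻¹ • x)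
    rw [smul_inv_smul₀ hpn] at h2
    rw [h2, inv_smul_smul₀ hpn]

omit [IsDomain O] [IsDiscreteValuationRing O] in
theorem natCast_pow_smul (n : ℕ) (x : V) : (p : O) ^ n • x = (p : K) ^ n • x := by
  rw [← algebraMap_smul K ((p : O) ^ n) x]
  simp

variable (V) in
/-- The multiplication by a power of `p`. -/
noncomputable def scale (hp0 : (p : K) ≠ 0) (z : ℤ) : V ≃ₗ[ℤ] V :=
  (LinearEquiv.smulOfNeZero K V ((p : K) ^ z) (zpow_ne_zero z hp0)).restrictScalars ℤ

theorem scale_apply (hp0 : (p : K) ≠ 0) (z : ℤ) (x : V) :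
    scale V hp0 z x = (p : K) ^ z • x := rfl

omit [IsDomain O] [IsDiscreteValuationRing O] in
theorem isSemilinear_scale (hp0 : (p : K) ≠ 0) (z : ℤ) : IsSemilinear O (scale V hp0 z) :=
  ⟨RingEquiv.refl O, fun a x ↦ by
    rw [scale_apply, scale_apply, RingEquiv.refl_apply, ← algebraMap_smul K a x, smul_comm,
      algebraMap_smul]⟩

/-- The operator `p ^ (-d) f ^ h`, which is bijective on the lattices exhibiting the slope
`d / h` of `f`. -/
noncomputable def twist (hp0 : (p : K) ≠ 0) (f : V ≃ₗ[ℤ] V) (d : ℤ) (h : ℕ) : V ≃ₗ[ℤ] V :=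
  scale V hp0 (-d) * f ^ h

theorem twist_apply (hp0 : (p : K) ≠ 0) (f : V ≃ₗ[ℤ] V) (d : ℤ) (h : ℕ) (x : V) :
    twist hp0 f d h x = (p : K) ^ (-d) • (f ^ h) x := rfl

omit [IsDomain O] [IsDiscreteValuationRing O] in
theorem isSemilinear_twist (hp0 : (p : K) ≠ 0) {f : V ≃ₗ[ℤ] V} (hf : IsSemilinear O f) (d : ℤ)
    (h : ℕ) : IsSemilinear O (twist hp0 f d h) :=
  (isSemilinear_scale hp0 _).mul (hf.pow h)

theorem twist_pow_apply (hp0 : (p : K) ≠ 0) (f : V ≃ₗ[ℤ] V) (d : ℤ) (h n : ℕ) (x : V) :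
    (twist hp0 f d h ^ n) x = (p : K) ^ (-(d * n)) • (f ^ (h * n)) x := by
  induction n with
  | zero => simp
  | succ n ih =>
    rw [pow_succ', LinearEquiv.mul_apply, ih, twist_apply, map_zpow_smul _ hp0, smul_smul,
      ← zpow_add₀ hp0, ← LinearEquiv.mul_apply, ← pow_add]
    congr 2
    · push_cast
      ring
    · ring_nf

theorem twist_pow (hp0 : (p : K) ≠ 0) (f : V ≃ₗ[ℤ] V) (d : ℤ) (h n : ℕ) :
    twist hp0 f d h ^ n = twist hp0 f (d * n) (h * n) :=
  LinearEquiv.ext fun x ↦ twist_pow_apply hp0 f d h n x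

theorem mem_pow_iff {θ : V ≃ₗ[ℤ] V} {M : Set V} (h : ∀ x, θ x ∈ M ↔ x ∈ M) (n : ℕ) (x : V) :
    (θ ^ n) x ∈ M ↔ x ∈ M := by
  induction n with
  | zero => simp
  | succ n ih => rw [pow_succ', LinearEquiv.mul_apply, h, ih]

/-- The lifting of slopes: if `θ` maps a lattice of the subspace `V₁` into itself and induces a
bijection of the image of `M₀` modulo `V₁`, then this image lifts to a lattice on which `θ` is
bijective. -/
theorem exists_fixed_lift [IsAdicComplete (Ideal.span {(p : O)}) O] (hp : Irreducible (p : O))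
    (hp0 : (p : K) ≠ 0) {θ : V ≃ₗ[ℤ] V} (hθ : IsSemilinear O θ) {V₁ : Submodule K V}
    (hV₁ : ∀ x ∈ V₁, θ x ∈ V₁) {M₁ : Submodule O V} (hM₁ : M₁.FG)
    (hspan : ∀ x ∈ V₁, ∃ n : ℕ, (p : K) ^ n • x ∈ M₁) (hθ₁ : ∀ x ∈ M₁, θ x ∈ M₁)
    {M₀ : Submodule O V} (hM₀ : M₀.FG) (h1 : ∀ x ∈ M₀, ∃ y ∈ M₀, θ x - y ∈ V₁)
    (h2 : ∀ x ∈ M₀, ∃ y ∈ M₀, x - θ y ∈ V₁) :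
    ∃ M' : Submodule O V, M'.FG ∧ (∀ x, θ x ∈ M' ↔ x ∈ M') ∧
      ∀ x ∈ M₀, ∃ z ∈ M', x - z ∈ V₁ := by
  obtain ⟨r, g, hg⟩ := Submodule.fg_iff_exists_fin_generating_family.1 hM₀
  have hgM : ∀ i, g i ∈ M₀ := fun i ↦ hg ▸ Submodule.subset_span ⟨i, rfl⟩
  choose y hy hyV using fun i ↦ h1 (g i) (hgM i)
  choose n hn using fun i ↦ hspan _ (hyV i)
  set m := ∑ i, n i with hm
  have hnm : ∀ i, n i ≤ m := fun i ↦
    Finset.single_le_sum (fun _ _ ↦ Nat.zero_le _) (Finset.mem_univ i)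
  -- the lattice `p ^ (-m) M₁` of `V₁` absorbs the errors made by `θ` on the generators of `M₀`
  obtain ⟨M₂, hM₂, hM₂fg⟩ := (isSemilinear_scale (O := O) (V := V) hp0 (-m)).exists_image M₁
  have hM₂' : ∀ x, x ∈ M₂ ↔ (p : K) ^ m • x ∈ M₁ := fun x ↦ by
    rw [hM₂]
    have : (scale V hp0 (-(m : ℤ)))⁻¹ x = (p : K) ^ m • x := by
      apply (scale V hp0 (-(m : ℤ))).injective
      rw [apply_inv_self, scale_apply, zpow_neg, zpow_natCast, inv_smul_smul₀ (pow_ne_zero m hp0)]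
    rw [this]
  have hθ₀ : ∀ u ∈ Submodule.span O (Set.range g), θ u ∈ M₀ ⊔ M₂ := by
    obtain ⟨τ, hτ⟩ := hθ
    intro u hu
    induction hu using Submodule.span_induction with
    | mem u hu =>
      obtain ⟨i, rfl⟩ := hu
      rw [show θ (g i) = y i + (θ (g i) - y i) by abel]
      refine Submodule.add_mem _ (Submodule.mem_sup_left (hy i)) (Submodule.mem_sup_right ?_)
      rw [hM₂', ← Nat.sub_add_cancel (hnm i), pow_add, mul_smul, ← natCast_pow_smul (O := O)]
      exact M₁.smul_mem _ (hn i)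
    | zero => simp
    | add u w _ _ h3 h4 => rw [map_add]; exact Submodule.add_mem _ h3 h4
    | smul a u _ h3 => rw [hτ]; exact Submodule.smul_mem _ _ h3
  have hθM : ∀ x ∈ M₀ ⊔ M₂, θ x ∈ M₀ ⊔ M₂ := by
    intro x hx
    obtain ⟨u, hu, v, hv, rfl⟩ := Submodule.mem_sup.1 hx
    rw [map_add]
    refine Submodule.add_mem _ (hθ₀ u (hg ▸ hu)) (Submodule.mem_sup_right ?_)
    rw [hM₂'] at hv ⊢
    rw [← zpow_natCast, ← map_zpow_smul θ hp0, zpow_natCast]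
    exact hθ₁ _ hv
  obtain ⟨M', hM'fg, hM', hlift⟩ := hθ.exists_fixed_submodule hp (hM₀.sup (hM₂fg hM₁)) hθM
  refine ⟨M', hM'fg, hM', fun x hx ↦ hlift (V₁.restrictScalars O) x fun n ↦ ?_⟩
  have hV₁n : ∀ n, ∀ x ∈ V₁, (θ ^ n) x ∈ V₁ := fun n ↦ by
    induction n with
    | zero => simp
    | succ n ih => exact fun x hx ↦ by rw [pow_succ', LinearEquiv.mul_apply]; exact hV₁ _ (ih x hx)
  suffices h : ∃ y ∈ M₀, x - (θ ^ n) y ∈ V₁ by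
    obtain ⟨y, hy, h⟩ := h
    exact ⟨y, Submodule.mem_sup_left hy, h⟩
  induction n with
  | zero => exact ⟨x, hx, by simp⟩
  | succ n ih =>
    obtain ⟨y, hy, h3⟩ := ih
    obtain ⟨w, hw, h4⟩ := h2 y hy
    refine ⟨w, hw, ?_⟩
    have := V₁.add_mem h3 (hV₁n n _ h4)
    rw [map_sub] at this
    rw [pow_succ, LinearEquiv.mul_apply]
    simpa using this

end Lattices

/-! ### The first slope of a cyclic vector -/

section CyclicVector

variable {O : Type*} [CommRing O] {p : ℕ} {K : Type*} [Field K] [Algebra O K]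
  {V : Type*} [AddCommGroup V] [Module K V] [Module O V] [IsScalarTower O K V]

/-- Nonzero elements of the fraction field are units times powers of the uniformizer. -/
theorem exists_eq_unit_mul_zpow [IsDomain O] [IsDiscreteValuationRing O] [IsFractionRing O K]
    (hp : Irreducible (p : O)) {a : K} (ha : a ≠ 0) :
    ∃ (z : ℤ) (u : Oˣ), a = algebraMap O K u * (p : K) ^ z := by
  obtain ⟨x, y, hy, rfl⟩ := IsFractionRing.div_surjective (A := O) a
  have hx0 : x ≠ 0 := by
    rintro rfl
    simp at ha
  have hy0 : y ≠ 0 := nonZeroDivisors.ne_zero hy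
  obtain ⟨m, u, rfl⟩ := IsDiscreteValuationRing.eq_unit_mul_pow_irreducible hx0 hp
  obtain ⟨n, w, rfl⟩ := IsDiscreteValuationRing.eq_unit_mul_pow_irreducible hy0 hp
  have hp0 : (p : K) ≠ 0 := by
    intro h
    apply hp.ne_zero
    apply IsFractionRing.injective O K
    simpa using h
  refine ⟨m - n, u * w⁻¹, ?_⟩
  have hw : algebraMap O K w ≠ 0 := by
    rw [Ne, FaithfulSMul.algebraMap_eq_zero_iff]
    exact w.ne_zero
  have hw' : algebraMap O K ((w⁻¹ : Oˣ) : O) = (algebraMap O K w)⁻¹ := by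
    refine eq_inv_of_mul_eq_one_left ?_
    rw [← map_mul, Units.inv_mul, map_one]
  rw [zpow_sub₀ hp0]
  push_cast
  simp only [hw', zpow_natCast]
  field_simp

/-- The `O`-submodule generated by the vectors `p ^ m f ^ j v` with `h m + d j ≥ r`. When `d / h` is
the smallest slope of the vector `v` it consists of the vectors of "valuation" at least `r / h`,
where `f ^ j v` is given the valuation `d j / h`. -/
def slopeLattice (O : Type*) [CommRing O] (p : ℕ) (K : Type*) [Field K] {V : Type*}
    [AddCommGroup V] [Module K V] [Module O V] (f : V ≃ₗ[ℤ] V) (v : V) (d : ℤ) (h : ℕ) (r : ℤ) :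
    Submodule O V :=
  Submodule.span O {x | ∃ (m : ℤ) (j : ℕ), r ≤ h * m + d * j ∧ x = (p : K) ^ m • (f ^ j) v}

variable {f : V ≃ₗ[ℤ] V} {v : V} {d : ℤ} {h : ℕ}

omit [Algebra O K] [IsScalarTower O K V] in
theorem mem_slopeLattice (m r : ℤ) (j : ℕ) (hr : r ≤ h * m + d * j) :
    (p : K) ^ m • (f ^ j) v ∈ slopeLattice O p K f v d h r :=
  Submodule.subset_span ⟨m, j, hr, rfl⟩

omit [Algebra O K] [IsScalarTower O K V] in
theorem slopeLattice_anti {r s : ℤ} (hrs : r ≤ s) :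
    slopeLattice O p K f v d h s ≤ slopeLattice O p K f v d h r :=
  Submodule.span_mono fun _ ⟨m, j, h1, h2⟩ ↦ ⟨m, j, hrs.trans h1, h2⟩

theorem zpow_smul_mem_slopeLattice (hp0 : (p : K) ≠ 0) {r : ℤ} {x : V} (m : ℤ)
    (hx : x ∈ slopeLattice O p K f v d h r) :
    (p : K) ^ m • x ∈ slopeLattice O p K f v d h (r + h * m) := by
  obtain ⟨τ, hτ⟩ := isSemilinear_scale (O := O) (V := V) hp0 m
  simp only [scale_apply] at hτ
  unfold slopeLattice at hx
  induction hx using Submodule.span_induction with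
  | mem x hx =>
    obtain ⟨m', j, h1, rfl⟩ := hx
    rw [smul_smul, ← zpow_add₀ hp0]
    exact mem_slopeLattice _ _ _ (by linarith)
  | zero => simp
  | add x y _ _ h1 h2 => rw [smul_add]; exact Submodule.add_mem _ h1 h2
  | smul a x _ h1 => rw [hτ]; exact Submodule.smul_mem _ _ h1

omit [Algebra O K] [IsScalarTower O K V] in
theorem apply_mem_slopeLattice (hp0 : (p : K) ≠ 0) (hf : IsSemilinear O f) {r : ℤ} {x : V}
    (hx : x ∈ slopeLattice O p K f v d h r) (n : ℕ) :
    (f ^ n) x ∈ slopeLattice O p K f v d h (r + d * n) := by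
  obtain ⟨τ, hτ⟩ := hf.pow n
  unfold slopeLattice at hx
  induction hx using Submodule.span_induction with
  | mem x hx =>
    obtain ⟨m', j, h1, rfl⟩ := hx
    rw [map_zpow_smul _ hp0, ← LinearEquiv.mul_apply, ← pow_add]
    exact mem_slopeLattice _ _ _ (by push_cast; linarith)
  | zero => simp
  | add x y _ _ h1 h2 => rw [map_add]; exact Submodule.add_mem _ h1 h2
  | smul a x _ h1 => rw [hτ]; exact Submodule.smul_mem _ _ h1

theorem twist_mem_slopeLattice (hp0 : (p : K) ≠ 0) (hf : IsSemilinear O f) {r : ℤ} {x : V}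
    (hx : x ∈ slopeLattice O p K f v d h r) :
    twist hp0 f d h x ∈ slopeLattice O p K f v d h r := by
  rw [twist_apply]
  have := zpow_smul_mem_slopeLattice hp0 (-d) (apply_mem_slopeLattice hp0 hf hx h)
  rwa [show r + d * h + h * -d = r by ring] at this

variable {n : ℕ} {u : ℕ → O} {z : ℕ → ℤ}

/-- By the relation expressing `f ^ n v`, the vectors `f ^ i v` with `i < n` suffice to generate.
The hypothesis `hz` says that the Newton polygon of the relation has no slope smaller than
`d / h`. -/
theorem slopeLattice_le_span (hp0 : (p : K) ≠ 0) (hf : IsSemilinear O f) (hh : 0 < h)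
    (hrel : (f ^ n) v = ∑ i ∈ Finset.range n, u i • (p : K) ^ z i • (f ^ i) v)
    (hz : ∀ i < n, d * (n - i) ≤ h * z i) (r : ℤ) :
    slopeLattice O p K f v d h r ≤ Submodule.span O
      (Set.range fun i : Fin n ↦ (p : K) ^ (-((d * (i : ℕ) - r) / h)) • (f ^ (i : ℕ)) v) := by
  rw [slopeLattice, Submodule.span_le]
  rintro _ ⟨m, j, hr, rfl⟩
  induction j using Nat.strong_induction_on generalizing m with
  | _ j ih =>
    rcases lt_or_ge j n with hj | hj
    · have h1 : -m ≤ (d * j - r) / h := by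
        rw [Int.le_ediv_iff_mul_le (by exact_mod_cast hh)]
        linarith
      obtain ⟨c, hc⟩ := Int.eq_ofNat_of_zero_le (show 0 ≤ m + (d * j - r) / h by linarith)
      have h2 : (p : K) ^ m • (f ^ j) v =
          (p : O) ^ c • (p : K) ^ (-((d * j - r) / h)) • (f ^ j) v := by
        rw [natCast_pow_smul (K := K), smul_smul, ← zpow_natCast (p : K) c, ← zpow_add₀ hp0, ← hc]
        congr 2
        ring
      rw [h2]
      exact Submodule.smul_mem _ _ (Submodule.subset_span ⟨⟨j, hj⟩, rfl⟩)
    · obtain ⟨τ, hτ⟩ := hf.pow (j - n)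
      have h1 : (p : K) ^ m • (f ^ j) v = ∑ i ∈ Finset.range n,
          τ (u i) • (p : K) ^ (m + z i) • (f ^ (j - n + i)) v := by
        conv_lhs => rw [← Nat.sub_add_cancel hj, pow_add, LinearEquiv.mul_apply, hrel, map_sum,
          Finset.smul_sum]
        refine Finset.sum_congr rfl fun i _ ↦ ?_
        obtain ⟨υ, hυ⟩ := isSemilinear_scale (O := O) (V := V) hp0 m
        rw [hτ, map_zpow_smul _ hp0, ← LinearEquiv.mul_apply, ← pow_add, zpow_add₀ hp0, mul_smul,
          ← algebraMap_smul K (τ (u i)), smul_comm, algebraMap_smul]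
      rw [h1]
      refine Submodule.sum_mem _ fun i hi ↦ Submodule.smul_mem _ _ ?_
      have hi' := Finset.mem_range.1 hi
      refine ih _ (by omega) _ ?_
      have := hz i hi'
      push_cast [Nat.cast_sub hj]
      linarith

theorem slopeLattice_fg (hp0 : (p : K) ≠ 0) (hf : IsSemilinear O f) (hh : 0 < h)
    (hrel : (f ^ n) v = ∑ i ∈ Finset.range n, u i • (p : K) ^ z i • (f ^ i) v)
    (hz : ∀ i < n, d * (n - i) ≤ h * z i) (r : ℤ) : (slopeLattice O p K f v d h r).FG := by
  have : slopeLattice O p K f v d h r = Submodule.span O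
      (Set.range fun i : Fin n ↦ (p : K) ^ (-((d * (i : ℕ) - r) / h)) • (f ^ (i : ℕ)) v) := by
    refine le_antisymm (slopeLattice_le_span hp0 hf hh hrel hz r) (Submodule.span_le.2 ?_)
    rintro _ ⟨i, rfl⟩
    refine mem_slopeLattice _ _ _ ?_
    have := Int.ediv_mul_le (d * (i : ℕ) - r) (b := h) (by exact_mod_cast hh.ne')
    linarith
  rw [this]
  exact Submodule.fg_span (Set.finite_range _)

/-- The vector `f ^ j v` has exact valuation `d j / h`, provided that `d / h` is the slope of the
first segment of the Newton polygon of the relation: `i₀` is the smallest index for which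
`z i / (n - i)` takes its minimal value `d / h`. -/
theorem notMem_slopeLattice [IsDomain O] [IsDiscreteValuationRing O] [FaithfulSMul O K]
    (hp : Irreducible (p : O)) (hp0 : (p : K) ≠ 0) (hf : IsSemilinear O f) (hh : 0 < h)
    (hli : LinearIndependent K fun i : Fin n ↦ (f ^ (i : ℕ)) v)
    (hrel : (f ^ n) v = ∑ i ∈ Finset.range n, u i • (p : K) ^ z i • (f ^ i) v)
    (hz : ∀ i < n, d * (n - i) ≤ h * z i) {i₀ : ℕ} (hi₀ : i₀ + h = n)
    (hz₀ : z i₀ = d) (hu₀ : IsUnit (u i₀)) (hlt : ∀ i < i₀, d * (n - i) < h * z i) (j : ℕ) :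
    (f ^ j) v ∉ slopeLattice O p K f v d h (d * j + 1) := by
  classical
  intro hj
  have hex : ∃ j : ℕ, (f ^ j) v ∈ slopeLattice O p K f v d h (d * j + 1) := ⟨j, hj⟩
  clear hj j
  obtain ⟨J, hJ, hmin⟩ : ∃ J : ℕ, (f ^ J) v ∈ slopeLattice O p K f v d h (d * J + 1) ∧
      ∀ j < J, (f ^ j) v ∉ slopeLattice O p K f v d h (d * j + 1) :=
    ⟨Nat.find hex, Nat.find_spec hex, fun j hj ↦ Nat.find_min hex hj⟩
  rcases lt_or_ge J n with hJn | hJn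
  · -- for `J < n` the claim contradicts the uniqueness of coordinates
    have h1 := slopeLattice_le_span hp0 hf hh hrel hz _ hJ
    obtain ⟨c, hc⟩ := (Submodule.mem_span_range_iff_exists_fun O).1 h1
    have h2 : ∑ i : Fin n, (algebraMap O K (c i) * (p : K) ^ (-((d * (i : ℕ) - (d * J + 1)) / h)) -
        if i = ⟨J, hJn⟩ then 1 else 0) • (f ^ (i : ℕ)) v = 0 := by
      simp only [sub_smul, Finset.sum_sub_distrib, mul_smul, algebraMap_smul, hc]
      simp
    have h3 := Fintype.linearIndependent_iff.1 hli _ h2 ⟨J, hJn⟩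
    have h4 : (d * (J : ℤ) - (d * J + 1)) / h = -1 := by
      rw [show d * (J : ℤ) - (d * J + 1) = -1 by ring]
      exact Int.ediv_eq_neg_one_of_neg_of_le (by omega) (by omega)
    simp only [h4, neg_neg, zpow_one, if_true] at h3
    apply hp.not_isUnit
    refine IsUnit.of_mul_eq_one (c ⟨J, hJn⟩) (FaithfulSMul.algebraMap_injective O K ?_)
    rw [map_mul, map_natCast, map_one, mul_comm]
    exact sub_eq_zero.1 h3
  · -- for larger `J` the relation shows that `J - 1` has the same property
    have hJ' : ∀ j ≥ J, (f ^ j) v ∈ slopeLattice O p K f v d h (d * j + 1) := fun j hj ↦ by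
      have := apply_mem_slopeLattice hp0 hf hJ (j - J)
      rw [← LinearEquiv.mul_apply, ← pow_add, Nat.sub_add_cancel hj] at this
      convert this using 1
      push_cast [Nat.cast_sub hj]
      ring_nf
    obtain ⟨k, hk⟩ : ∃ k, J = k + i₀ + 1 := ⟨J - i₀ - 1, by omega⟩
    obtain ⟨τ, hτ⟩ := hf.pow k
    have hfk : ∀ i, (f ^ k) (u i • (p : K) ^ z i • (f ^ i) v) =
        τ (u i) • (p : K) ^ z i • (f ^ (k + i)) v := fun i ↦ by
      rw [hτ, map_zpow_smul _ hp0, ← LinearEquiv.mul_apply, ← pow_add]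
    have h1 : (f ^ (k + n)) v =
        ∑ i ∈ Finset.range n, τ (u i) • (p : K) ^ z i • (f ^ (k + i)) v := by
      rw [pow_add, LinearEquiv.mul_apply, hrel, map_sum]
      exact Finset.sum_congr rfl fun i _ ↦ hfk i
    have hi₀n : i₀ ∈ Finset.range n := Finset.mem_range.2 (by omega)
    rw [← Finset.add_sum_erase _ _ hi₀n, ← sub_eq_iff_eq_add] at h1
    have h2 : τ (u i₀) • (p : K) ^ z i₀ • (f ^ (k + i₀)) v ∈
        slopeLattice O p K f v d h (d * (k + n : ℕ) + 1) := by
      rw [← h1]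
      refine Submodule.sub_mem _ (hJ' _ (by omega)) (Submodule.sum_mem _ fun i hi ↦ ?_)
      obtain ⟨hne, hi⟩ := Finset.mem_erase.1 hi
      have hin := Finset.mem_range.1 hi
      refine Submodule.smul_mem _ _ ?_
      rcases lt_or_gt_of_ne hne with h3 | h3
      · refine mem_slopeLattice _ _ _ ?_
        have := hlt i h3
        push_cast
        linarith
      · have := zpow_smul_mem_slopeLattice hp0 (z i) (hJ' (k + i) (by omega))
        refine slopeLattice_anti ?_ this
        have := hz i hin
        push_cast
        linarith
    have hτu : IsUnit (τ (u i₀)) := hu₀.map τ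
    obtain ⟨w, hw⟩ := hτu
    have h3 := zpow_smul_mem_slopeLattice hp0 (-d) (Submodule.smul_mem _ (↑w⁻¹ : O) h2)
    rw [← hw, smul_smul, Units.inv_mul, one_smul, smul_smul, hz₀, ← zpow_add₀ hp0, neg_add_cancel,
      zpow_zero, one_smul] at h3
    refine hmin (k + i₀) (by omega) ?_
    convert h3 using 1
    have : (n : ℤ) = i₀ + h := by exact_mod_cast hi₀.symm
    push_cast
    rw [this]
    ring_nf

/-- A nonzero space contains a nonzero lattice on which some `p ^ (-d) f ^ h` is bijective. Here
`d / h` is the first slope of the Newton polygon of a relation of minimal length between the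
iterates of some vector `v`: the operator maps the lattice `slopeLattice` of index `0` into
itself without being topologically nilpotent on it. -/
theorem exists_fixed_submodule_ne_bot [IsDomain O] [IsDiscreteValuationRing O]
    [IsFractionRing O K] [IsAdicComplete (Ideal.span {(p : O)}) O] [FiniteDimensional K V]
    [Nontrivial V] (hp : Irreducible (p : O)) (hp0 : (p : K) ≠ 0) (hf : IsSemilinear O f) :
    ∃ (d : ℤ) (h : ℕ) (M : Submodule O V), 0 < h ∧ M.FG ∧ M ≠ ⊥ ∧
      ∀ x, twist hp0 f d h x ∈ M ↔ x ∈ M := by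
  classical
  obtain ⟨v, hv⟩ := exists_ne (0 : V)
  -- the shortest linear relation between the iterates of `v`
  have hex : ∃ n, ¬ LinearIndependent K fun i : Fin (n + 1) ↦ (f ^ (i : ℕ)) v := by
    refine ⟨finrank K V, fun h ↦ ?_⟩
    have := h.fintype_card_le_finrank
    simp at this
  obtain ⟨n, hn, hmin⟩ : ∃ n, (¬ LinearIndependent K fun i : Fin (n + 1) ↦ (f ^ (i : ℕ)) v) ∧
      ∀ m < n, LinearIndependent K fun i : Fin (m + 1) ↦ (f ^ (i : ℕ)) v :=
    ⟨Nat.find hex, Nat.find_spec hex, fun m hm ↦ not_not.1 (Nat.find_min hex hm)⟩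
  have hli : LinearIndependent K fun i : Fin n ↦ (f ^ (i : ℕ)) v := by
    cases n with
    | zero => exact linearIndependent_empty_type
    | succ m => exact hmin m (Nat.lt_succ_self m)
  have hspan : (f ^ n) v ∈ Submodule.span K (Set.range fun i : Fin n ↦ (f ^ (i : ℕ)) v) := by
    by_contra hns
    refine hn (linearIndependent_finSucc'.2 ⟨?_, ?_⟩)
    · simpa [Fin.init_def] using hli
    · simpa [Fin.init_def] using hns
  obtain ⟨a', ha'⟩ := (Submodule.mem_span_range_iff_exists_fun K).1 hspan
  obtain ⟨a, haa⟩ : ∃ a : ℕ → K, ∀ i : Fin n, a i = a' i :=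
    ⟨fun i ↦ if hi : i < n then a' ⟨i, hi⟩ else 0, fun i ↦ by simp⟩
  have ha : (f ^ n) v = ∑ i ∈ Finset.range n, a i • (f ^ i) v := by
    rw [← ha', Finset.sum_range]
    exact Finset.sum_congr rfl fun i _ ↦ by rw [haa]
  have hval : ∀ i, ∃ (z : ℤ) (u : Oˣ), a i ≠ 0 → a i = algebraMap O K u * (p : K) ^ z := fun i ↦ by
    by_cases h0 : a i = 0
    · exact ⟨0, 1, fun h ↦ (h h0).elim⟩
    · obtain ⟨z, u, h⟩ := exists_eq_unit_mul_zpow hp h0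
      exact ⟨z, u, fun _ ↦ h⟩
  choose z u hzu using hval
  set I := (Finset.range n).filter fun i ↦ a i ≠ 0 with hI
  have hIne : I.Nonempty := by
    by_contra hne
    rw [Finset.not_nonempty_iff_eq_empty] at hne
    have : (f ^ n) v = 0 := by
      rw [ha]
      refine Finset.sum_eq_zero fun i hi ↦ ?_
      have : a i = 0 := by
        by_contra h0
        have : i ∈ I := Finset.mem_filter.2 ⟨hi, h0⟩
        simp [hne] at this
      rw [this, zero_smul]
    exact hv ((f ^ n).map_eq_zero_iff.1 this)
  -- the first segment of the Newton polygon
  obtain ⟨i₀, hi₀, hmin₀⟩ := Finset.exists_min_image I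
    (fun i ↦ toLex ((z i : ℚ) / ((n : ℚ) - i), i)) hIne
  have hi₀n : i₀ < n := Finset.mem_range.1 (Finset.mem_filter.1 hi₀).1
  have ha₀ : a i₀ ≠ 0 := (Finset.mem_filter.1 hi₀).2
  obtain ⟨h, hh⟩ : ∃ h, i₀ + h = n := ⟨n - i₀, by omega⟩
  have hhpos : 0 < h := by omega
  set d := z i₀ with hd
  have hhq : (n : ℚ) - i₀ = h := by
    rw [← hh]
    push_cast
    ring
  have hle : ∀ i ∈ I, d * (n - i) ≤ h * z i ∧ (i < i₀ → d * (n - i) < h * z i) := by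
    intro i hi
    have hin : i < n := Finset.mem_range.1 (Finset.mem_filter.1 hi).1
    have hpos : (0 : ℚ) < (n : ℚ) - i := sub_pos.2 (by exact_mod_cast hin)
    have hpos' : (0 : ℚ) < h := by exact_mod_cast hhpos
    have h1 := hmin₀ i hi
    rw [Prod.Lex.toLex_le_toLex] at h1
    simp only [hhq] at h1
    rcases h1 with h1 | ⟨h1, h2⟩
    · rw [div_lt_div_iff₀ hpos' hpos] at h1
      have h3 : d * ((n : ℤ) - i) < z i * h := by exact_mod_cast h1
      exact ⟨by linarith, fun _ ↦ by linarith⟩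
    · rw [div_eq_div_iff hpos'.ne' hpos.ne'] at h1
      have h3 : d * ((n : ℤ) - i) = z i * h := by exact_mod_cast h1
      exact ⟨by linarith, fun h4 ↦ (h4.not_ge h2).elim⟩
  -- zero coefficients are given a large valuation
  let u' : ℕ → O := fun i ↦ if a i = 0 then 0 else u i
  let z' : ℕ → ℤ := fun i ↦ if a i = 0 then |d| * n + 1 else z i
  have hrel : (f ^ n) v = ∑ i ∈ Finset.range n, u' i • (p : K) ^ z' i • (f ^ i) v := by
    rw [ha]
    refine Finset.sum_congr rfl fun i _ ↦ ?_
    by_cases h0 : a i = 0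
    · simp [u', h0]
    · simp only [u', z', h0, if_false]
      rw [hzu i h0, mul_smul, algebraMap_smul]
  have hz' : ∀ i < n, d * (n - i) ≤ h * z' i ∧ (i < i₀ → d * (n - i) < h * z' i) := by
    intro i hi
    by_cases h0 : a i = 0
    · simp only [z', h0, if_true]
      have h1 : (0 : ℤ) ≤ n - i := by omega
      have h2 : d * (n - i) ≤ |d| * n :=
        (mul_le_mul_of_nonneg_right (le_abs_self d) h1).trans
          (mul_le_mul_of_nonneg_left (by omega) (abs_nonneg d))
      have h3 : 1 * (|d| * n + 1) ≤ (h : ℤ) * (|d| * n + 1) :=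
        mul_le_mul_of_nonneg_right (by omega) (by positivity)
      exact ⟨by linarith, fun _ ↦ by linarith⟩
    · simp only [z', h0, if_false]
      exact hle i (Finset.mem_filter.2 ⟨Finset.mem_range.2 hi, h0⟩)
  have hexact := notMem_slopeLattice (d := d) hp hp0 hf hhpos hli hrel (fun i hi ↦ (hz' i hi).1) hh
    (by simp only [z', ha₀, if_false]; rfl) (by simp only [u', ha₀, if_false]; exact (u i₀).isUnit)
    (fun i hi ↦ (hz' i (by omega)).2 hi)
  have hfg := slopeLattice_fg (d := d) hp0 hf hhpos hrel (fun i hi ↦ (hz' i hi).1) 0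
  have hstab : ∀ x ∈ slopeLattice O p K f v d h 0,
      twist hp0 f d h x ∈ slopeLattice O p K f v d h 0 := fun x hx ↦
    twist_mem_slopeLattice hp0 hf hx
  have hθ := isSemilinear_twist (O := O) hp0 hf d h
  obtain ⟨N, hN, hanti, hNM⟩ := hθ.exists_iterates hstab
  obtain ⟨M', hM'fg, hM', hlift⟩ := hθ.exists_fixed_submodule hp hfg hstab
  obtain ⟨n₀, hn₀⟩ := exists_stable_mod_pow hp hfg hanti hNM 1
  have hv0 : v ∈ slopeLattice O p K f v d h 0 := by
    simpa using mem_slopeLattice (O := O) (K := K) (p := p) (f := f) (v := v) (d := d) (h := h)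
      0 0 0 (by simp)
  have hmem : ∀ n, (twist hp0 f d h ^ n) v ∈ N n := fun n ↦ by
    rw [hN, inv_apply_self]
    exact hv0
  -- the lattice of index `1` contains `p` times that of index `0`
  obtain ⟨w, hw, hw'⟩ := hlift (slopeLattice O p K f v d h 1) ((twist hp0 f d h ^ n₀) v) fun m ↦ by
    rcases le_total n₀ m with hm | hm
    · obtain ⟨y, hy, t, ht, hyt⟩ := hn₀ m hm _ (hmem n₀)
      refine ⟨(twist hp0 f d h ^ m)⁻¹ y, (hN m y).1 hy, ?_⟩
      rw [apply_inv_self, hyt, natCast_pow_smul (K := K), ← zpow_natCast]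
      refine slopeLattice_anti ?_ (zpow_smul_mem_slopeLattice hp0 _ ht)
      push_cast
      omega
    · refine ⟨(twist hp0 f d h ^ m)⁻¹ ((twist hp0 f d h ^ n₀) v),
        (hN m _).1 (hanti hm (hmem n₀)), ?_⟩
      rw [apply_inv_self, sub_self]
      exact Submodule.zero_mem _
  refine ⟨d, h, M', hhpos, hM'fg, ?_, hM'⟩
  -- `w = 0` would give a valuation larger than the exact one to some iterate of `v`
  rintro rfl
  rw [Submodule.mem_bot] at hw
  rw [hw, sub_zero, twist_pow_apply] at hw'
  have h1 := zpow_smul_mem_slopeLattice hp0 (d * n₀) hw'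
  rw [smul_smul, ← zpow_add₀ hp0, add_neg_cancel, zpow_zero, one_smul] at h1
  refine hexact (h * n₀) ?_
  convert h1 using 1
  push_cast
  ring_nf

end CyclicVector

/-! ### Parts of given slope -/

section Slopes

variable {O : Type*} [CommRing O] {p : ℕ} {K : Type*} [Field K] [Algebra O K]
  {V : Type*} [AddCommGroup V] [Module K V] [Module O V] [IsScalarTower O K V]

/-- A finitely generated `O`-submodule `M` such that `f ^ h M = p ^ d M`. It need not span `V`. -/
def IsFixedLattice (hp0 : (p : K) ≠ 0) (f : V ≃ₗ[ℤ] V) (d : ℤ) (h : ℕ) (M : Submodule O V) :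
    Prop :=
  M.FG ∧ ∀ x, twist hp0 f d h x ∈ M ↔ x ∈ M

variable (O) in
/-- The part of slope `s` of `V`, spanned by the lattices `M` such that `f ^ h M = p ^ d M` for some
`d` and `h` with `s = d / h`. -/
def slopeComponent (hp0 : (p : K) ≠ 0) (f : V ≃ₗ[ℤ] V) (s : ℚ) : Submodule K V :=
  Submodule.span K {x | ∃ (d : ℤ) (h : ℕ) (M : Submodule O V), 0 < h ∧ s = (d : ℚ) / (h : ℚ) ∧
    IsFixedLattice hp0 f d h M ∧ x ∈ M}

variable {hp0 : (p : K) ≠ 0} {f : V ≃ₗ[ℤ] V} {d : ℤ} {h : ℕ} {M : Submodule O V} {s : ℚ}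

omit [Algebra O K] [IsScalarTower O K V] in
theorem IsFixedLattice.mul_right (hM : IsFixedLattice hp0 f d h M) (n : ℕ) :
    IsFixedLattice hp0 f (d * n) (h * n) M :=
  ⟨hM.1, fun x ↦ by rw [← twist_pow]; exact mem_pow_iff (M := M) hM.2 n x⟩

omit [Algebra O K] [IsScalarTower O K V] in
theorem IsFixedLattice.inv_mem (hM : IsFixedLattice hp0 f d h M) {x : V} (hx : x ∈ M) :
    (twist hp0 f d h)⁻¹ x ∈ M := by
  rw [← hM.2, apply_inv_self]
  exact hx

omit [Algebra O K] [IsScalarTower O K V] in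
theorem IsFixedLattice.of_forall (hM : M.FG) (h1 : ∀ x ∈ M, twist hp0 f d h x ∈ M)
    (h2 : ∀ x ∈ M, (twist hp0 f d h)⁻¹ x ∈ M) : IsFixedLattice hp0 f d h M :=
  ⟨hM, fun x ↦ ⟨fun hx ↦ by simpa [inv_apply_self] using h2 _ hx, h1 x⟩⟩

omit [Algebra O K] [IsScalarTower O K V] in
theorem IsFixedLattice.sup (hM : IsFixedLattice hp0 f d h M) {M' : Submodule O V}
    (hM' : IsFixedLattice hp0 f d h M') : IsFixedLattice hp0 f d h (M ⊔ M') := by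
  refine .of_forall (hM.1.sup hM'.1) (fun x hx ↦ ?_) (fun x hx ↦ ?_) <;>
  · obtain ⟨y, hy, z, hz, rfl⟩ := Submodule.mem_sup.1 hx
    rw [map_add]
    first
    | exact Submodule.add_mem_sup ((hM.2 y).2 hy) ((hM'.2 z).2 hz)
    | exact Submodule.add_mem_sup (hM.inv_mem hy) (hM'.inv_mem hz)

omit [Algebra O K] [IsScalarTower O K V] in
theorem IsFixedLattice.exists_image (hM : IsFixedLattice hp0 f d h M) {g : V ≃ₗ[ℤ] V}
    (hg : IsSemilinear O g) (hgf : Commute g f) :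
    ∃ M' : Submodule O V, IsFixedLattice hp0 f d h M' ∧ ∀ x ∈ M, g x ∈ M' := by
  obtain ⟨M', hM', hfg⟩ := hg.exists_image M
  refine ⟨M', ⟨hfg hM.1, fun x ↦ ?_⟩, fun x hx ↦ by rwa [hM', inv_apply_self]⟩
  rw [hM', hM', ← hM.2 (g⁻¹ x), twist_apply, twist_apply, map_zpow_smul _ hp0]
  have h1 : g⁻¹ * f ^ h = f ^ h * g⁻¹ := (hgf.pow_right h).inv_left
  have h2 : g⁻¹ ((f ^ h) x) = (f ^ h) (g⁻¹ x) := LinearEquiv.congr_fun h1 x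
  rw [h2]

omit [Algebra O K] [IsScalarTower O K V] in
/-- Two lattices of the same slope are contained in a third one. -/
theorem IsFixedLattice.exists_sup {d' : ℤ} {h' : ℕ} {M' : Submodule O V}
    (hM : IsFixedLattice hp0 f d h M) (hM' : IsFixedLattice hp0 f d' h' M')
    (hh : 0 < h) (hh' : 0 < h') (hs : s = (d : ℚ) / h) (hs' : s = (d' : ℚ) / h') :
    ∃ (D : ℤ) (H : ℕ), 0 < H ∧ s = (D : ℚ) / H ∧ IsFixedLattice hp0 f D H (M ⊔ M') := by
  refine ⟨d * h', h * h', Nat.mul_pos hh hh', ?_, (hM.mul_right h').sup ?_⟩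
  · push_cast
    rw [mul_div_mul_right _ _ (by exact_mod_cast hh'.ne'), hs]
  · have h1 : d * h' = d' * h := by
      rw [hs, div_eq_div_iff (by exact_mod_cast hh.ne') (by exact_mod_cast hh'.ne')] at hs'
      exact_mod_cast hs'
    rw [h1, mul_comm h h']
    exact hM'.mul_right h

/-- Every vector of slope `s` is contained in a single lattice. -/
theorem mem_slopeComponent [IsDomain O] [IsDiscreteValuationRing O] [IsFractionRing O K]
    (hp : Irreducible (p : O)) {x : V} :
    x ∈ slopeComponent O hp0 f s ↔
      ∃ (d : ℤ) (h : ℕ) (M : Submodule O V), 0 < h ∧ s = (d : ℚ) / (h : ℚ) ∧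
        IsFixedLattice hp0 f d h M ∧ x ∈ M := by
  refine ⟨fun hx ↦ ?_, fun hx ↦ Submodule.subset_span hx⟩
  unfold slopeComponent at hx
  induction hx using Submodule.span_induction with
  | mem x hx => exact hx
  | zero =>
    refine ⟨s.num, s.den, ⊥, s.den_pos, (Rat.num_div_den s).symm, ⟨Submodule.fg_bot, ?_⟩,
      Submodule.zero_mem _⟩
    simp
  | add x y _ _ hx hy =>
    obtain ⟨d, h, M, hh, hs, hM, hx⟩ := hx
    obtain ⟨d', h', M', hh', hs', hM', hy⟩ := hy
    obtain ⟨D, H, hH, hsH, hsup⟩ := hM.exists_sup hM' hh hh' hs hs'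
    exact ⟨D, H, M ⊔ M', hH, hsH, hsup, Submodule.add_mem_sup hx hy⟩
  | smul a x _ hx =>
    obtain ⟨d, h, M, hh, hs, hM, hx⟩ := hx
    by_cases ha : a = 0
    · exact ⟨d, h, M, hh, hs, hM, by simp [ha]⟩
    · obtain ⟨z, u, rfl⟩ := exists_eq_unit_mul_zpow hp ha
      have hcomm : Commute (scale V hp0 z) f := LinearEquiv.ext fun y ↦ by
        simp only [LinearEquiv.mul_apply, scale_apply]
        rw [map_zpow_smul f hp0]
      obtain ⟨M', hM', hx'⟩ := hM.exists_image (isSemilinear_scale hp0 z) hcomm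
      refine ⟨d, h, M', hh, hs, hM', ?_⟩
      rw [mul_smul, algebraMap_smul]
      exact Submodule.smul_mem _ _ (hx' x hx)

theorem apply_mem_slopeComponent [IsDomain O] [IsDiscreteValuationRing O] [IsFractionRing O K]
    (hp : Irreducible (p : O)) {g : V ≃ₗ[ℤ] V} (hg : IsSemilinear O g)
    (hgf : Commute g f) {x : V} (hx : x ∈ slopeComponent O hp0 f s) :
    g x ∈ slopeComponent O hp0 f s := by
  obtain ⟨d, h, M, hh, hs, hM, hx⟩ := (mem_slopeComponent hp).1 hx
  obtain ⟨M', hM', hx'⟩ := hM.exists_image hg hgf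
  exact (mem_slopeComponent hp).2 ⟨d, h, M', hh, hs, hM', hx' x hx⟩

/-- A lattice which exhausts the part of slope `s`, up to powers of `p`. -/
theorem exists_lattice_slopeComponent [IsDomain O] [IsDiscreteValuationRing O] [IsFractionRing O K]
    [FiniteDimensional K V] (hp : Irreducible (p : O)) (s : ℚ) :
    ∃ (d : ℤ) (h : ℕ) (M : Submodule O V), 0 < h ∧ s = (d : ℚ) / (h : ℚ) ∧
      IsFixedLattice hp0 f d h M ∧
        ∀ x ∈ slopeComponent O hp0 f s, ∃ n : ℕ, (p : K) ^ n • x ∈ M := by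
  classical
  obtain ⟨S, hS⟩ := IsNoetherian.noetherian (slopeComponent O hp0 f s)
  have hlat : ∀ T : Finset V, (∀ x ∈ T, x ∈ slopeComponent O hp0 f s) →
      ∃ (d : ℤ) (h : ℕ) (M : Submodule O V), 0 < h ∧ s = (d : ℚ) / (h : ℚ) ∧
        IsFixedLattice hp0 f d h M ∧ ∀ x ∈ T, x ∈ M := by
    intro T
    induction T using Finset.induction_on with
    | empty =>
      intro _
      obtain ⟨d, h, M, hh, hs, hM, -⟩ := (mem_slopeComponent (s := s) hp).1
        (Submodule.zero_mem (slopeComponent O hp0 f s))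
      exact ⟨d, h, M, hh, hs, hM, by simp⟩
    | insert a T _ ih =>
      intro hT
      obtain ⟨d, h, M, hh, hs, hM, hx⟩ := ih fun x hx ↦ hT x (Finset.mem_insert_of_mem hx)
      obtain ⟨d', h', M', hh', hs', hM', hy⟩ :=
        (mem_slopeComponent hp).1 (hT a (Finset.mem_insert_self a T))
      obtain ⟨D, H, hH, hsH, hsup⟩ := hM.exists_sup hM' hh hh' hs hs'
      refine ⟨D, H, M ⊔ M', hH, hsH, hsup, fun x hxT ↦ ?_⟩
      rcases Finset.mem_insert.1 hxT with rfl | hxT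
      · exact Submodule.mem_sup_right hy
      · exact Submodule.mem_sup_left (hx x hxT)
  obtain ⟨d, h, M, hh, hs, hM, hx⟩ := hlat S fun x hx ↦ hS ▸ Submodule.subset_span hx
  refine ⟨d, h, M, hh, hs, hM, fun x hxs ↦ ?_⟩
  rw [← hS] at hxs
  induction hxs using Submodule.span_induction with
  | mem x hxS => exact ⟨0, by simpa using hx x hxS⟩
  | zero => exact ⟨0, by simp⟩
  | add x y _ _ h1 h2 =>
    obtain ⟨m, hm⟩ := h1
    obtain ⟨n, hn⟩ := h2
    refine ⟨m + n, ?_⟩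
    rw [smul_add]
    refine M.add_mem ?_ ?_
    · rw [add_comm, pow_add, mul_smul, ← natCast_pow_smul (O := O)]
      exact M.smul_mem _ hm
    · rw [pow_add, mul_smul, ← natCast_pow_smul (O := O)]
      exact M.smul_mem _ hn
  | smul a x _ h1 =>
    obtain ⟨m, hm⟩ := h1
    by_cases ha : a = 0
    · exact ⟨0, by simp [ha]⟩
    · obtain ⟨z, u, rfl⟩ := exists_eq_unit_mul_zpow hp ha
      obtain ⟨c, hc⟩ := Int.eq_ofNat_of_zero_le (show 0 ≤ z + z.natAbs by omega)
      refine ⟨m + z.natAbs, ?_⟩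
      have h2 : (p : K) ^ (m + z.natAbs) • (algebraMap O K u * (p : K) ^ z) • x =
          ((u : O) * (p : O) ^ c) • (p : K) ^ m • x := by
        rw [← algebraMap_smul K ((u : O) * (p : O) ^ c), smul_smul, smul_smul]
        congr 1
        rw [map_mul, map_pow, map_natCast, ← zpow_natCast (p : K) c, ← hc, pow_add,
          zpow_add₀ hp0, zpow_natCast]
        ring
      rw [h2]
      exact M.smul_mem _ hm

omit [Algebra O K] [IsScalarTower O K V] [Module O V] in
theorem commute_twist (d : ℤ) (h : ℕ) : Commute (twist hp0 f d h) f :=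
  LinearEquiv.ext fun x ↦ by
    simp only [LinearEquiv.mul_apply, twist_apply]
    rw [map_zpow_smul f hp0, ← LinearEquiv.mul_apply, ← LinearEquiv.mul_apply, ← pow_succ,
      ← pow_succ']

omit [Algebra O K] [IsScalarTower O K V] [Module O V] in
theorem map_twist {V' : Type*} [AddCommGroup V'] [Module K V'] {f' : V' ≃ₗ[ℤ] V'} (g : V →ₗ[K] V')
    (hg : ∀ x, g (f x) = f' (g x)) (d : ℤ) (h : ℕ) (x : V) :
    g (twist hp0 f d h x) = twist hp0 f' d h (g x) := by
  have h1 : ∀ n : ℕ, g ((f ^ n) x) = (f' ^ n) (g x) := fun n ↦ by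
    induction n with
    | zero => simp
    | succ n ih =>
      rw [pow_succ', pow_succ', LinearEquiv.mul_apply, LinearEquiv.mul_apply, hg, ih]
  rw [twist_apply, twist_apply, map_smul, h1]

theorem IsFixedLattice.map {V' : Type*} [AddCommGroup V'] [Module K V'] [Module O V']
    [IsScalarTower O K V'] {f' : V' ≃ₗ[ℤ] V'} (hM : IsFixedLattice hp0 f d h M) (g : V →ₗ[K] V')
    (hg : ∀ x, g (f x) = f' (g x)) :
    IsFixedLattice hp0 f' d h (M.map (g.restrictScalars O)) := by
  refine .of_forall (hM.1.map _) ?_ ?_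
  · rintro _ ⟨x, hx, rfl⟩
    exact ⟨twist hp0 f d h x, (hM.2 x).2 hx, map_twist g hg d h x⟩
  · rintro _ ⟨x, hx, rfl⟩
    refine ⟨(twist hp0 f d h)⁻¹ x, hM.inv_mem hx, ?_⟩
    apply (twist hp0 f' d h).injective
    rw [apply_inv_self]
    refine (map_twist g hg d h _).symm.trans ?_
    rw [apply_inv_self]
    rfl

theorem map_slopeComponent_le {V' : Type*} [AddCommGroup V'] [Module K V'] [Module O V']
    [IsScalarTower O K V'] {f' : V' ≃ₗ[ℤ] V'} (g : V →ₗ[K] V') (hg : ∀ x, g (f x) = f' (g x)) :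
    (slopeComponent O hp0 f s).map g ≤ slopeComponent O hp0 f' s := by
  rw [slopeComponent, Submodule.map_span, Submodule.span_le]
  rintro _ ⟨x, ⟨d, h, M, hh, hs, hM, hx⟩, rfl⟩
  exact Submodule.subset_span ⟨d, h, _, hh, hs, hM.map g hg, Submodule.mem_map_of_mem hx⟩

end Slopes

/-! ### The slope decomposition -/

section SlopeDecomposition

variable {O : Type*} [CommRing O] [IsDomain O] [IsDiscreteValuationRing O] {p : ℕ}
  {K : Type*} [Field K] [Algebra O K] [IsFractionRing O K]

/-- The automorphism induced on the quotient by a stable subspace. -/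
theorem exists_quotient_equiv {V : Type*} [AddCommGroup V] [Module K V] (f : V ≃ₗ[ℤ] V)
    (U : Submodule K V) (hU : ∀ x, f x ∈ U ↔ x ∈ U) :
    ∃ g : (V ⧸ U) ≃ₗ[ℤ] V ⧸ U, ∀ x, U.mkQ (f x) = g (U.mkQ x) := by
  have hmap : (U.restrictScalars ℤ).map (f : V →ₗ[ℤ] V) = U.restrictScalars ℤ := by
    ext x
    constructor
    · rintro ⟨y, hy, rfl⟩
      exact (hU y).2 hy
    · intro hx
      exact ⟨f⁻¹ x, (hU _).1 (by rwa [apply_inv_self]), apply_inv_self f x⟩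
  let e := Submodule.Quotient.restrictScalarsEquiv ℤ U
  exact ⟨(e.symm.trans (Submodule.Quotient.equiv _ _ f hmap)).trans e, fun x ↦ rfl⟩

/-- The parts of the various slopes span: the first slope of some vector gives a nonzero part, and
the parts of the quotient by it lift. -/
theorem iSup_slopeComponent [IsAdicComplete (Ideal.span {(p : O)}) O] (hp : Irreducible (p : O))
    (hp0 : (p : K) ≠ 0) (n : ℕ) :
    ∀ {V : Type*} [AddCommGroup V] [Module K V] [Module O V] [IsScalarTower O K V]
      [FiniteDimensional K V] {f : V ≃ₗ[ℤ] V}, IsSemilinear O f → finrank K V = n →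
      ⨆ s, slopeComponent O hp0 f s = ⊤ := by
  induction n using Nat.strong_induction_on with
  | _ n ih =>
  intro V _ _ _ _ _ f hf hn
  rcases subsingleton_or_nontrivial V with hV | hV
  · exact Subsingleton.elim _ _
  obtain ⟨d, h, M, hh, hM, hM0, hfix⟩ := exists_fixed_submodule_ne_bot (f := f) hp hp0 hf
  set s : ℚ := (d : ℚ) / h with hs
  set U := slopeComponent O hp0 f s with hU
  have hMU : ∀ x ∈ M, x ∈ U := fun x hx ↦
    Submodule.subset_span ⟨d, h, M, hh, hs, ⟨hM, hfix⟩, hx⟩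
  have hU0 : U ≠ ⊥ := fun h0 ↦ hM0 ((Submodule.eq_bot_iff _).2 fun x hx ↦ by
    simpa [h0] using hMU x hx)
  have hUf : ∀ x ∈ U, f x ∈ U := fun x hx ↦
    apply_mem_slopeComponent hp hf (Commute.refl f) hx
  have hUf' : ∀ x ∈ U, f⁻¹ x ∈ U := fun x hx ↦
    apply_mem_slopeComponent hp hf.inv (Commute.refl f).inv_left hx
  obtain ⟨g, hg⟩ := exists_quotient_equiv f U fun x ↦
    ⟨fun hx ↦ by simpa [inv_apply_self] using hUf' _ hx, hUf x⟩
  have hgsemi : IsSemilinear O g := by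
    obtain ⟨τ, hτ⟩ := hf
    refine ⟨τ, fun a x ↦ ?_⟩
    obtain ⟨x, rfl⟩ := U.mkQ_surjective x
    have h1 : ∀ (b : O) (y : V), b • U.mkQ y = U.mkQ (b • y) := fun _ _ ↦ rfl
    rw [h1, ← hg, ← hg, hτ, h1]
  have hlt : finrank K (V ⧸ U) < n := by
    have h1 := U.finrank_quotient_add_finrank
    have h2 : finrank K U ≠ 0 := fun h0 ↦ hU0 (Submodule.finrank_eq_zero.1 h0)
    omega
  have hquot := ih _ hlt hgsemi rfl
  have hUS : U ≤ ⨆ s, slopeComponent O hp0 f s := le_iSup (slopeComponent O hp0 f) s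
  suffices hle : ∀ t, slopeComponent O hp0 g t ≤ (⨆ s, slopeComponent O hp0 f s).map U.mkQ by
    have h1 : (⨆ s, slopeComponent O hp0 f s).map U.mkQ = ⊤ := by
      rw [eq_top_iff, ← hquot]
      exact iSup_le hle
    rw [Submodule.map_mkQ_eq_top] at h1
    rwa [sup_eq_right.2 hUS] at h1
  intro t
  rw [slopeComponent, Submodule.span_le]
  rintro _ ⟨d', h', M', hh', -, hM', hx⟩
  rename_i x
  -- lattices for `U` and for its quotient, with the same denominator
  obtain ⟨d₁, h₁, M₁, hh₁, hs₁, hM₁, hexh⟩ :=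
    exists_lattice_slopeComponent (hp0 := hp0) (f := f) hp s
  have hM₁' := hM₁.mul_right h'
  have hM₂ := hM'.mul_right h₁
  rw [mul_comm h' h₁] at hM₂
  obtain ⟨r, b, hb⟩ := Submodule.fg_iff_exists_fin_generating_family.1 hM'.1
  choose c hc using fun i ↦ U.mkQ_surjective (b i)
  set M₀ : Submodule O V := Submodule.span O (Set.range c) with hM₀
  have hmap : M₀.map (U.mkQ.restrictScalars O) = M' := by
    rw [hM₀, Submodule.map_span, ← Set.range_comp, ← hb]
    congr 2
    exact funext hc
  have hM₀' : ∀ y ∈ M₀, U.mkQ y ∈ M' := fun y hy ↦ hmap ▸ Submodule.mem_map_of_mem hy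
  have hlift : ∀ y ∈ M', ∃ w ∈ M₀, U.mkQ w = y := fun y hy ↦ by
    rw [← hmap] at hy
    exact hy
  have hsub : ∀ y w : V, U.mkQ y = U.mkQ w → y - w ∈ U := fun y w hyw ↦ by
    rwa [← Submodule.Quotient.eq]
  have htw := map_twist (hp0 := hp0) (f := f) U.mkQ hg (d' * h₁) (h₁ * h')
  have htw' : ∀ y, U.mkQ ((twist hp0 f (d' * h₁) (h₁ * h'))⁻¹ y) =
      (twist hp0 g (d' * h₁) (h₁ * h'))⁻¹ (U.mkQ y) := fun y ↦ by
    apply (twist hp0 g (d' * h₁) (h₁ * h')).injective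
    rw [← htw, apply_inv_self, apply_inv_self]
  have hUn : ∀ (n : ℕ), ∀ y ∈ U, (f ^ n) y ∈ U := fun n y hy ↦
    apply_mem_slopeComponent hp (hf.pow n) ((Commute.refl f).pow_left n) hy
  have hUθ : ∀ y ∈ U, twist hp0 f (d' * h₁) (h₁ * h') y ∈ U := fun y hy ↦
    U.smul_mem _ (hUn _ y hy)
  have hUθ' : ∀ y ∈ U, (twist hp0 f (d' * h₁) (h₁ * h'))⁻¹ y ∈ U := fun y hy ↦
    apply_mem_slopeComponent hp (isSemilinear_twist hp0 hf _ _).inv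
      (commute_twist _ _).inv_left hy
  -- on `U` the two operators differ by a power of `p`
  have hscale : ∀ y, twist hp0 f (d' * h₁) (h₁ * h') y =
      (p : K) ^ (d₁ * h' - d' * h₁) • twist hp0 f (d₁ * h') (h₁ * h') y := fun y ↦ by
    rw [twist_apply, twist_apply, smul_smul, ← zpow_add₀ hp0]
    congr 2
    ring
  have hpow : ∀ (c : ℕ), ∀ y ∈ M₁, (p : K) ^ (c : ℤ) • y ∈ M₁ := fun c y hy ↦ by
    rw [zpow_natCast, ← natCast_pow_smul (O := O)]
    exact M₁.smul_mem _ hy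
  obtain ⟨M₃, hM₃, hM₃'⟩ : ∃ M₃ : Submodule O V,
      IsFixedLattice hp0 f (d' * h₁) (h₁ * h') M₃ ∧ ∀ y ∈ M₀, ∃ z ∈ M₃, y - z ∈ U := by
    have hM₀fg : M₀.FG := Submodule.fg_span (Set.finite_range c)
    have e1 : ∀ y ∈ M₀, ∃ w ∈ M₀, twist hp0 f (d' * h₁) (h₁ * h') y - w ∈ U := fun y hy ↦ by
      obtain ⟨w, hw, hyw⟩ := hlift _ ((hM₂.2 _).2 (hM₀' y hy))
      exact ⟨w, hw, hsub _ _ (by rw [hyw, htw])⟩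
    have e2 : ∀ y ∈ M₀, ∃ w ∈ M₀, (twist hp0 f (d' * h₁) (h₁ * h'))⁻¹ y - w ∈ U := fun y hy ↦ by
      obtain ⟨w, hw, hyw⟩ := hlift _ (hM₂.inv_mem (hM₀' y hy))
      exact ⟨w, hw, hsub _ _ (by rw [hyw, htw'])⟩
    rcases le_total (d' * h₁) (d₁ * h') with hle | hle
    · obtain ⟨M₃, hfg, hfix, hl⟩ := exists_fixed_lift hp hp0
        (isSemilinear_twist hp0 hf (d' * h₁) (h₁ * h')) hUθ hM₁'.1 hexh (fun y hy ↦ by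
          obtain ⟨c, hc⟩ := Int.eq_ofNat_of_zero_le (sub_nonneg.2 hle)
          rw [hscale, hc]
          exact hpow c _ ((hM₁'.2 y).2 hy)) hM₀fg e1 (fun y hy ↦ by
          obtain ⟨w, hw, hyw⟩ := e2 y hy
          refine ⟨w, hw, ?_⟩
          have := hUθ _ hyw
          rwa [map_sub, apply_inv_self] at this)
      exact ⟨M₃, ⟨hfg, hfix⟩, hl⟩
    · obtain ⟨M₃, hfg, hfix, hl⟩ := exists_fixed_lift hp hp0
        (isSemilinear_twist hp0 hf (d' * h₁) (h₁ * h')).inv hUθ' hM₁'.1 hexh (fun y hy ↦ by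
          obtain ⟨c, hc⟩ := Int.eq_ofNat_of_zero_le (sub_nonneg.2 hle)
          have h1 : (twist hp0 f (d' * h₁) (h₁ * h'))⁻¹ y =
              (p : K) ^ (c : ℤ) • (twist hp0 f (d₁ * h') (h₁ * h'))⁻¹ y := by
            apply (twist hp0 f (d' * h₁) (h₁ * h')).injective
            rw [apply_inv_self, map_zpow_smul _ hp0, hscale, apply_inv_self, smul_smul,
              ← zpow_add₀ hp0, ← hc, sub_add_sub_cancel, sub_self, zpow_zero, one_smul]
          rw [h1]
          exact hpow c _ (hM₁'.inv_mem hy)) hM₀fg e2 (fun y hy ↦ by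
          obtain ⟨w, hw, hyw⟩ := e1 y hy
          refine ⟨w, hw, ?_⟩
          have := hUθ' _ hyw
          rwa [map_sub, inv_apply_self] at this)
      refine ⟨M₃, ⟨hfg, fun y ↦ ?_⟩, hl⟩
      have := hfix (twist hp0 f (d' * h₁) (h₁ * h') y)
      rw [inv_apply_self] at this
      exact this.symm
  obtain ⟨w, hw, rfl⟩ := hlift _ hx
  obtain ⟨z, hz, hwz⟩ := hM₃' w hw
  refine ⟨z, ?_, ((Submodule.Quotient.eq U).2 hwz).symm⟩
  exact le_iSup (slopeComponent O hp0 f) _ (Submodule.subset_span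
    ⟨d' * h₁, h₁ * h', M₃, Nat.mul_pos hh₁ hh', rfl, hM₃, hz⟩)

variable {V : Type*} [AddCommGroup V] [Module K V] [Module O V] [IsScalarTower O K V]
  [FiniteDimensional K V] {f : V ≃ₗ[ℤ] V}

/-- On a sum of parts of slopes larger than `d / h`, the operator `p ^ (-d) f ^ h` is topologically
nilpotent. -/
theorem exists_contracted_lattice (hp : Irreducible (p : O)) (hp0 : (p : K) ≠ 0) {a : ℚ}
    (B : Finset ℚ) (hB : ∀ b ∈ B, a < b) :
    ∃ (d : ℤ) (h : ℕ) (N : Submodule O V), 0 < h ∧ a = (d : ℚ) / h ∧ N.FG ∧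
      (∀ x ∈ N, ∃ y ∈ N, twist hp0 f d h x = (p : O) • y) ∧
      ∀ x ∈ ⨆ b ∈ B, slopeComponent O hp0 f b, ∃ n : ℕ, (p : K) ^ n • x ∈ N := by
  induction B using Finset.induction_on with
  | empty =>
    refine ⟨a.num, a.den, ⊥, a.den_pos, (Rat.num_div_den a).symm, Submodule.fg_bot,
      fun x hx ↦ ⟨0, Submodule.zero_mem _, ?_⟩, fun x hx ↦ ⟨0, ?_⟩⟩
    · rw [Submodule.mem_bot] at hx
      simp [hx]
    · simpa using hx
  | insert b B _ ih =>
    obtain ⟨d, h, N, hh, ha, hN, hcon, hexh⟩ := ih fun b hb ↦ hB b (Finset.mem_insert_of_mem hb)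
    obtain ⟨d', h', M, hh', hb, hM, hexh'⟩ :=
      exists_lattice_slopeComponent (hp0 := hp0) (f := f) hp b
    have hab := hB b (Finset.mem_insert_self b B)
    have hlt : d * h' < d' * h := by
      rw [ha, hb, div_lt_div_iff₀ (by exact_mod_cast hh) (by exact_mod_cast hh')] at hab
      exact_mod_cast hab
    have hcon' : ∀ n : ℕ, ∀ x ∈ N, ∃ y ∈ N, (twist hp0 f d h ^ (n + 1)) x = (p : O) • y := by
      intro n
      induction n with
      | zero => simpa using hcon
      | succ n ihn =>
        intro x hx
        obtain ⟨y, hy, hxy⟩ := hcon x hx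
        obtain ⟨w, hw, hyw⟩ := ihn ((p : O) • y) (N.smul_mem _ hy)
        exact ⟨w, hw, by rw [pow_succ, LinearEquiv.mul_apply, hxy, hyw]⟩
    refine ⟨d * h', h * h', N ⊔ M, Nat.mul_pos hh hh', ?_, hN.sup hM.1, fun x hx ↦ ?_,
      fun x hx ↦ ?_⟩
    · push_cast
      rw [mul_div_mul_right _ _ (by exact_mod_cast hh'.ne'), ha]
    · obtain ⟨y, hy, z, hz, rfl⟩ := Submodule.mem_sup.1 hx
      obtain ⟨w, hw, hyw⟩ := hcon' (h' - 1) y hy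
      rw [Nat.sub_add_cancel hh', twist_pow] at hyw
      obtain ⟨c, hc⟩ := Int.eq_ofNat_of_zero_le (show 0 ≤ d' * h - d * h' - 1 by omega)
      have h1 := ((hM.mul_right h).2 z).2 hz
      refine ⟨w + (p : O) ^ c • twist hp0 f (d' * h) (h' * h) z,
        Submodule.add_mem_sup hw (M.smul_mem _ h1), ?_⟩
      rw [map_add, hyw, smul_add]
      congr 1
      rw [smul_smul, ← pow_succ', natCast_pow_smul (K := K), ← zpow_natCast, twist_apply,
        twist_apply, smul_smul, ← zpow_add₀ hp0, mul_comm h' h]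
      congr 2
      push_cast
      linarith
    · rw [Finset.iSup_insert] at hx
      obtain ⟨y, hy, z, hz, rfl⟩ := Submodule.mem_sup.1 hx
      obtain ⟨m, hm⟩ := hexh' y hy
      obtain ⟨n, hn⟩ := hexh z hz
      refine ⟨m + n, ?_⟩
      rw [smul_add]
      refine Submodule.add_mem _ (Submodule.mem_sup_right ?_) (Submodule.mem_sup_left ?_)
      · rw [add_comm, pow_add, mul_smul, ← natCast_pow_smul (O := O)]
        exact M.smul_mem _ hm
      · rw [pow_add, mul_smul, ← natCast_pow_smul (O := O)]
        exact N.smul_mem _ hn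

/-- On the part of slope `a = d / h` the operator `p ^ (-d) f ^ h` is bijective on a lattice,
whereas on a sum of parts of larger slopes it is topologically nilpotent. -/
theorem disjoint_slopeComponent (hp : Irreducible (p : O)) (hp0 : (p : K) ≠ 0)
    (hf : IsSemilinear O f) {a : ℚ} (B : Finset ℚ) (hB : ∀ b ∈ B, a < b) {x : V}
    (hx : x ∈ slopeComponent O hp0 f a) (hxB : x ∈ ⨆ b ∈ B, slopeComponent O hp0 f b) : x = 0 := by
  obtain ⟨d, h, N, hh, ha, hN, hcon, hexh⟩ := exists_contracted_lattice (f := f) hp hp0 B hB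
  obtain ⟨d', h', M, hh', ha', hM, hxM⟩ := (mem_slopeComponent hp).1 hx
  set W := ⨆ b ∈ B, slopeComponent O hp0 f b with hW
  have hdd : d' * h = d * h' := by
    rw [ha, div_eq_div_iff (by exact_mod_cast hh.ne') (by exact_mod_cast hh'.ne')] at ha'
    exact_mod_cast ha'.symm
  set θ := twist hp0 f (d * h') (h * h') with hθ
  have hWθ : ∀ y ∈ W, θ⁻¹ y ∈ W := by
    have h1 : ∀ (C : Finset ℚ), ∀ y ∈ ⨆ b ∈ C, slopeComponent O hp0 f b,
        θ⁻¹ y ∈ ⨆ b ∈ C, slopeComponent O hp0 f b := by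
      intro C
      induction C using Finset.induction_on with
      | empty => simp
      | insert b C _ ih =>
        intro y hy
        rw [Finset.iSup_insert] at hy ⊢
        obtain ⟨u, hu, v, hv, rfl⟩ := Submodule.mem_sup.1 hy
        rw [map_add]
        exact Submodule.add_mem_sup (apply_mem_slopeComponent hp
          (isSemilinear_twist hp0 hf _ _).inv (commute_twist _ _).inv_left hu) (ih v hv)
    exact h1 B
  have hMθ := hM.mul_right h
  rw [hdd, mul_comm h' h] at hMθ
  -- a lattice of `W` on which `θ` is bijective, although it is topologically nilpotent there
  set P := M ⊓ W.restrictScalars O with hP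
  have hPfg : P.FG := by
    have : IsNoetherian O M := isNoetherian_of_fg_of_noetherian M hM.1
    exact Submodule.FG.of_le hM.1 inf_le_left
  have hPθ : ∀ y ∈ P, θ⁻¹ y ∈ P := fun y hy ↦ ⟨hMθ.inv_mem hy.1, hWθ y hy.2⟩
  obtain ⟨c, hc⟩ : ∃ c : ℕ, ∀ y ∈ P, (p : O) ^ c • y ∈ N := by
    obtain ⟨r, g, hg⟩ := Submodule.fg_iff_exists_fin_generating_family.1 hPfg
    choose n hn using fun i ↦ hexh (g i) ((hg ▸ Submodule.subset_span ⟨i, rfl⟩ : g i ∈ P)).2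
    refine ⟨∑ i, n i, fun y hy ↦ ?_⟩
    rw [← hg] at hy
    induction hy using Submodule.span_induction with
    | mem y hy =>
      obtain ⟨i, rfl⟩ := hy
      rw [← Nat.sub_add_cancel (Finset.single_le_sum (f := n) (fun _ _ ↦ Nat.zero_le _)
        (Finset.mem_univ i)), pow_add, mul_smul, natCast_pow_smul (K := K) (n i)]
      exact N.smul_mem _ (hn i)
    | zero => simp
    | add y z _ _ h1 h2 => rw [smul_add]; exact N.add_mem h1 h2
    | smul u y _ h1 => rw [smul_comm]; exact N.smul_mem _ h1
  have hcon' : ∀ n : ℕ, ∀ y ∈ N, ∃ w ∈ N, (twist hp0 f d h ^ n) y = (p : O) ^ n • w := by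
    intro n
    induction n with
    | zero => exact fun y hy ↦ ⟨y, hy, by simp⟩
    | succ n ih =>
      intro y hy
      obtain ⟨w, hw, hyw⟩ := ih y hy
      obtain ⟨v, hv, hwv⟩ := hcon w hw
      refine ⟨v, hv, ?_⟩
      rw [pow_succ', LinearEquiv.mul_apply, hyw, natCast_pow_smul (K := K), ← zpow_natCast,
        map_zpow_smul _ hp0, zpow_natCast, hwv, ← natCast_pow_smul (O := O), smul_smul, pow_succ]
  have hxP : x ∈ P := ⟨hxM, hxB⟩
  have hzero : (p : O) ^ c • x ∈ (⊥ : Submodule O V) := by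
    refine mem_of_forall_mem_mod_pow hp hN (hc x hxP) fun n ↦ ⟨0, Submodule.zero_mem _, ?_⟩
    have h1 : (θ ^ n)⁻¹ x ∈ P := by
      induction n with
      | zero => simpa using hxP
      | succ n ih =>
        rw [pow_succ, mul_inv_rev, LinearEquiv.mul_apply]
        exact hPθ _ ih
    obtain ⟨w, hw, hyw⟩ := hcon' (h' * n) _ (hc _ h1)
    refine ⟨(p : O) ^ (h' * n - n) • w, N.smul_mem _ hw, ?_⟩
    rw [sub_zero, smul_smul, ← pow_add, Nat.add_sub_cancel' (Nat.le_mul_of_pos_left n hh'), ← hyw,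
      pow_mul, twist_pow, ← hθ]
    simp only [natCast_pow_smul (K := K), ← zpow_natCast (p : K)]
    rw [map_zpow_smul _ hp0, apply_inv_self]
  rw [Submodule.mem_bot, natCast_pow_smul (K := K)] at hzero
  exact (smul_eq_zero_iff_right (pow_ne_zero c hp0)).1 hzero

theorem isInternal_slopeComponent [IsAdicComplete (Ideal.span {(p : O)}) O]
    (hp : Irreducible (p : O)) (hp0 : (p : K) ≠ 0) (hf : IsSemilinear O f) :
    DirectSum.IsInternal (slopeComponent O hp0 f) := by
  refine DirectSum.isInternal_submodule_of_iSupIndep_of_iSup_eq_top ?_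
    (iSup_slopeComponent hp hp0 _ hf rfl)
  rw [iSupIndep_iff_finsetSum_eq_zero_imp_eq_zero]
  intro S
  induction S using Finset.induction_on_min with
  | empty => simp
  | insert a S hlt ih =>
    intro v hv hsum
    have haS : a ∉ S := fun haS ↦ (hlt a haS).false
    rw [Finset.sum_insert haS] at hsum
    have ha : v a = 0 := by
      refine disjoint_slopeComponent hp hp0 hf S hlt (hv a (Finset.mem_insert_self a S)) ?_
      rw [eq_neg_of_add_eq_zero_left hsum]
      exact Submodule.neg_mem _ (Submodule.sum_mem _ fun b hb ↦
        Submodule.mem_iSup_of_mem b (Submodule.mem_iSup_of_mem hb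
          (hv b (Finset.mem_insert_of_mem hb))))
    rw [ha, zero_add] at hsum
    intro b hb
    rcases Finset.mem_insert.1 hb with rfl | hb
    · exact ha
    · exact ih v (fun b hb ↦ hv b (Finset.mem_insert_of_mem hb)) hsum b hb

/-- A stable subspace is the sum of its intersections with the parts of the various slopes. -/
theorem le_iSup_inf_slopeComponent [IsAdicComplete (Ideal.span {(p : O)}) O]
    (hp : Irreducible (p : O)) (hp0 : (p : K) ≠ 0) (hf : IsSemilinear O f) {W : Submodule K V}
    (hW : ∀ x, f x ∈ W ↔ x ∈ W) : W ≤ ⨆ s, W ⊓ slopeComponent O hp0 f s := by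
  let g : W ≃ₗ[ℤ] W :=
    { toFun := fun x ↦ ⟨f x, (hW x).2 x.2⟩
      map_add' := fun x y ↦ Subtype.ext (map_add f _ _)
      map_smul' := fun a x ↦ Subtype.ext (map_smul f a (x : V))
      invFun := fun x ↦ ⟨f⁻¹ x, (hW _).1 (by rw [apply_inv_self]; exact x.2)⟩
      left_inv := fun x ↦ Subtype.ext (inv_apply_self f _)
      right_inv := fun x ↦ Subtype.ext (apply_inv_self f _) }
  have hg : IsSemilinear O g := by
    obtain ⟨τ, hτ⟩ := hf
    exact ⟨τ, fun a x ↦ Subtype.ext (hτ a x)⟩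
  have h1 := iSup_slopeComponent hp hp0 _ hg rfl
  have h2 := congr_arg (Submodule.map W.subtype) h1
  rw [Submodule.map_iSup, Submodule.map_top, Submodule.range_subtype] at h2
  rw [← h2]
  refine iSup_mono fun s ↦ le_inf ?_ ?_
  · rw [h2]
    exact Submodule.map_subtype_le _ _
  · exact map_slopeComponent_le W.subtype fun _ ↦ rfl

end SlopeDecomposition

/-! ### Slope parts of isocrystals -/

section SlopeParts

variable (p : ℕ) [Fact p.Prime] (k : Type*) [Field k] [CharP k p] [PerfectRing k p]
variable (V : Type*) [AddCommGroup V] [WittVector.Isocrystal p k V]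

/-- The Frobenius of an isocrystal, as an automorphism of its additive group. -/
noncomputable def frobEquiv : V ≃ₗ[ℤ] V :=
  (WittVector.Isocrystal.frobenius p k : V ≃ᶠˡ[p, k] V).toAddEquiv.toIntLinearEquiv

/-- An isocrystal as a module over the ring of Witt vectors. -/
noncomputable abbrev wittModule : Module (WittVector p k) V :=
  Module.compHom V (algebraMap (WittVector p k) K(p, k))

theorem isScalarTower_wittModule :
    letI := wittModule p k V
    IsScalarTower (WittVector p k) K(p, k) V :=
  let := wittModule p k V
  ⟨fun a b x ↦ by
    rw [Algebra.smul_def, mul_smul]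
    rfl⟩

theorem isSemilinear_frobEquiv :
    letI := wittModule p k V
    IsSemilinear (WittVector p k) (frobEquiv p k V) := by
  let := wittModule p k V
  refine ⟨WittVector.frobeniusEquiv p k, fun a x ↦ ?_⟩
  have h1 : WittVector.FractionRing.frobeniusRingHom p k (algebraMap (WittVector p k) K(p, k) a) =
      algebraMap (WittVector p k) K(p, k) (WittVector.frobeniusEquiv p k a) :=
    IsFractionRing.ringEquivOfRingEquiv_algebraMap _ a
  have h2 := (WittVector.Isocrystal.frobenius p k : V ≃ᶠˡ[p, k] V).map_smulₛₗ
    (algebraMap (WittVector p k) K(p, k) a) x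
  rw [h1] at h2
  exact h2

/-- The equality `f ^ h M = p ^ d M` says that `p ^ (-d) f ^ h` is bijective on `M`. -/
theorem slopePart_eq_slopeComponent (s : ℚ) :
    letI := wittModule p k V
    slopePart p k V s = slopeComponent (WittVector p k) (WittVector.FractionRing.p_nonzero p k)
      (frobEquiv p k V) s := by
  let := wittModule p k V
  have hp0 := WittVector.FractionRing.p_nonzero p k
  unfold slopePart slopeComponent
  congr 1
  ext x
  have hiter : ∀ (h : ℕ) (y : V), (frob p k)^[h] y = ((frobEquiv p k V) ^ h) y := fun h y ↦ by
    induction h with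
    | zero => rfl
    | succ h ih => rw [Function.iterate_succ_apply', ih, pow_succ']; rfl
  have hfix : ∀ (d : ℤ) (h : ℕ) (M : Submodule (WittVector p k) V),
      (frob p k)^[h] '' (M : Set V) = (fun y : V ↦ (p : K(p, k)) ^ d • y) '' (M : Set V) ↔
        ∀ y, twist hp0 (frobEquiv p k V) d h y ∈ M ↔ y ∈ M := by
    intro d h M
    have hz := zpow_ne_zero d hp0
    constructor
    · intro heq y
      rw [twist_apply, zpow_neg]
      constructor
      · intro hy
        have h1 : (frob p k)^[h] y ∈ (fun y : V ↦ (p : K(p, k)) ^ d • y) '' (M : Set V) :=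
          ⟨_, hy, by rw [hiter]; exact smul_inv_smul₀ hz _⟩
        rw [← heq] at h1
        obtain ⟨w, hw, hwy⟩ := h1
        rw [hiter, hiter] at hwy
        exact (frobEquiv p k V ^ h).injective hwy ▸ hw
      · intro hy
        have h1 : (frob p k)^[h] y ∈ (frob p k)^[h] '' (M : Set V) := ⟨y, hy, rfl⟩
        rw [heq] at h1
        obtain ⟨w, hw, hwy⟩ := h1
        rw [hiter] at hwy
        rw [← hwy, inv_smul_smul₀ hz]
        exact hw
    · intro hM
      ext y
      constructor
      · rintro ⟨w, hw, rfl⟩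
        refine ⟨_, (hM w).2 hw, ?_⟩
        rw [hiter, twist_apply, zpow_neg]
        exact smul_inv_smul₀ hz _
      · rintro ⟨w, hw, rfl⟩
        refine ⟨(twist hp0 (frobEquiv p k V) d h)⁻¹ w, (hM _).1 (by rwa [apply_inv_self]), ?_⟩
        have h1 := apply_inv_self (twist hp0 (frobEquiv p k V) d h) w
        rw [twist_apply, zpow_neg] at h1
        rw [hiter]
        exact (eq_inv_smul_iff₀ hz).1 h1.symm ▸ rfl
  constructor
  · rintro ⟨d, h, M, hh, hs, hfg, hx, heq⟩
    exact ⟨d, h, M, hh, hs, ⟨hfg, (hfix d h M).1 heq⟩, hx⟩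
  · rintro ⟨d, h, M, hh, hs, ⟨hfg, heq⟩, hx⟩
    exact ⟨d, h, M, hh, hs, hfg, hx, (hfix d h M).2 heq⟩

theorem isStable_slopePart (s : ℚ) : IsStable p k (slopePart p k V s) := by
  let := wittModule p k V
  have := isScalarTower_wittModule p k V
  intro x hx
  rw [slopePart_eq_slopeComponent] at hx ⊢
  exact apply_mem_slopeComponent (WittVector.irreducible p) (isSemilinear_frobEquiv p k V)
    (Commute.refl _) hx

variable [FiniteDimensional K(p, k) V]

theorem isInternal_slopePart : DirectSum.IsInternal (slopePart p k V) := by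
  let := wittModule p k V
  have := isScalarTower_wittModule p k V
  have : IsAdicComplete (Ideal.span {(p : WittVector p k)}) (WittVector p k) :=
    WittVector.isAdicCompleteIdealSpanP
  rw [show slopePart p k V = _ from funext fun s ↦ slopePart_eq_slopeComponent p k V s]
  exact isInternal_slopeComponent (WittVector.irreducible p) _ (isSemilinear_frobEquiv p k V)

variable {p k V}

/-- The Frobenius is bijective on stable subspaces. -/
theorem IsStable.apply_mem_iff {W : Submodule K(p, k) V} (hW : IsStable p k W) (x : V) :
    frob p k x ∈ W ↔ x ∈ W := by
  refine ⟨fun hx ↦ ?_, hW x⟩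
  -- the inverse images of `W` by the iterates form an increasing sequence, hence stabilize
  let φ : V →ₛₗ[WittVector.FractionRing.frobeniusRingHom p k] V :=
    (WittVector.Isocrystal.frobenius p k : V ≃ᶠˡ[p, k] V).toLinearMap
  let A : ℕ → Submodule K(p, k) V := fun n ↦ (Submodule.comap φ)^[n] W
  have hA : Monotone A := monotone_nat_of_le_succ fun n ↦ by
    induction n with
    | zero => exact hW
    | succ n ih =>
      simp only [A, Function.iterate_succ_apply'] at ih ⊢
      exact Submodule.comap_mono ih
  obtain ⟨n, hn⟩ := WellFoundedGT.monotone_chain_condition ⟨A, hA⟩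
  have hsurj : Function.Surjective φ :=
    (WittVector.Isocrystal.frobenius p k : V ≃ᶠˡ[p, k] V).surjective
  have hinj : Function.Injective (Submodule.comap φ) :=
    Submodule.comap_injective_of_surjective hsurj
  have h1 : A 0 = A 1 := by
    apply hinj.iterate n
    have := hn (n + 1) (Nat.le_succ n)
    simpa only [A, Function.iterate_zero, Function.iterate_one, id, OrderHom.coe_mk,
      Function.iterate_succ_apply] using this
  have h2 : x ∈ A 1 := hx
  rwa [← h1] at h2

theorem IsStable.le_iSup_inf_slopePart {W : Submodule K(p, k) V} (hW : IsStable p k W) :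
    W ≤ ⨆ s, W ⊓ slopePart p k V s := by
  let := wittModule p k V
  have := isScalarTower_wittModule p k V
  have : IsAdicComplete (Ideal.span {(p : WittVector p k)}) (WittVector p k) :=
    WittVector.isAdicCompleteIdealSpanP
  simp only [slopePart_eq_slopeComponent]
  exact le_iSup_inf_slopeComponent (WittVector.irreducible p) _ (isSemilinear_frobEquiv p k V)
    hW.apply_mem_iff

end SlopeParts

/-! ### Graduations and Newton filtrations -/

section Graduations

variable {F : Type*} [Field F] {E : Type*} [AddCommGroup E] [Module F E] {Λ : Type*}
  {G : Λ → Submodule F E} {W : Submodule F E}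

/-- A subspace compatible with a graduation has compatible intersections with partial sums. -/
theorem inf_biSup_eq (hG : iSupIndep G) (hW : W ≤ ⨆ i, W ⊓ G i) (S : Set Λ) :
    W ⊓ ⨆ i ∈ S, G i = ⨆ i ∈ S, W ⊓ G i := by
  have h1 : W = (⨆ i ∈ S, W ⊓ G i) ⊔ ⨆ i ∈ Sᶜ, W ⊓ G i := by
    refine le_antisymm (hW.trans (iSup_le fun i ↦ ?_))
      (sup_le (iSup₂_le fun _ _ ↦ inf_le_left) (iSup₂_le fun _ _ ↦ inf_le_left))
    by_cases hi : i ∈ S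
    · exact le_sup_of_le_left (le_iSup₂_of_le i hi le_rfl)
    · exact le_sup_of_le_right (le_iSup₂_of_le i hi le_rfl)
  have h2 : ⨆ i ∈ S, W ⊓ G i ≤ ⨆ i ∈ S, G i := iSup₂_mono fun _ _ ↦ inf_le_right
  have h3 : Disjoint (⨆ i ∈ S, G i) (⨆ i ∈ Sᶜ, G i) := hG.disjoint_biSup_biSup disjoint_compl_right
  have h4 : (⨆ i ∈ Sᶜ, W ⊓ G i) ⊓ ⨆ i ∈ S, G i = ⊥ :=
    (h3.symm.mono_left (iSup₂_mono fun _ _ ↦ inf_le_right)).eq_bot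
  conv_lhs => rw [h1]
  rw [sup_inf_assoc_of_le _ h2, h4, sup_bot_eq]

theorem submoduleOf_iSup_inf {ι : Sort*} (A : ι → Submodule F E) :
    (⨆ i, W ⊓ A i).submoduleOf W = ⨆ i, (A i).submoduleOf W := by
  apply Submodule.map_injective_of_injective W.injective_subtype
  rw [Submodule.map_iSup, Submodule.submoduleOf, Submodule.map_comap_subtype,
    inf_eq_right.2 (iSup_le fun i ↦ inf_le_left)]
  exact iSup_congr fun i ↦ (Submodule.map_comap_subtype W (A i)).symm

/-- The degrees induced by a graduation on a subspace `W` compatible with it: the numbers `l i` are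
the elements of `Λ` in which `W` has nonzero components, with multiplicities. -/
theorem exists_degreeOn_eq_sum [DecidableEq Λ] [FiniteDimensional F E] (hG : DirectSum.IsInternal G)
    (hW : W ≤ ⨆ i, W ⊓ G i) : ∃ l : Fin (finrank F W) → Λ, ∀ w : Λ → ℝ,
      degreeOn (fun x ↦ ⨆ (i : Λ) (_ : x ≤ w i), G i) W = ∑ i, w (l i) := by
  have hind := hG.submodule_iSupIndep
  have hsup : ⨆ i, (G i).submoduleOf W = ⊤ := by
    rw [← submoduleOf_iSup_inf, Submodule.submoduleOf_eq_top]
    exact hW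
  have hind' : iSupIndep fun i ↦ (G i).submoduleOf W := by
    rw [iSupIndep_iff_finsetSum_eq_zero_imp_eq_zero] at hind ⊢
    intro S v hv hsum i hi
    have := hind S (fun i ↦ (v i : E)) hv (by simpa using congr_arg (fun x : W ↦ (x : E)) hsum) i hi
    exact Subtype.ext this
  obtain ⟨b, l, hbl⟩ := exists_filOf_of_isInternal _
    (DirectSum.isInternal_submodule_of_iSupIndep_of_iSup_eq_top hind' hsup)
  refine ⟨l, fun w ↦ ?_⟩
  have h1 : restrict (fun x ↦ ⨆ (i : Λ) (_ : x ≤ w i), G i) W = filOf b (w ∘ l) := by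
    rw [hbl]
    funext x
    have h2 := inf_biSup_eq hG.submodule_iSupIndep hW {i | x ≤ w i}
    calc restrict (fun x ↦ ⨆ (i : Λ) (_ : x ≤ w i), G i) W x
        = (W ⊓ ⨆ i ∈ {i | x ≤ w i}, G i).submoduleOf W := by
          rw [Submodule.submoduleOf, Submodule.comap_inf, Submodule.comap_subtype_self, top_inf_eq]
          rfl
      _ = ⨆ i ∈ {i | x ≤ w i}, (G i).submoduleOf W := by
          rw [h2]
          have h3 : ∀ i, ⨆ (_ : i ∈ {i | x ≤ w i}), W ⊓ G i ≤ W := fun i ↦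
            iSup_le fun _ ↦ inf_le_left
          calc (⨆ i ∈ {i | x ≤ w i}, W ⊓ G i).submoduleOf W
              = (⨆ i, W ⊓ ⨆ (_ : i ∈ {i | x ≤ w i}), W ⊓ G i).submoduleOf W := by
                simp only [inf_eq_right.2 (h3 _)]
            _ = _ := by
                rw [submoduleOf_iSup_inf]
                exact iSup_congr fun i ↦ submoduleOf_iSup_inf _
  rw [degreeOn, h1, degree_filOf]
  rfl

end Graduations

section NewtonFiltrations

variable {p : ℕ} [Fact p.Prime] {k : Type*} [Field k] [CharP k p] [PerfectRing k p]
variable {V : Type*} [AddCommGroup V] [WittVector.Isocrystal p k V]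

theorem isStable_iff_le_comap {W : Submodule K(p, k) V} :
    IsStable p k W ↔
      W ≤ W.comap (WittVector.Isocrystal.frobenius p k : V ≃ᶠˡ[p, k] V).toLinearMap :=
  Iff.rfl

theorem IsStable.iSup {ι : Sort*} {A : ι → Submodule K(p, k) V} (hA : ∀ i, IsStable p k (A i)) :
    IsStable p k (⨆ i, A i) :=
  isStable_iff_le_comap.2 (iSup_le fun i ↦
    (isStable_iff_le_comap.1 (hA i)).trans (Submodule.comap_mono (le_iSup A i)))

theorem IsStable.sup {W W' : Submodule K(p, k) V} (hW : IsStable p k W) (hW' : IsStable p k W') :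
    IsStable p k (W ⊔ W') := by
  rw [sup_eq_iSup]
  exact IsStable.iSup fun b ↦ by cases b <;> assumption

theorem IsStable.inf {W W' : Submodule K(p, k) V} (hW : IsStable p k W) (hW' : IsStable p k W') :
    IsStable p k (W ⊓ W') :=
  fun x hx ↦ ⟨hW x hx.1, hW' x hx.2⟩

theorem isStable_top : IsStable p k (⊤ : Submodule K(p, k) V) := fun _ _ ↦ trivial

theorem isStable_bot : IsStable p k (⊥ : Submodule K(p, k) V) := fun x hx ↦ by
  rw [Submodule.mem_bot] at hx ⊢
  rw [hx]
  exact (WittVector.Isocrystal.frobenius p k : V ≃ᶠˡ[p, k] V).map_zero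

variable (p k V)

theorem newton_eq : newton p k V = fun x ↦ ⨆ (η : ℚ) (_ : x ≤ (η : ℝ)), slopePart p k V η := rfl

theorem newtonOpp_eq :
    newtonOpp p k V = fun x ↦ ⨆ (η : ℚ) (_ : x ≤ -(η : ℝ)), slopePart p k V η := by
  funext x
  refine (Equiv.neg ℚ).iSup_congr fun η ↦ ?_
  simp

variable [FiniteDimensional K(p, k) V]

theorem newton_mem : newton p k V ∈ filtrations rationals K(p, k) V := by
  obtain ⟨b, l, hbl⟩ := exists_filOf_of_isInternal _ (isInternal_slopePart p k V)
  rw [newton_eq, ← hbl fun η ↦ (η : ℝ)]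
  exact filOf_mem_filtrations b _ fun i ↦ ⟨l i, rfl⟩

theorem newtonOpp_mem : newtonOpp p k V ∈ filtrations rationals K(p, k) V := by
  obtain ⟨b, l, hbl⟩ := exists_filOf_of_isInternal _ (isInternal_slopePart p k V)
  rw [newtonOpp_eq, ← hbl fun η ↦ -(η : ℝ)]
  exact filOf_mem_filtrations b _ fun i ↦ ⟨-l i, by simp⟩

theorem newtonOpp_mem_stableFiltrations : newtonOpp p k V ∈ stableFiltrations p k V rationals :=
  ⟨newtonOpp_mem p k V, fun _ ↦ IsStable.iSup fun _ ↦ IsStable.iSup fun _ ↦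
    isStable_slopePart p k V _⟩

variable {p k V}

/-- On stable subspaces, which are compatible with the slope decomposition, passing to the opposed
Newton filtration changes the sign of the degrees. -/
theorem IsStable.degreeOn_newtonOpp {W : Submodule K(p, k) V} (hW : IsStable p k W) :
    degreeOn (newtonOpp p k V) W = -degreeOn (newton p k V) W ∧
      degreeOn (newtonOpp p k V) W ∈ rationals := by
  obtain ⟨l, hl⟩ := exists_degreeOn_eq_sum (isInternal_slopePart p k V) hW.le_iSup_inf_slopePart
  rw [newtonOpp_eq, newton_eq, hl fun η ↦ -(η : ℝ), hl fun η ↦ (η : ℝ), Finset.sum_neg_distrib]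
  exact ⟨rfl, -∑ i, l i, by simp⟩

/-- The degrees of both Newton filtrations are supermodular and they are opposite, hence they are
modular on stable subspaces. -/
theorem IsStable.degreeOn_newton_modular {W W' : Submodule K(p, k) V} (hW : IsStable p k W)
    (hW' : IsStable p k W') :
    degreeOn (newton p k V) (W ⊔ W') + degreeOn (newton p k V) (W ⊓ W') =
      degreeOn (newton p k V) W + degreeOn (newton p k V) W' := by
  have h1 := degreeOn_supermodular (newton_mem p k V) W W'
  have h2 := degreeOn_supermodular (newtonOpp_mem p k V) W W'
  rw [hW.degreeOn_newtonOpp.1, hW'.degreeOn_newtonOpp.1, (hW.sup hW').degreeOn_newtonOpp.1,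
    (hW.inf hW').degreeOn_newtonOpp.1] at h2
  linarith

end NewtonFiltrations

/-! ### Extension of scalars of filtrations -/

section BaseChange

variable {F : Type*} [Field F] {E : Type*} [AddCommGroup E] [Module F E]
  (L : Type*) [Field L] [Algebra F L]

theorem baseChange_span_image {ι : Type*} (b : Basis ι F E) (S : Set ι) :
    (Submodule.span F (b '' S)).baseChange L = Submodule.span L (b.baseChange L '' S) := by
  rw [Submodule.baseChange_span, Set.image_image]
  congr 1
  exact Set.image_congr fun i _ ↦ (Basis.baseChange_apply L b i).symm

theorem baseChange_filOf {ι : Type*} (b : Basis ι F E) (w : ι → ℝ) :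
    baseChange L (filOf b w) = filOf (b.baseChange L) w :=
  funext fun x ↦ baseChange_span_image L b {i | x ≤ w i}

theorem baseChange_mem [FiniteDimensional F E] {Γ : AddSubgroup ℝ} {A : ℝ → Submodule F E}
    (hA : A ∈ filtrations Γ F E) : baseChange L A ∈ filtrations Γ L (L ⊗[F] E) := by
  obtain ⟨b, w, rfl, hw⟩ := exists_filOf_of_mem hA
  rw [baseChange_filOf]
  exact filOf_mem_filtrations _ _ hw

/-- Extension of scalars respects sums and intersections, as is seen on a basis adapted to both
subspaces. -/
theorem baseChange_sup_inf [FiniteDimensional F E] (W W' : Submodule F E) :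
    (W ⊔ W').baseChange L = W.baseChange L ⊔ W'.baseChange L ∧
      (W ⊓ W').baseChange L = W.baseChange L ⊓ W'.baseChange L := by
  obtain ⟨b, hb⟩ := exists_basis_isAdapted _ (F := F) (E := E) rfl {W} {W'}
    (Set.subsingleton_singleton.isChain) (Set.subsingleton_singleton.isChain)
  obtain ⟨S, hS⟩ := hb W (by simp)
  obtain ⟨T, hT⟩ := hb W' (by simp)
  rw [hS, hT, span_image_sup_span_image, span_image_inf_span_image]
  simp only [baseChange_span_image, span_image_sup_span_image, span_image_inf_span_image, and_self]

variable {L}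

theorem scalarProduct_baseChange [FiniteDimensional F E] {Γ Δ : AddSubgroup ℝ}
    {A : ℝ → Submodule L (L ⊗[F] E)} (hA : A ∈ filtrations Γ L (L ⊗[F] E))
    {Ξ : ℝ → Submodule F E} (hΞ : Ξ ∈ filtrations Δ F E) :
    scalarProduct A (baseChange L Ξ) = choquet Ξ fun W ↦ degreeOn A (W.baseChange L) := by
  rw [scalarProduct_eq_choquet hA (baseChange_mem L hΞ)]
  have h1 : ∀ γ, plus (baseChange L Ξ) γ = (plus Ξ γ).baseChange L :=
    plus_comp hΞ (T := fun W ↦ W.baseChange L) fun W W' h ↦ Submodule.baseChange_mono L h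
  unfold choquet
  simp only [h1]
  rfl

end BaseChange

/-! ### The lattice of weakly admissible subspaces -/

section WeaklyAdmissible

variable {p : ℕ} [Fact p.Prime] {k : Type*} [Field k] [CharP k p] [PerfectRing k p]
  {L : Type*} [Field L] [Algebra K(p, k) L]
  {V : Type*} [AddCommGroup V] [WittVector.Isocrystal p k V] [FiniteDimensional K(p, k) V]
  {Γ : AddSubgroup ℝ} {FH : ℝ → Submodule L (L ⊗[K(p, k)] V)}

omit [FiniteDimensional K(p, k) V] in
theorem IsWeaklyAdmissible.sub_iff (hwa : IsWeaklyAdmissible p k FH) {W : Submodule K(p, k) V} :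
    IsWeaklyAdmissibleSub p k FH W ↔
      IsStable p k W ∧ degreeOn FH (W.baseChange L) = degreeOn (newton p k V) W :=
  ⟨fun h ↦ ⟨h.1, h.2.1⟩, fun h ↦ ⟨h.1, h.2, fun W' _ hW' ↦ hwa.2 W' hW'⟩⟩

theorem IsWeaklyAdmissible.bot (hwa : IsWeaklyAdmissible p k FH)
    (hFH : FH ∈ filtrations Γ L (L ⊗[K(p, k)] V)) :
    IsWeaklyAdmissibleSub p k FH (⊥ : Submodule K(p, k) V) := by
  rw [hwa.sub_iff, Submodule.baseChange_bot, degreeOn_bot hFH, degreeOn_bot (newton_mem p k V)]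
  exact ⟨isStable_bot, rfl⟩

theorem IsWeaklyAdmissible.top (hwa : IsWeaklyAdmissible p k FH)
    (hFH : FH ∈ filtrations Γ L (L ⊗[K(p, k)] V)) :
    IsWeaklyAdmissibleSub p k FH (⊤ : Submodule K(p, k) V) := by
  rw [hwa.sub_iff, Submodule.baseChange_top, degreeOn_top hFH, degreeOn_top (newton_mem p k V)]
  exact ⟨isStable_top, hwa.1⟩

/-- Weakly admissible subspaces form a lattice: the degree of `FH` is supermodular, that of the
Newton filtration is modular on stable subspaces, and the former is bounded by the latter. -/
theorem IsWeaklyAdmissible.sup_inf (hwa : IsWeaklyAdmissible p k FH)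
    (hFH : FH ∈ filtrations Γ L (L ⊗[K(p, k)] V)) {W W' : Submodule K(p, k) V}
    (hW : IsWeaklyAdmissibleSub p k FH W) (hW' : IsWeaklyAdmissibleSub p k FH W') :
    IsWeaklyAdmissibleSub p k FH (W ⊔ W') ∧ IsWeaklyAdmissibleSub p k FH (W ⊓ W') := by
  have h1 := degreeOn_supermodular hFH (W.baseChange L) (W'.baseChange L)
  rw [← (baseChange_sup_inf L W W').1, ← (baseChange_sup_inf L W W').2, hW.2.1, hW'.2.1] at h1
  have h2 := hW.1.degreeOn_newton_modular hW'.1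
  have h3 := hwa.2 _ (hW.1.sup hW'.1)
  have h4 := hwa.2 _ (hW.1.inf hW'.1)
  rw [hwa.sub_iff, hwa.sub_iff]
  exact ⟨⟨hW.1.sup hW'.1, by linarith⟩, ⟨hW.1.inf hW'.1, by linarith⟩⟩

omit [FiniteDimensional K(p, k) V] in
theorem admissibleFiltrations_eq (Δ : AddSubgroup ℝ) :
    admissibleFiltrations p k FH Δ = {Ξ ∈ filtrations Δ K(p, k) V |
      ∀ γ, Ξ γ ∈ {W | IsWeaklyAdmissibleSub p k FH W}} :=
  Set.ext fun _ ↦ ⟨fun h ↦ ⟨h.1.1, h.2⟩, fun h ↦ ⟨⟨h.1, fun γ ↦ (h.2 γ).1⟩, h.2⟩⟩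

/-- Both scalar products are obtained from the degrees of the steps of `Ξ`, by the same formula,
which is strictly increasing. -/
theorem IsWeaklyAdmissible.mem_admissibleFiltrations_iff (hwa : IsWeaklyAdmissible p k FH)
    (hFH : FH ∈ filtrations Γ L (L ⊗[K(p, k)] V)) {Δ : AddSubgroup ℝ}
    {Ξ : ℝ → Submodule K(p, k) V} (hΞ : Ξ ∈ stableFiltrations p k V Δ) :
    Ξ ∈ admissibleFiltrations p k FH Δ ↔
      scalarProduct FH (baseChange L Ξ) = scalarProduct (newton p k V) Ξ := by
  rw [scalarProduct_baseChange hFH hΞ.1, scalarProduct_eq_choquet (newton_mem p k V) hΞ.1]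
  constructor
  · exact fun h ↦ choquet_congr hΞ.1 fun γ ↦ (h.2 γ).2.1
  · intro h
    refine ⟨hΞ, fun γ ↦ hwa.sub_iff.2 ⟨hΞ.2 γ, ?_⟩⟩
    exact (choquet_mono hΞ.1 (hwa.bot hFH).2.1 (hwa.top hFH).2.1 fun γ ↦ hwa.2 _ (hΞ.2 γ)).2 h γ

/-- A quotient by a weakly admissible subspace is weakly admissible if and only if its inverse image
is, by additivity of the degrees. -/
theorem IsWeaklyAdmissible.subquotient_iff (hwa : IsWeaklyAdmissible p k FH)
    (hFH : FH ∈ filtrations Γ L (L ⊗[K(p, k)] V)) {U W : Submodule K(p, k) V}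
    (hU : IsWeaklyAdmissibleSub p k FH U) (hUW : U ≤ W) :
    IsWeaklyAdmissibleSubquotient p k FH U W ↔ IsWeaklyAdmissibleSub p k FH W := by
  have hH : ∀ W', U ≤ W' → degreeSubquotient FH (U.baseChange L) (W'.baseChange L) =
      degreeOn FH (W'.baseChange L) - degreeOn FH (U.baseChange L) := fun W' h ↦
    degreeSubquotient_eq hFH (Submodule.baseChange_mono L h)
  have hN : ∀ W', U ≤ W' → degreeSubquotient (newton p k V) U W' =
      degreeOn (newton p k V) W' - degreeOn (newton p k V) U := fun W' h ↦
    degreeSubquotient_eq (newton_mem p k V) h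
  constructor
  · rintro ⟨-, hW, -, h, -⟩
    rw [hH W hUW, hN W hUW, hU.2.1] at h
    exact hwa.sub_iff.2 ⟨hW, by linarith⟩
  · intro hW
    refine ⟨hU.1, hW.1, hUW, ?_, fun W' hUW' _ hW' ↦ ?_⟩
    · rw [hH W hUW, hN W hUW, hU.2.1, hW.2.1]
    · rw [hH W' hUW', hN W' hUW', hU.2.1]
      exact sub_le_sub_right (hwa.2 W' hW') _

theorem farguesSlope_eq {U W : Submodule K(p, k) V} (hUW : U ≤ W) :
    farguesSlope p k U W =
      (degreeOn (newtonOpp p k V) W - degreeOn (newtonOpp p k V) U) / (sdim W - sdim U) := by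
  rw [farguesSlope, degreeSubquotient_eq (newtonOpp_mem p k V) hUW,
    finrank_quotient_eq_sdim_sub hUW]

/-- The Fargues filtration is the Harder-Narasimhan filtration of the lattice of weakly admissible
subspaces. -/
theorem IsWeaklyAdmissible.isFargues_iff (hwa : IsWeaklyAdmissible p k FH)
    (hFH : FH ∈ filtrations Γ L (L ⊗[K(p, k)] V)) {Ξ : ℝ → Submodule K(p, k) V}
    (hΞ : Ξ ∈ filtrations ⊤ K(p, k) V) :
    IsFargues p k FH Ξ ↔
      IsHarderNarasimhan {W | IsWeaklyAdmissibleSub p k FH W} (degreeOn (newtonOpp p k V)) Ξ := by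
  rw [IsFargues, admissibleFiltrations_eq, IsHarderNarasimhan]
  constructor
  · rintro ⟨⟨-, hC⟩, h⟩
    refine ⟨hC, fun γ ↦ ?_⟩
    have hU := plus_mem_of_steps hΞ hC γ
    have hle : plus Ξ γ ≤ Ξ γ := plus_le (antitone_of_mem hΞ) γ
    by_cases hne : plus Ξ γ = Ξ γ
    · refine ⟨fun W _ h1 h2 ↦ ?_, by simp [hne]⟩
      rw [le_antisymm h1 (hne ▸ h2)]
      simp
    · obtain ⟨⟨hlt, -, hss⟩, hγ⟩ := h γ hne
      have hpos : ∀ W, plus Ξ γ < W → 0 < sdim W - sdim (plus Ξ γ) := fun W h1 ↦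
        sub_pos.2 (sdim_strictMono h1)
      refine ⟨fun W hW h1 h2 ↦ ?_, ?_⟩
      · rcases h1.eq_or_lt with h1 | h1
        · simp [← h1]
        · have := hss W h1 h2 ((hwa.subquotient_iff hFH hU h1.le).2 hW)
          rwa [hγ, farguesSlope_eq h1.le, div_le_iff₀ (hpos W h1)] at this
      · rwa [farguesSlope_eq hlt.le, div_eq_iff (hpos _ hlt).ne'] at hγ
  · rintro ⟨hC, h⟩
    refine ⟨⟨hΞ, hC⟩, fun γ hne ↦ ?_⟩
    have hU := plus_mem_of_steps hΞ hC γ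
    have hlt : plus Ξ γ < Ξ γ := lt_of_le_of_ne (plus_le (antitone_of_mem hΞ) γ) hne
    have hpos : ∀ W, plus Ξ γ < W → 0 < sdim W - sdim (plus Ξ γ) := fun W h1 ↦
      sub_pos.2 (sdim_strictMono h1)
    have hγ : farguesSlope p k (plus Ξ γ) (Ξ γ) = γ := by
      rw [farguesSlope_eq hlt.le, div_eq_iff (hpos _ hlt).ne']
      exact (h γ).2
    refine ⟨⟨hlt, (hwa.subquotient_iff hFH hU hlt.le).2 (hC γ), fun W h1 h2 hW ↦ ?_⟩, hγ⟩
    rw [hγ, farguesSlope_eq h1.le, div_le_iff₀ (hpos W h1)]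
    exact (h γ).1 W ((hwa.subquotient_iff hFH hU h1.le).1 hW) h1.le h2

end WeaklyAdmissible

end FilteredIsocrystal

theorem lemma5p2 (p : ℕ) [Fact p.Prime] (k : Type*) [Field k] [CharP k p] [PerfectRing k p]
    (L : Type*) [Field L] [Algebra K(p, k) L]
    (V : Type*) [AddCommGroup V] [WittVector.Isocrystal p k V] [FiniteDimensional K(p, k) V]
    (Γ : AddSubgroup ℝ) (hΓ : Γ ≠ ⊥)
    (FH : ℝ → Submodule L (L ⊗[K(p, k)] V)) (hFH : FH ∈ filtrations Γ L (L ⊗[K(p, k)] V))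
    (hwa : IsWeaklyAdmissible p k FH) :
    (∀ Δ : AddSubgroup ℝ, Δ ≠ ⊥ →
      admissibleFiltrations p k FH Δ =
        {Ξ ∈ stableFiltrations p k V Δ |
          scalarProduct FH (baseChange L Ξ) = scalarProduct (newton p k V) Ξ}) ∧
    IsClosedIn (filtrations ⊤ K(p, k) V) (admissibleFiltrations p k FH ⊤) ∧
    IsConvexIn (filtrations ⊤ K(p, k) V) (admissibleFiltrations p k FH ⊤) ∧
    newtonOpp p k V ∈ stableFiltrations p k V rationals ∧
    ∃ FF : ℝ → Submodule K(p, k) V,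
      (∀ Ξ, IsFargues p k FH Ξ ↔ Ξ = FF) ∧
      FF ∈ admissibleFiltrations p k FH rationals ∧
      IsConvexProjection (admissibleFiltrations p k FH ⊤) (newtonOpp p k V) FF := by
  have hbot := hwa.bot hFH
  have htop := hwa.top hFH
  have hsup : ∀ W ∈ {W | IsWeaklyAdmissibleSub p k FH W},
      ∀ W' ∈ {W | IsWeaklyAdmissibleSub p k FH W},
        W ⊔ W' ∈ {W | IsWeaklyAdmissibleSub p k FH W} :=
    fun _ hW _ hW' ↦ (hwa.sup_inf hFH hW hW').1
  have hinf : ∀ W ∈ {W | IsWeaklyAdmissibleSub p k FH W},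
      ∀ W' ∈ {W | IsWeaklyAdmissibleSub p k FH W},
        W ⊓ W' ∈ {W | IsWeaklyAdmissibleSub p k FH W} :=
    fun _ hW _ hW' ↦ (hwa.sup_inf hFH hW hW').2
  have hδ : ∀ W ∈ {W | IsWeaklyAdmissibleSub p k FH W},
      ∀ W' ∈ {W | IsWeaklyAdmissibleSub p k FH W},
        degreeOn (newtonOpp p k V) (W ⊔ W') + degreeOn (newtonOpp p k V) (W ⊓ W') =
          degreeOn (newtonOpp p k V) W + degreeOn (newtonOpp p k V) W' := by
    intro W hW W' hW'
    rw [hW.1.degreeOn_newtonOpp.1, hW'.1.degreeOn_newtonOpp.1,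
      (hW.1.sup hW'.1).degreeOn_newtonOpp.1, (hW.1.inf hW'.1).degreeOn_newtonOpp.1]
    linarith [hW.1.degreeOn_newton_modular hW'.1]
  have hN := newtonOpp_mem p k V
  refine ⟨fun Δ _ ↦ Set.ext fun Ξ ↦ ⟨fun h ↦ ⟨h.1, ?_⟩, fun h ↦ ?_⟩, ?_, ?_,
    newtonOpp_mem_stableFiltrations p k V, ?_⟩
  · exact (hwa.mem_admissibleFiltrations_iff hFH h.1).1 h
  · exact (hwa.mem_admissibleFiltrations_iff hFH h.1).2 h.2
  · rw [admissibleFiltrations_eq]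
    exact isClosedIn_of_steps _
  · rw [admissibleFiltrations_eq]
    exact isConvexIn_of_steps hbot hsup hinf
  · obtain ⟨FF, hFF, hHN⟩ := exists_isHarderNarasimhan hbot htop hsup hinf (degreeOn_bot hN) hδ
      ((finite_range_degreeOn hN).subset (by rintro _ ⟨W, rfl⟩; exact ⟨W, rfl⟩))
    have hlt : ∀ {Ξ}, Ξ ∈ filtrations ⊤ K(p, k) V →
        IsHarderNarasimhan {W | IsWeaklyAdmissibleSub p k FH W} (degreeOn (newtonOpp p k V)) Ξ →
        ∀ {Ξ'}, Ξ' ∈ admissibleFiltrations p k FH ⊤ → Ξ' ≠ Ξ →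
          filDist (newtonOpp p k V) Ξ < filDist (newtonOpp p k V) Ξ' := by
      intro Ξ hΞ h Ξ' hΞ' hne
      rw [admissibleFiltrations_eq] at hΞ'
      exact h.filDist_lt hΞ hbot htop hsup hinf hδ (mem_filtrations_top hN) (fun _ _ ↦ rfl) hΞ'.1
        hΞ'.2 hne
    have hFF' : FF ∈ admissibleFiltrations p k FH ⊤ := by
      rw [admissibleFiltrations_eq]
      exact ⟨hFF, hHN.1⟩
    refine ⟨FF, fun Ξ ↦ ⟨fun h ↦ ?_, ?_⟩, ?_, hFF', fun C hC hne ↦ hlt hFF hHN hC hne⟩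
    · -- both filtrations are the point nearest to the opposed Newton filtration
      by_contra hne
      have hΞ := h.1.1.1
      exact (hlt hFF hHN h.1 hne).asymm
        (hlt hΞ ((hwa.isFargues_iff hFH hΞ).1 h) hFF' (Ne.symm hne))
    · rintro rfl
      exact (hwa.isFargues_iff hFH hFF).2 hHN
    · rw [admissibleFiltrations_eq]
      exact ⟨hHN.mem_rationals hFF fun W hW ↦ hW.1.degreeOn_newtonOpp.2, hHN.1⟩
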